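/- **Setting.** Let $\mathcal T$ (prompts) and $\mathcal X$ (outputs) be measurable spaces, $G\ge 1$, and let $P_g(\cdot\mid t)$, $g\in[G]$, be Markov kernels from $\mathcal T$ to $\mathcal X$ (the generative models). Let $k:\mathcal T\times\mathcal T\to\mathbb R$ be a measurable positive definite kernel with $k(t,t)=1$ for all $t$ and with RKHS $\mathcal H$. For each $g$ let $s_g,D_g\in\mathcal H$ with $\|s_g\|_{\mathcal H}\le B_s$, $\|D_g\|_{\mathcal H}\le B_D$. For $\lambda\ge 0$ put $J_g(t)=s_g(t)-\lambda D_g(t)$. Fix a horizon $T\ge 2$, a ridge $\alpha>0$, $\sigma\ge 0$, $\delta\in(0,1)$, and set $M=\lceil\log_2T\rceil$, $\eta_\sigma=\sigma\sqrt{2\log(2GMT/\delta)}$, $\beta^{(s)}=B_s\sqrt\alpha+\eta_\sigma$, $\beta^{(D)}=B_D\sqrt\alpha+\eta_\sigma$, $b=B_s+\lambda B_D$. For a finite index set $\Psi$ of rounds with prompts $(t_j)_{j\in\Psi}$ and labels $y_\Psi$ let $K_\Psi=[k(t_i,t_j)]_{i,j\in\Psi}$, $k_\Psi(t)=[k(t,t_j)]_{j\in\Psi}$,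 and $$\hat\mu(t;\Psi)=k_\Psi(t)^\top(K_\Psi+\alpha I)^{-1}y_\Psi,\qquad \hat\sigma^2(t;\Psi)=\alpha^{-1}\bigl(k(t,t)-k_\Psi(t)^\top(K_\Psi+\alpha I)^{-1}k_\Psi(t)\bigr),$$ $$\gamma(\Psi)=\tfrac12\log\det(I+\alpha^{-1}K_\Psi),\qquad d(\Psi)=\operatorname{tr}\bigl(K_\Psi(K_\Psi+\alpha I)^{-1}\bigr).$$ **Algorithm (Sup-DAK-UCB).** For all arms $g$, stages $m\ge 1$ and targets $\tau\in\{s,D\}$ start with $\Psi_g^{m,(\tau)}=\emptyset$. In round $i=1,\dots,T$ a prompt $t_i$ arrives; set $m=1$, $\hat{\mathcal G}^1=[G]$, and repeat: for $g\in\hat{\mathcal G}^m$ compute the KRR predictions $\hat s_g,\hat\sigma^{(s)}_g$ and $\hat D_g,\hat\sigma^{(D)}_g$ at $t_i$ from $\Psi_g^{m,(s)}$ and $\Psi_g^{m,(D)}$, the score $\tilde J_g=(\hat s_g+\beta^{(s)}\hat\sigma_g^{(s)})-\lambda(\hat D_g-\beta^{(D)}\hat\sigma_g^{(D)})$ and the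 width $w_g=\beta^{(s)}\hat\sigma_g^{(s)}+\lambda\beta^{(D)}\hat\sigma_g^{(D)}$. - If $\max_g w_g\le T^{-1/2}$: let $g_i$ maximize $\tilde J_g$ over $\hat{\mathcal G}^m$ and stop (exploit). - Else if $\max_g w_g\le 2^{1-m}$: set $\hat{\mathcal G}^{m+1}=\{g\in\hat{\mathcal G}^m:\tilde J_g\ge\max_{h\in\hat{\mathcal G}^m}\tilde J_h-2^{2-m}\}$ and $m\leftarrow m+1$. - Else: choose $g_i\in\hat{\mathcal G}^m$ with $w_{g_i}>2^{1-m}$, append $i$ to $\Psi_{g_i}^{m,(s)}$ and $\Psi_{g_i}^{m,(D)}$, and stop (explore). Arms are picked by a fixed measurable rule that depends only on the set of eligible arms and on the compared values (the scores when exploiting, the widths when exploring). Then the output $x_i$ of model $g_i$ and a fidelity observation $y_i^{(s)}$ are revealed, and a diversity label $y_i^{(D)}=\psi_{g_i}(\mathcal D_{g_i}^{m},t_i,x_i)$ is formed by an arbitrary measurable rule $\psi$ from $(t_i,x_i)$ and the frozen archive $\mathcal D_{g}^{m}$, the list of pairs $(t_j,x_j)$ with $g_j=g$ from the rounds before the first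 round in which stage $m$ was entered. **Assumptions on the data.** The prompts are i.i.d. with law $P_T$, and $t_i$ is independent of everything observed before round $i$. Given the past and $t_i$, $x_i$ has law $P_{g_i}(\cdot\mid t_i)$ and $y_i^{(s)}$ is drawn from a fixed kernel $Q_{g_i}(\cdot\mid t_i,x_i)$. Both observations are conditionally $\sigma$-sub-Gaussian: for $f^{(s)}=s$, $f^{(D)}=D$, $\tau\in\{s,D\}$, every round $i$ and all $u\in\mathbb R$, almost surely $$\mathbb E\bigl[\exp\bigl(u\,(y_i^{(\tau)}-f^{(\tau)}_{g_i}(t_i))\bigr)\,\big|\,\text{past},t_i\bigr]\le e^{u^2\sigma^2/2}$$ (in particular the labels are conditionally unbiased). **Theorem (DAK-UCB regret).** Let $\mathrm{Regret}(T)=\sum_{i=1}^T\bigl(\max_gJ_g(t_i)-J_{g_i}(t_i)\bigr)$, $\Gamma_T^{(\tau)}=\max_{g,m}\gamma(\Psi_g^{m,(\tau)})$ and $d_{\mathrm{eff}}^{(\tau)}=\max_{g,m}d(\Psi_g^{m,(\tau)})$, with the index sets after $T$ rounds. With probability at least $1-\delta$, all of the following hold: $$\mathrm{(i)}\quad \mathrm{Regret}(T)\le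 16\Bigl(\sqrt T+(1+b)\sqrt{1+\tfrac1\alpha}\,\Bigl[\beta^{(s)}\sqrt{GMT\,\Gamma_T^{(s)}}+\lambda\,\beta^{(D)}\sqrt{GMT\,\Gamma_T^{(D)}}\Bigr]\Bigr);$$ (ii) if $b\sqrt T>1$, then $$\mathrm{Regret}(T)\le 16\,(1+b+b^{-1})\sqrt{1+\tfrac1\alpha}\,\Bigl[\beta^{(s)}\sqrt{GMT\,\Gamma_T^{(s)}}+\lambda\,\beta^{(D)}\sqrt{GMT\,\Gamma_T^{(D)}}\Bigr];$$ (iii) with $L=1+\log(1+T/\alpha)$, $$\mathrm{Regret}(T)\le 16\Bigl(\sqrt T+(1+b)\sqrt{1+\tfrac1\alpha}\,\sqrt{L}\,(1+\sqrt\alpha)\Bigl[(B_s+\eta_\sigma)\sqrt{GMT\,d_{\mathrm{eff}}^{(s)}}+\lambda\,(B_D+\eta_\sigma)\sqrt{GMT\,d_{\mathrm{eff}}^{(D)}}\Bigr]\Bigr).$$ Thus, up to factors that are logarithmic in $G,T,1/\delta$ or depend only on $B_s,B_D,\sigma,\alpha,\lambda$, the regret is $\widetilde O\bigl(\sqrt{GT\,\Gamma_T^{(s)}}\bigr)+\lambda\,\widetilde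 O\bigl(\sqrt{GT\,\Gamma_T^{(D)}}\bigr)$, and likewise with $d_{\mathrm{eff}}^{(\tau)}$. -/

import Mathlib

open MeasureTheory ProbabilityTheory
open scoped NNReal ENNReal

namespace SupDAK

noncomputable section

/-! ### Kernel ridge regression on a finite family of prompts -/

section KRR

variable {𝒯 : Type*} {n : ℕ}

/-- Gram matrix `K_Ψ` of the prompts `p`. -/
def gram (k : 𝒯 → 𝒯 → ℝ) (p : Fin n → 𝒯) : Matrix (Fin n) (Fin n) ℝ :=
  Matrix.of fun i j => k (p i) (p j)

/-- The matrix `K_Ψ + α I`. -/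
def ridge (k : 𝒯 → 𝒯 → ℝ) (α : ℝ) (p : Fin n → 𝒯) : Matrix (Fin n) (Fin n) ℝ :=
  gram k p + α • (1 : Matrix (Fin n) (Fin n) ℝ)

/-- The vector `k_Ψ(t)`. -/
def kvec (k : 𝒯 → 𝒯 → ℝ) (p : Fin n → 𝒯) (t : 𝒯) : Fin n → ℝ := fun i => k t (p i)

/-- KRR predictor `k_Ψ(t)ᵀ (K_Ψ + α I)⁻¹ y`. -/
def krrMean (k : 𝒯 → 𝒯 → ℝ) (α : ℝ) (p : Fin n → 𝒯) (y : Fin n → ℝ) (t : 𝒯) : ℝ :=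
  kvec k p t ⬝ᵥ ((ridge k α p)⁻¹.mulVec y)

/-- The squared posterior deviation `φ(t)ᵀ A⁻¹ φ(t)`, with `A = Φᵀ Φ + α I`, in its kernel form
`α⁻¹ (k(t,t) - k_Ψ(t)ᵀ (K_Ψ + α I)⁻¹ k_Ψ(t))`; see `krrVar_eq_inner`. -/
def krrVar (k : 𝒯 → 𝒯 → ℝ) (α : ℝ) (p : Fin n → 𝒯) (t : 𝒯) : ℝ :=
  α⁻¹ * (k t t - kvec k p t ⬝ᵥ ((ridge k α p)⁻¹.mulVec (kvec k p t)))

/-- Information gain `γ(Ψ) = ½ log det (I + α⁻¹ K_Ψ)`. -/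
def infoGain (k : 𝒯 → 𝒯 → ℝ) (α : ℝ) (p : Fin n → 𝒯) : ℝ :=
  1 / 2 * Real.log (Matrix.det ((1 : Matrix (Fin n) (Fin n) ℝ) + α⁻¹ • gram k p))

/-- Effective dimension `tr (K_Ψ (K_Ψ + α I)⁻¹)`. -/
def effDim (k : 𝒯 → 𝒯 → ℝ) (α : ℝ) (p : Fin n → 𝒯) : ℝ :=
  Matrix.trace (gram k p * (ridge k α p)⁻¹)

theorem gram_posSemidef {H : Type*} [NormedAddCommGroup H] [InnerProductSpace ℝ H]
    (k : 𝒯 → 𝒯 → ℝ) (φ : 𝒯 → H) (hk : ∀ t t', k t t' = inner ℝ (φ t) (φ t'))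
    (p : Fin n → 𝒯) : (gram k p).PosSemidef := by
  have : gram k p = Matrix.gram ℝ (fun i => φ (p i)) := by
    ext i j; simp [gram, Matrix.gram, hk]
  rw [this]
  exact Matrix.posSemidef_gram ℝ _

theorem ridge_isUnit_det {H : Type*} [NormedAddCommGroup H] [InnerProductSpace ℝ H]
    (k : 𝒯 → 𝒯 → ℝ) (φ : 𝒯 → H) (hk : ∀ t t', k t t' = inner ℝ (φ t) (φ t'))
    {α : ℝ} (hα : 0 < α) (p : Fin n → 𝒯) : IsUnit (ridge k α p).det := by
  have h : (ridge k α p).PosDef :=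
    (Matrix.PosDef.one.smul hα).posSemidef_add (gram_posSemidef k φ hk p)
  exact h.det_pos.ne'.isUnit

/-- For every feature map `φ` of `k`: if `A v = φ(t)`, where `A = Φᵀ Φ + α I`, then
`krrVar` is `⟨φ(t), v⟩ = φ(t)ᵀ A⁻¹ φ(t)`. -/
theorem krrVar_eq_inner {H : Type*} [NormedAddCommGroup H] [InnerProductSpace ℝ H]
    (k : 𝒯 → 𝒯 → ℝ) (φ : 𝒯 → H) (hk : ∀ t t', k t t' = inner ℝ (φ t) (φ t'))
    {α : ℝ} (hα : 0 < α) (p : Fin n → 𝒯) (t : 𝒯) (v : H)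
    (hv : (∑ i, inner ℝ (φ (p i)) v • φ (p i)) + α • v = φ t) :
    krrVar k α p t = inner ℝ (φ t) v := by
  have hc : (ridge k α p).mulVec (fun i => inner ℝ (φ (p i)) v) = kvec k p t := by
    ext j
    have := congrArg (fun u => inner ℝ (φ (p j)) u) hv
    simp only [inner_add_right, inner_sum, real_inner_smul_right] at this
    simp only [ridge, Matrix.add_mulVec, Matrix.smul_mulVec, Matrix.one_mulVec, Pi.add_apply,
      Pi.smul_apply, smul_eq_mul, kvec, hk, real_inner_comm (φ (p j)) (φ t), ← this]
    congr 1
    simp [Matrix.mulVec, dotProduct, gram, hk, mul_comm]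
  have hc' : (ridge k α p)⁻¹.mulVec (kvec k p t) = fun i => inner ℝ (φ (p i)) v := by
    rw [← hc, Matrix.mulVec_mulVec, Matrix.nonsing_inv_mul _ (ridge_isUnit_det k φ hk hα p),
      Matrix.one_mulVec]
  have h2 := congrArg (fun u => inner ℝ (φ t) u) hv
  simp only [inner_add_right, inner_sum, real_inner_smul_right] at h2
  rw [krrVar, hc', hk t t, ← h2]
  have : kvec k p t ⬝ᵥ (fun i => inner ℝ (φ (p i)) v)
      = ∑ i, inner ℝ (φ (p i)) v * inner ℝ (φ t) (φ (p i)) := by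
    simp [dotProduct, kvec, hk, mul_comm]
  rw [this]
  field_simp
  ring

end KRR

/-! ### The algorithm -/

/-- The two regression targets: `s` (fidelity) and `D` (diversity). -/
inductive Target
  | fidelity
  | diversity

/-- The record of one finished round.  `stage` is the stage at which the inner loop stopped, and
`appended τ` says whether the round was appended to the index set `Ψ_g^{m,(τ)}` of its arm and
stage. -/
structure Round (𝒯 𝒳 : Type*) (G : ℕ) where
  prompt : 𝒯
  arm : Fin G
  output : 𝒳
  stage : ℕ
  appended : Target → Bool
  label : Target → ℝ

/-- The two-sample archive average
`(max {1, |L|})⁻¹ ∑_{(t',x') ∈ L} k_𝒯(t,t')² k_𝒳(x,x')²`, one possible diversity label rule. -/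
def archiveAverage {𝒯 𝒳 : Type*} (k : 𝒯 → 𝒯 → ℝ) (kX : 𝒳 → 𝒳 → ℝ) (L : List (𝒯 × 𝒳))
    (q : 𝒯 × 𝒳) : ℝ :=
  ((max 1 L.length : ℕ) : ℝ)⁻¹ * (L.map fun p => k q.1 p.1 ^ 2 * kX q.2 p.2 ^ 2).sum

/-- Inputs of Sup-DAK-UCB: horizon, trade-off, ridge, noise level, confidence, RKHS radii, prompt
kernel, the rule that turns a frozen archive snapshot and the current (prompt, output) pair of an
arm into a diversity label (for instance `fun _ => archiveAverage k kX`), and the rule that picks one arm of a set of eligible arms (given the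
values of the arms that are compared). -/
structure Config (𝒯 𝒳 : Type*) (G : ℕ) where
  T : ℕ
  lam : ℝ
  α : ℝ
  σ : ℝ≥0
  δ : ℝ
  B : Target → ℝ
  k : 𝒯 → 𝒯 → ℝ
  divLabel : Fin G → List (𝒯 × 𝒳) → 𝒯 × 𝒳 → ℝ
  pick : (Fin G → ℝ) → Finset (Fin G) → Fin G

section Algorithm

variable {𝒯 𝒳 : Type*} {G : ℕ}

/-- Number of stages `M = ⌈log₂ T⌉`. -/
def Config.M (c : Config 𝒯 𝒳 G) : ℕ := Nat.clog 2 c.T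

/-- `η_σ = σ √(2 log (2 G M T / δ))`. -/
def Config.eta (c : Config 𝒯 𝒳 G) : ℝ :=
  c.σ * √(2 * Real.log (2 * G * c.M * c.T / c.δ))

/-- Confidence radius `β^{(τ)} = B_τ √α + η_σ`. -/
def Config.beta (c : Config 𝒯 𝒳 G) (τ : Target) : ℝ := c.B τ * √c.α + c.eta

open Classical in
/-- The rounds of the history `h` (in chronological order) that belong to `Ψ_g^{m,(τ)}`. -/
def indexSet (h : List (Round 𝒯 𝒳 G)) (τ : Target) (g : Fin G) (m : ℕ) :
    List (Round 𝒯 𝒳 G) :=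
  h.filter fun r => decide (r.appended τ = true ∧ r.arm = g ∧ r.stage = m)

/-- The prompts of a list of rounds. -/
def prompts (L : List (Round 𝒯 𝒳 G)) : Fin L.length → 𝒯 := fun i => (L.get i).prompt

/-- The `τ`-labels of a list of rounds. -/
def labels (τ : Target) (L : List (Round 𝒯 𝒳 G)) : Fin L.length → ℝ :=
  fun i => (L.get i).label τ

/-- KRR prediction for target `τ` and arm `g` at stage `m`. -/
def estimate (c : Config 𝒯 𝒳 G) (h : List (Round 𝒯 𝒳 G)) (t : 𝒯) (τ : Target) (m : ℕ)
    (g : Fin G) : ℝ :=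
  krrMean c.k c.α (prompts (indexSet h τ g m)) (labels τ (indexSet h τ g m)) t

/-- KRR posterior deviation for target `τ` and arm `g` at stage `m`. -/
def deviation (c : Config 𝒯 𝒳 G) (h : List (Round 𝒯 𝒳 G)) (t : 𝒯) (τ : Target) (m : ℕ)
    (g : Fin G) : ℝ :=
  √(krrVar c.k c.α (prompts (indexSet h τ g m)) t)

/-- Optimistic score `(ŝ + β^{(s)} σ̂^{(s)}) - λ (D̂ - β^{(D)} σ̂^{(D)})`. -/
def score (c : Config 𝒯 𝒳 G) (h : List (Round 𝒯 𝒳 G)) (t : 𝒯) (m : ℕ) (g : Fin G) : ℝ :=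
  (estimate c h t .fidelity m g + c.beta .fidelity * deviation c h t .fidelity m g)
    - c.lam * (estimate c h t .diversity m g - c.beta .diversity * deviation c h t .diversity m g)

/-- Width `β^{(s)} σ̂^{(s)} + λ β^{(D)} σ̂^{(D)}`. -/
def width (c : Config 𝒯 𝒳 G) (h : List (Round 𝒯 𝒳 G)) (t : 𝒯) (m : ℕ) (g : Fin G) : ℝ :=
  c.beta .fidelity * deviation c h t .fidelity m g
    + c.lam * (c.beta .diversity * deviation c h t .diversity m g)

open Classical in
/-- Candidate sets: all arms at stage `1`; stage `m + 1` keeps the candidates of stage `m` whose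
score is within `2^(2-m)` of the best one. (Stage `0` does not occur.) -/
def candidates (c : Config 𝒯 𝒳 G) (h : List (Round 𝒯 𝒳 G)) (t : 𝒯) : ℕ → Finset (Fin G)
  | 0 => Finset.univ
  | 1 => Finset.univ
  | m + 2 => (candidates c h t (m + 1)).filter fun g => ∀ g' ∈ candidates c h t (m + 1),
      score c h t (m + 1) g' - score c h t (m + 1) g ≤ (2 : ℝ) ^ (2 - ((m + 1 : ℕ) : ℤ))

/-- All candidate widths at stage `m` are at most `r`. -/
def WidthsLE (c : Config 𝒯 𝒳 G) (h : List (Round 𝒯 𝒳 G)) (t : 𝒯) (m : ℕ) (r : ℝ) : Prop :=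
  ∀ g ∈ candidates c h t m, width c h t m g ≤ r

/-- Exploitation trigger `max_g w_g ≤ T^(-1/2)`. -/
def Exploits (c : Config 𝒯 𝒳 G) (h : List (Round 𝒯 𝒳 G)) (t : 𝒯) (m : ℕ) : Prop :=
  WidthsLE c h t m (1 / √(c.T : ℝ))

/-- Elimination trigger: no exploitation, and `max_g w_g ≤ 2^(1-m)`. -/
def Eliminates (c : Config 𝒯 𝒳 G) (h : List (Round 𝒯 𝒳 G)) (t : 𝒯) (m : ℕ) : Prop :=
  ¬ Exploits c h t m ∧ WidthsLE c h t m ((2 : ℝ) ^ (1 - (m : ℤ)))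

/-- The stage at which the inner loop stops: the first stage `m ≥ 1` that does not eliminate. (Such
a stage exists as soon as `T ≥ 1`, because `2^(1-m) ≤ T^(-1/2)` for large `m`.) -/
def finalStage (c : Config 𝒯 𝒳 G) (h : List (Round 𝒯 𝒳 G)) (t : 𝒯) : ℕ :=
  sInf {m | 1 ≤ m ∧ ¬ Eliminates c h t m}

open Classical in
/-- The selected arm: at the final stage, an arm of maximal optimistic score when exploiting, and
an arm with width `> 2^(1-m)` when exploring. -/
def selectArm (c : Config 𝒯 𝒳 G) (h : List (Round 𝒯 𝒳 G)) (t : 𝒯) : Fin G :=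
  let m := finalStage c h t
  if Exploits c h t m then
    c.pick (score c h t m) ((candidates c h t m).filter fun g =>
      ∀ g' ∈ candidates c h t m, score c h t m g' ≤ score c h t m g)
  else
    c.pick (width c h t m) ((candidates c h t m).filter fun g =>
      (2 : ℝ) ^ (1 - (m : ℤ)) < width c h t m g)

open Classical in
/-- The archive of arm `g` frozen at the beginning of stage `m`: the (prompt, output) pairs of arm
`g` from the rounds that precede the first round in which stage `m` is entered. -/
def snapshot (h : List (Round 𝒯 𝒳 G)) (g : Fin G) (m : ℕ) : List (𝒯 × 𝒳) :=
  ((h.takeWhile fun r => decide (r.stage < m)).filter fun r => decide (r.arm = g)).map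
    fun r => (r.prompt, r.output)

open Classical in
/-- One round: after the history `h`, prompt `t` arrives, the arm is selected, the output `x` and
the fidelity observation `y` are returned, and the diversity label is formed from the snapshot of
the stage. The round is appended to both index sets exactly when it explores. -/
def playRound (c : Config 𝒯 𝒳 G) (h : List (Round 𝒯 𝒳 G)) (z : 𝒯 × (𝒳 × ℝ)) :
    Round 𝒯 𝒳 G where
  prompt := z.1
  arm := selectArm c h z.1
  output := z.2.1
  stage := finalStage c h z.1
  appended := fun _ => decide (¬ Exploits c h z.1 (finalStage c h z.1))
  label := fun τ => match τ with
    | .fidelity => z.2.2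
    | .diversity =>
        c.divLabel (selectArm c h z.1)
          (snapshot h (selectArm c h z.1) (finalStage c h z.1)) (z.1, z.2.1)

/-- The history after `n` rounds, when round `i` has prompt, output and fidelity observation
`z i = (t_i, x_i, y_i)`. -/
def history (c : Config 𝒯 𝒳 G) (z : ℕ → 𝒯 × (𝒳 × ℝ)) : ℕ → List (Round 𝒯 𝒳 G)
  | 0 => []
  | n + 1 => history c z n ++ [playRound c (history c z n) (z n)]

/-- The arm `g_i` selected in round `i`. -/
def chosenArm (c : Config 𝒯 𝒳 G) (z : ℕ → 𝒯 × (𝒳 × ℝ)) (i : ℕ) : Fin G :=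
  selectArm c (history c z i) (z i).1

/-- The frozen archive snapshot from which the diversity label of round `i` is formed. -/
def usedSnapshot (c : Config 𝒯 𝒳 G) (z : ℕ → 𝒯 × (𝒳 × ℝ)) (i : ℕ) : List (𝒯 × 𝒳) :=
  snapshot (history c z i) (chosenArm c z i) (finalStage c (history c z i) (z i).1)

/-- Objective `J_g(t) = s_g(t) - λ D_g(t)`. -/
def objective (c : Config 𝒯 𝒳 G) (f : Target → Fin G → 𝒯 → ℝ) (g : Fin G) (t : 𝒯) : ℝ :=
  f .fidelity g t - c.lam * f .diversity g t

/-- Cumulative regret `∑_{i < T} (max_g J_g(t_i) - J_{g_i}(t_i))`. -/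
def regret (c : Config 𝒯 𝒳 G) (f : Target → Fin G → 𝒯 → ℝ) (z : ℕ → 𝒯 × (𝒳 × ℝ)) : ℝ :=
  ∑ i ∈ Finset.range c.T,
    ((⨆ g, objective c f g (z i).1) - objective c f (chosenArm c z i) (z i).1)

/-- `Γ_T^{(τ)} = max_{g,m} γ(Ψ_g^{m,(τ)})` over the index sets after `T` rounds. (Only finitely many
of them are non-empty, and the empty one contributes `0`.) -/
def maxInfoGain (c : Config 𝒯 𝒳 G) (z : ℕ → 𝒯 × (𝒳 × ℝ)) (τ : Target) : ℝ :=
  ⨆ gm : Fin G × ℕ, infoGain c.k c.α (prompts (indexSet (history c z c.T) τ gm.1 gm.2))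

/-- `d_eff^{(τ)}`: the largest effective dimension of the index sets after `T` rounds. -/
def maxEffDim (c : Config 𝒯 𝒳 G) (z : ℕ → 𝒯 × (𝒳 × ℝ)) (τ : Target) : ℝ :=
  ⨆ gm : Fin G × ℕ, effDim c.k c.α (prompts (indexSet (history c z c.T) τ gm.1 gm.2))

end Algorithm

/-! ### The interaction with the models -/

section Interaction

variable {𝒯 𝒳 : Type*} {G : ℕ} [MeasurableSpace 𝒯] [MeasurableSpace 𝒳]
  {Ω : Type*} [MeasurableSpace Ω]

/-- The `σ`-algebra of everything observed before round `i`. -/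
@[reducible] def past (Z : ℕ → Ω → 𝒯 × (𝒳 × ℝ)) (i : ℕ) : MeasurableSpace Ω :=
  ⨆ j : Fin i, MeasurableSpace.comap (Z j) inferInstance

/-- `Z i = (t_i, x_i, y_i)` is a run of the algorithm against the models `P_g(· | t)` with fidelity
observations of law `Q_g(· | t, x)`: the prompt `t_i` has law `PT` and is independent of the past,
and given the past and `t_i`, the pair `(x_i, y_i)` has law `P_{g_i}(dx | t_i) Q_{g_i}(dy | t_i, x)`
for the selected arm `g_i`. -/
structure IsRun (c : Config 𝒯 𝒳 G) (PT : Measure 𝒯) (P : Fin G → Kernel 𝒯 𝒳)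
    (Q : Fin G → Kernel (𝒯 × 𝒳) ℝ) (μ : Measure Ω) (Z : ℕ → Ω → 𝒯 × (𝒳 × ℝ)) : Prop where
  measurable : ∀ i, Measurable (Z i)
  prompt_law : ∀ i < c.T, ∀ S, MeasurableSet[past Z i] S → ∀ A, MeasurableSet A →
    μ (S ∩ {ω | (Z i ω).1 ∈ A}) = μ S * PT A
  feedback_law : ∀ i < c.T, ∀ S,
    MeasurableSet[past Z i ⊔ MeasurableSpace.comap (fun ω => (Z i ω).1) inferInstance] S →
    ∀ A, MeasurableSet A →
    μ (S ∩ {ω | (Z i ω).2 ∈ A}) =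
      ∫⁻ ω in S, (P (chosenArm c (fun j => Z j ω) i) ⊗ₖ Q (chosenArm c (fun j => Z j ω) i))
        (Z i ω).1 A ∂μ

end Interaction

end

end SupDAK

/-! On an event of probability at least `1 - δ` all confidence intervals hold, and on that event the
three bounds are deterministic.

Deterministic half. When the intervals hold, an optimal arm survives every elimination, and an arm
that survives stage `m` has gap at most `8 · 2^(-m)` (`mem_candidates_of_isMax`,
`gap_le_of_mem_candidates`). So an exploiting round costs at most `2/√T`, and an exploring round
costs at most a constant times the width of its arm, because that width exceeds `2^(1-m)`. Widths
are combinations of posterior deviations, and appending a prompt to an index set multiplies `det (I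
+ α⁻¹ K)` by `1 + σ̂²` (`det_one_add_gram_snoc`). Hence the squared deviations of the exploring
rounds telescope to information gains, and Cauchy–Schwarz produces `√(G M T Γ)`
(`sum_sqrt_chosenVar_le`). For (ii): if `b √T > 1` the very first round explores, which bounds `Γ`
from below and lets the confidence term absorb `√T` (`le_gainSum`). For (iii), information gain and
effective dimension are compared eigenvalue by eigenvalue (`infoGain_le_effDim`).

Probabilistic half. The error of a KRR prediction is a bias of at most `B √α σ̂` plus a noise `∑ a_j
ε_j` with `∑ a_j² ≤ σ̂²`. The weights `a_j` depend on later prompts and on which later rounds enter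
the index set, so the noise is not a martingale. The stages repair this: membership and prompts of
`Ψ_g^m` are unaffected by the feedback of rounds that stop at stage `m` or later
(`SameHistory.sameUpTo_playRound`); for the diversity labels this relies on the frozen archives. For
weights `Φ ≥ 0` and coefficients `b_j` that are blind to such feedback, `lintegral_noiseExp_le`
shows `E[Φ exp(∑ (b_j ε_j - C b_j²/2))] ≤ E[Φ]` by induction on the rounds.

The two label errors of a round are merged into the single noise `ε^(s) - λ ε^(D)`, which is
`(1+λ)σ`-sub-Gaussian without any independence. Both targets share their index sets, so this matches
the noise part of the width exactly, and a union bound over the `G M T` triples of arm, stage and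
round suffices. -/

namespace SupDAK

noncomputable section

/-! ### Kernel ridge regression -/

section KRRFacts

variable {𝒯 : Type*} {n : ℕ}

/-- The weights `(K_Ψ + α I)⁻¹ k_Ψ(t)` that the KRR predictor puts on the labels. -/
def krrWeight (k : 𝒯 → 𝒯 → ℝ) (α : ℝ) (p : Fin n → 𝒯) (t : 𝒯) : Fin n → ℝ :=
  (ridge k α p)⁻¹.mulVec (kvec k p t)

variable {H : Type*} [NormedAddCommGroup H] [InnerProductSpace ℝ H]
  {k : 𝒯 → 𝒯 → ℝ} {φ : 𝒯 → H}

theorem ridge_mulVec_krrWeight (hk : ∀ t t', k t t' = inner ℝ (φ t) (φ t')) {α : ℝ} (hα : 0 < α)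
    (p : Fin n → 𝒯) (t : 𝒯) : (ridge k α p).mulVec (krrWeight k α p t) = kvec k p t := by
  rw [krrWeight, Matrix.mulVec_mulVec, Matrix.mul_nonsing_inv _ (ridge_isUnit_det k φ hk hα p),
    Matrix.one_mulVec]

theorem ridge_transpose (hk : ∀ t t', k t t' = inner ℝ (φ t) (φ t')) {α : ℝ}
    (p : Fin n → 𝒯) : (ridge k α p).transpose = ridge k α p := by
  ext i j
  simp [ridge, gram, hk, real_inner_comm, Matrix.one_apply, eq_comm]

theorem krrMean_eq_weight (hk : ∀ t t', k t t' = inner ℝ (φ t) (φ t')) {α : ℝ}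
    (p : Fin n → 𝒯) (y : Fin n → ℝ) (t : 𝒯) :
    krrMean k α p y t = ∑ i, krrWeight k α p t i * y i := by
  rw [krrMean, Matrix.dotProduct_mulVec, ← Matrix.mulVec_transpose, Matrix.transpose_nonsing_inv,
    ridge_transpose hk]
  rfl

theorem krrVar_eq_weight (α : ℝ) (p : Fin n → 𝒯) (t : 𝒯) :
    krrVar k α p t = α⁻¹ * (k t t - ∑ i, kvec k p t i * krrWeight k α p t i) := rfl

/-- The weights minimise the ridge objective `‖∑ a_i φ(p_i) - φ(t)‖² + α ∑ a_i²`, whose minimum is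
`α σ̂²`. This one identity controls both parts of the prediction error: dropping the second term
bounds the bias, dropping the first bounds the weights that multiply the noise. Only inner products
of features occur, so no operator on `H` has to be inverted. -/
theorem norm_sq_residual_add (hk : ∀ t t', k t t' = inner ℝ (φ t) (φ t')) {α : ℝ} (hα : 0 < α)
    (p : Fin n → 𝒯) (t : 𝒯) :
    ‖(∑ i, krrWeight k α p t i • φ (p i)) - φ t‖ ^ 2 + α * ∑ i, krrWeight k α p t i ^ 2
      = α * krrVar k α p t := by
  have h := ridge_mulVec_krrWeight hk hα p t
  set a := krrWeight k α p t with ha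
  have h1 : ∀ i, ∑ j, inner ℝ (φ (p i)) (φ (p j)) * a j + α * a i = inner ℝ (φ t) (φ (p i)) := by
    intro i
    have := congrFun h i
    rw [kvec, hk] at this
    rw [← this]
    simp [ridge, Matrix.mulVec, dotProduct, gram, hk, add_mul, Finset.sum_add_distrib,
      Matrix.one_apply]
  have h2 : inner ℝ (∑ i, a i • φ (p i)) (∑ i, a i • φ (p i)) + α * ∑ i, a i ^ 2
      = ∑ i, kvec k p t i * a i := by
    simp only [sum_inner, inner_sum, real_inner_smul_left, real_inner_smul_right, Finset.mul_sum,
      ← Finset.sum_add_distrib]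
    refine Finset.sum_congr rfl fun i _ => ?_
    rw [kvec, hk, ← h1 i, add_mul, Finset.sum_mul]
    congr 1
    · exact Finset.sum_congr rfl fun j _ => by rw [real_inner_comm]; ring
    · ring
  have h3 : inner ℝ (∑ i, a i • φ (p i)) (φ t) = ∑ i, kvec k p t i * a i := by
    simp only [sum_inner, real_inner_smul_left]
    refine Finset.sum_congr rfl fun i _ => ?_
    rw [kvec, hk, real_inner_comm]; ring
  rw [krrVar_eq_weight, ← ha, mul_inv_cancel_left₀ hα.ne', norm_sub_sq_real,
    ← real_inner_self_eq_norm_sq, ← real_inner_self_eq_norm_sq, h3, hk t t]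
  linarith

theorem krrVar_nonneg (hk : ∀ t t', k t t' = inner ℝ (φ t) (φ t')) {α : ℝ} (hα : 0 < α)
    (p : Fin n → 𝒯) (t : 𝒯) : 0 ≤ krrVar k α p t := by
  have h := norm_sq_residual_add hk hα p t
  have : 0 ≤ α * krrVar k α p t := by rw [← h]; positivity
  exact nonneg_of_mul_nonneg_right this hα

theorem sum_krrWeight_sq_le (hk : ∀ t t', k t t' = inner ℝ (φ t) (φ t')) {α : ℝ} (hα : 0 < α)
    (p : Fin n → 𝒯) (t : 𝒯) : ∑ i, krrWeight k α p t i ^ 2 ≤ krrVar k α p t := by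
  have h := norm_sq_residual_add hk hα p t
  refine le_of_mul_le_mul_left ?_ hα
  linarith [sq_nonneg ‖(∑ i, krrWeight k α p t i • φ (p i)) - φ t‖]

/-- Bias of kernel ridge regression on noiseless labels of an RKHS function. -/
theorem abs_krrBias_le (hk : ∀ t t', k t t' = inner ℝ (φ t) (φ t')) {α : ℝ} (hα : 0 < α)
    (p : Fin n → 𝒯) (t : 𝒯) {f : H} {B : ℝ} (hf : ‖f‖ ≤ B) :
    |(∑ i, krrWeight k α p t i * inner ℝ (φ (p i)) f) - inner ℝ (φ t) f|
      ≤ B * √α * √(krrVar k α p t) := by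
  have h1 : (∑ i, krrWeight k α p t i * inner ℝ (φ (p i)) f) - inner ℝ (φ t) f
      = inner ℝ ((∑ i, krrWeight k α p t i • φ (p i)) - φ t) f := by
    simp [inner_sub_left, sum_inner, real_inner_smul_left]
  have h2 : ‖(∑ i, krrWeight k α p t i • φ (p i)) - φ t‖ ≤ √α * √(krrVar k α p t) := by
    rw [← Real.sqrt_mul hα.le]
    apply Real.le_sqrt_of_sq_le
    rw [← norm_sq_residual_add hk hα p t]
    have : 0 ≤ α * ∑ i, krrWeight k α p t i ^ 2 := by positivity
    linarith
  rw [h1]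
  calc _ ≤ _ * ‖f‖ := abs_real_inner_le_norm _ _
    _ ≤ (√α * √(krrVar k α p t)) * B := by gcongr
    _ = _ := by ring

theorem krrVar_le (hk : ∀ t t', k t t' = inner ℝ (φ t) (φ t')) {α : ℝ} (hα : 0 < α)
    (p : Fin n → 𝒯) (t : 𝒯) : krrVar k α p t ≤ α⁻¹ * k t t := by
  rw [krrVar]
  have h : 0 ≤ kvec k p t ⬝ᵥ ((ridge k α p)⁻¹.mulVec (kvec k p t)) := by
    have h1 : (ridge k α p).PosDef :=
      (Matrix.PosDef.one.smul hα).posSemidef_add (gram_posSemidef k φ hk p)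
    have := h1.inv.posSemidef.dotProduct_mulVec_nonneg (kvec k p t)
    simpa using this
  have : 0 < α⁻¹ := inv_pos.2 hα
  gcongr
  linarith

/-- Schur complement: eliminating the block of the old prompts leaves the scalar `1 + α⁻¹ k(t,t) -
α⁻² k_Ψ(t)ᵀ (I + α⁻¹ K)⁻¹ k_Ψ(t)`, which is `1 + σ̂²` because `(I + α⁻¹ K)⁻¹ = α (K + α I)⁻¹`. -/
theorem det_one_add_gram_snoc (hk : ∀ t t', k t t' = inner ℝ (φ t) (φ t')) {α : ℝ} (hα : 0 < α)
    (p : Fin n → 𝒯) (t : 𝒯) :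
    ((1 : Matrix (Fin (n + 1)) (Fin (n + 1)) ℝ)
        + α⁻¹ • gram k (Fin.snoc p t : Fin (n + 1) → 𝒯)).det
      = ((1 : Matrix (Fin n) (Fin n) ℝ) + α⁻¹ • gram k p).det * (1 + krrVar k α p t) := by
  have hR : (1 : Matrix (Fin n) (Fin n) ℝ) + α⁻¹ • gram k p = α⁻¹ • ridge k α p := by
    rw [ridge, smul_add, smul_smul, inv_mul_cancel₀ hα.ne', one_smul, add_comm]
  have hu : IsUnit ((1 : Matrix (Fin n) (Fin n) ℝ) + α⁻¹ • gram k p).det := by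
    rw [hR, Matrix.det_smul]
    exact (IsUnit.mk0 _ (by positivity)).mul (ridge_isUnit_det k φ hk hα p)
  have hinv : ((1 : Matrix (Fin n) (Fin n) ℝ) + α⁻¹ • gram k p)⁻¹ = α • (ridge k α p)⁻¹ := by
    apply Matrix.inv_eq_right_inv
    rw [hR, Matrix.smul_mul, Matrix.mul_smul, smul_smul, inv_mul_cancel₀ hα.ne', one_smul,
      Matrix.mul_nonsing_inv _ (ridge_isUnit_det k φ hk hα p)]
  let _ := Matrix.invertibleOfIsUnitDet _ hu
  let A : Matrix (Fin n ⊕ Fin 1) (Fin n ⊕ Fin 1) ℝ :=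
    Matrix.fromBlocks ((1 : Matrix (Fin n) (Fin n) ℝ) + α⁻¹ • gram k p)
      (Matrix.of fun i _ => α⁻¹ * kvec k p t i) (Matrix.of fun _ i => α⁻¹ * kvec k p t i)
      (Matrix.of fun _ _ => 1 + α⁻¹ * k t t)
  have h1 : ((1 : Matrix (Fin (n + 1)) (Fin (n + 1)) ℝ)
        + α⁻¹ • gram k (Fin.snoc p t : Fin (n + 1) → 𝒯)).submatrix finSumFinEquiv finSumFinEquiv
      = A := by
    have hl : ∀ i : Fin n, (finSumFinEquiv (Sum.inl i) : Fin (n + 1)) = Fin.castSucc i := fun i => rfl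
    have hr : ∀ i : Fin 1, (finSumFinEquiv (Sum.inr i) : Fin (n + 1)) = Fin.last n := fun i => by
      ext; simp
    ext i j
    rcases i with i | i <;> rcases j with j | j
    · simp only [Matrix.submatrix_apply, hl, A, Matrix.fromBlocks_apply₁₁]
      simp [gram, Matrix.one_apply]
    · simp only [Matrix.submatrix_apply, hl, hr, A, Matrix.fromBlocks_apply₁₂]
      simp [gram, kvec, hk, real_inner_comm, (Fin.castSucc_lt_last i).ne]
    · simp only [Matrix.submatrix_apply, hl, hr, A, Matrix.fromBlocks_apply₂₁]
      simp [gram, kvec, (Fin.castSucc_lt_last j).ne']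
    · simp only [Matrix.submatrix_apply, hr, A, Matrix.fromBlocks_apply₂₂]
      simp [gram]
  rw [← Matrix.det_submatrix_equiv_self finSumFinEquiv, h1, Matrix.det_fromBlocks₁₁,
    Matrix.invOf_eq_nonsing_inv, hinv]
  congr 1
  rw [Matrix.det_fin_one, krrVar]
  simp only [Matrix.sub_apply, Matrix.of_apply, Matrix.mul_apply, Matrix.smul_apply, smul_eq_mul,
    Matrix.mulVec, dotProduct]
  simp only [Finset.sum_mul, Finset.mul_sum, mul_sub]
  rw [Finset.sum_comm, add_sub_assoc]
  congr 2
  refine Finset.sum_congr rfl fun i _ => Finset.sum_congr rfl fun j _ => ?_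
  field_simp

theorem det_one_add_gram_pos (hk : ∀ t t', k t t' = inner ℝ (φ t) (φ t')) {α : ℝ} (hα : 0 < α)
    (p : Fin n → 𝒯) : 0 < ((1 : Matrix (Fin n) (Fin n) ℝ) + α⁻¹ • gram k p).det :=
  (Matrix.PosDef.one.add_posSemidef
    ((gram_posSemidef k φ hk p).smul (inv_pos.2 hα).le)).det_pos

theorem infoGain_snoc (hk : ∀ t t', k t t' = inner ℝ (φ t) (φ t')) {α : ℝ} (hα : 0 < α)
    (p : Fin n → 𝒯) (t : 𝒯) :
    infoGain k α (Fin.snoc p t : Fin (n + 1) → 𝒯)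
      = infoGain k α p + 1 / 2 * Real.log (1 + krrVar k α p t) := by
  have := krrVar_nonneg hk hα p t
  rw [infoGain, infoGain, det_one_add_gram_snoc hk hα,
    Real.log_mul (det_one_add_gram_pos hk hα p).ne' (by positivity)]
  ring

/-! ### Spectral comparison of information gain and effective dimension. -/

theorem det_one_add_smul_eq_prod_eigenvalues {A : Matrix (Fin n) (Fin n) ℝ} (hA : A.IsHermitian)
    (r : ℝ) : (1 + r • A).det = ∏ i, (1 + r * hA.eigenvalues i) := by
  set U : Matrix (Fin n) (Fin n) ℝ := ↑(hA.eigenvectorUnitary) with hU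
  have hUU : U * star U = 1 := Unitary.coe_mul_star_self _
  have hA' : A = U * Matrix.diagonal hA.eigenvalues * star U := by
    conv_lhs => rw [hA.spectral_theorem]
    simp [hU, Unitary.conjStarAlgAut_apply]
  have h : 1 + r • A = U * Matrix.diagonal (fun i => 1 + r * hA.eigenvalues i) * star U := by
    have : Matrix.diagonal (fun i => 1 + r * hA.eigenvalues i)
        = 1 + r • Matrix.diagonal hA.eigenvalues := by
      ext i j; by_cases h : i = j <;> simp [h]
    rw [this, mul_add, add_mul, mul_one, hUU, Matrix.mul_smul, Matrix.smul_mul, ← hA']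
  have hd : U.det * (star U).det = 1 := by rw [← Matrix.det_mul, hUU, Matrix.det_one]
  rw [h, Matrix.det_mul, Matrix.det_mul, Matrix.det_diagonal, mul_right_comm, hd, one_mul]

theorem trace_mul_inv_add_eq_sum_eigenvalues {A : Matrix (Fin n) (Fin n) ℝ} (hA : A.PosSemidef)
    {α : ℝ} (hα : 0 < α) :
    (A * (A + α • (1 : Matrix (Fin n) (Fin n) ℝ))⁻¹).trace
      = ∑ i, hA.isHermitian.eigenvalues i / (hA.isHermitian.eigenvalues i + α) := by
  set e := hA.isHermitian.eigenvalues with he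
  have he0 : ∀ i, 0 ≤ e i := hA.eigenvalues_nonneg
  set U : Matrix (Fin n) (Fin n) ℝ := ↑(hA.isHermitian.eigenvectorUnitary) with hU
  have hUU : U * star U = 1 := Unitary.coe_mul_star_self _
  have hUU' : star U * U = 1 := Unitary.coe_star_mul_self _
  have hA' : A = U * Matrix.diagonal e * star U := by
    conv_lhs => rw [hA.isHermitian.spectral_theorem]
    simp [hU, Unitary.conjStarAlgAut_apply, he]
  have h : A + α • (1 : Matrix (Fin n) (Fin n) ℝ)
      = U * Matrix.diagonal (fun i => e i + α) * star U := by
    have : Matrix.diagonal (fun i => e i + α) = Matrix.diagonal e + α • 1 := by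
      ext i j; by_cases h : i = j <;> simp [h]
    rw [this, mul_add, add_mul, ← hA', Matrix.mul_smul, Matrix.smul_mul, mul_one, hUU]
  have hinv : (A + α • (1 : Matrix (Fin n) (Fin n) ℝ))⁻¹
      = U * Matrix.diagonal (fun i => (e i + α)⁻¹) * star U := by
    apply Matrix.inv_eq_right_inv
    rw [h]
    calc _ = U * Matrix.diagonal (fun i => e i + α) * (star U * U)
          * Matrix.diagonal (fun i => (e i + α)⁻¹) * star U := by simp only [mul_assoc]
      _ = U * (Matrix.diagonal (fun i => e i + α)
          * Matrix.diagonal (fun i => (e i + α)⁻¹)) * star U := by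
        rw [hUU', mul_one]; simp only [mul_assoc]
      _ = 1 := by
        rw [Matrix.diagonal_mul_diagonal]
        have : (fun i => (e i + α) * (e i + α)⁻¹) = fun _ => (1 : ℝ) := by
          funext i
          exact mul_inv_cancel₀ (by linarith [he0 i])
        rw [this, Matrix.diagonal_one, mul_one, hUU]
  rw [hinv]
  nth_rewrite 1 [hA']
  calc _ = (U * (Matrix.diagonal e * (star U * U)
          * Matrix.diagonal (fun i => (e i + α)⁻¹)) * star U).trace := by simp only [mul_assoc]
    _ = (Matrix.diagonal e * Matrix.diagonal (fun i => (e i + α)⁻¹)).trace := by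
      rw [hUU', mul_one, Matrix.trace_mul_comm, ← mul_assoc, hUU', one_mul]
    _ = _ := by
      rw [Matrix.diagonal_mul_diagonal, Matrix.trace_diagonal]
      rfl

/-- After clearing the denominator, `log (1+x) + x log (1+x) ≤ x + x log (1+y)` holds term by term.
Applied to each eigenvalue divided by `α`, it compares the log-determinant with the trace. -/
theorem log_one_add_le_mul_div {x y : ℝ} (hx : 0 ≤ x) (hxy : x ≤ y) :
    Real.log (1 + x) ≤ (1 + Real.log (1 + y)) * (x / (x + 1)) := by
  have h1 : Real.log (1 + x) ≤ x := by
    have := Real.log_le_sub_one_of_pos (show 0 < 1 + x by linarith)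
    linarith
  have h2 : Real.log (1 + x) ≤ Real.log (1 + y) := Real.log_le_log (by linarith) (by linarith)
  rw [← mul_div_assoc, le_div_iff₀ (by linarith)]
  nlinarith

theorem effDim_nonneg (hk : ∀ t t', k t t' = inner ℝ (φ t) (φ t')) {α : ℝ} (hα : 0 < α)
    (p : Fin n → 𝒯) : 0 ≤ effDim k α p := by
  have hA := gram_posSemidef k φ hk p
  rw [effDim, ridge, trace_mul_inv_add_eq_sum_eigenvalues hA hα]
  exact Finset.sum_nonneg fun i _ =>
    div_nonneg (hA.eigenvalues_nonneg i) (by linarith [hA.eigenvalues_nonneg i])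

theorem infoGain_nonneg (hk : ∀ t t', k t t' = inner ℝ (φ t) (φ t')) {α : ℝ} (hα : 0 < α)
    (p : Fin n → 𝒯) : 0 ≤ infoGain k α p := by
  have hA := gram_posSemidef k φ hk p
  rw [infoGain, det_one_add_smul_eq_prod_eigenvalues hA.isHermitian]
  have : 1 ≤ ∏ i, (1 + α⁻¹ * hA.isHermitian.eigenvalues i) := by
    apply Finset.one_le_prod
    intro i _
    have := mul_nonneg (inv_pos.2 hα).le (hA.eigenvalues_nonneg i)
    linarith
  have := Real.log_nonneg this
  positivity

/-- The information gain is at most the effective dimension, up to a logarithmic factor. -/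
theorem infoGain_le_effDim (hk : ∀ t t', k t t' = inner ℝ (φ t) (φ t')) {α : ℝ} (hα : 0 < α)
    (hnorm : ∀ t, k t t = 1) (p : Fin n → 𝒯) {T : ℝ} (hn : n ≤ T) :
    infoGain k α p ≤ (1 + Real.log (1 + T / α)) * effDim k α p := by
  have hA := gram_posSemidef k φ hk p
  set e := hA.isHermitian.eigenvalues with he
  have he0 : ∀ i, 0 ≤ e i := hA.eigenvalues_nonneg
  have hle : ∀ i, e i ≤ T := by
    intro i
    -- The normalization `k(t,t) = 1` makes the trace equal to the number of prompts, which caps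
    -- every eigenvalue at `T`.
    have h1 : ∑ i, e i = n := by
      have := hA.isHermitian.trace_eq_sum_eigenvalues
      rw [RCLike.ofReal_real_eq_id] at this
      simp only [id] at this
      rw [he, ← this]
      simp [Matrix.trace, gram, hnorm]
    calc e i ≤ ∑ i, e i := Finset.single_le_sum (fun i _ => he0 i) (Finset.mem_univ i)
      _ ≤ T := by rw [h1]; exact hn
  have hi : 0 < α⁻¹ := inv_pos.2 hα
  have hd := effDim_nonneg hk hα p
  have hlog : Real.log (((1 : Matrix (Fin n) (Fin n) ℝ) + α⁻¹ • gram k p).det)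
      ≤ (1 + Real.log (1 + T / α)) * effDim k α p := by
    rw [det_one_add_smul_eq_prod_eigenvalues hA.isHermitian, Real.log_prod, effDim, ridge,
      trace_mul_inv_add_eq_sum_eigenvalues hA hα, Finset.mul_sum]
    · refine Finset.sum_le_sum fun i _ => ?_
      have hx : 0 ≤ α⁻¹ * e i := mul_nonneg hi.le (he0 i)
      have hxy : α⁻¹ * e i ≤ T / α := by
        rw [div_eq_inv_mul]; exact mul_le_mul_of_nonneg_left (hle i) hi.le
      have := log_one_add_le_mul_div hx hxy
      have h2 : α⁻¹ * e i / (α⁻¹ * e i + 1) = e i / (e i + α) := by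
        have := he0 i
        field_simp
      rwa [h2] at this
    · intro i _
      have : 0 ≤ α⁻¹ * e i := mul_nonneg hi.le (he0 i)
      exact (by linarith : (0 : ℝ) < 1 + α⁻¹ * e i).ne'
  -- The factor `1/2` of the information gain is given away; nonnegativity permits this.
  have h0 := infoGain_nonneg hk hα p
  rw [infoGain] at h0 ⊢
  linarith

end KRRFacts

/-! ### Regret of the selected arms when the confidence intervals hold -/

section RoundRegret

variable {𝒯 𝒳 : Type*} {G : ℕ} (c : Config 𝒯 𝒳 G) (h : List (Round 𝒯 𝒳 G)) (t : 𝒯)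

/-- The confidence intervals of stage `m` contain the objective `J`. -/
def Accurate (J : Fin G → ℝ) (m : ℕ) : Prop :=
  ∀ g, |estimate c h t .fidelity m g - c.lam * estimate c h t .diversity m g - J g|
    ≤ width c h t m g

variable {c h t}

theorem score_eq (m : ℕ) (g : Fin G) : score c h t m g
    = estimate c h t .fidelity m g - c.lam * estimate c h t .diversity m g
      + width c h t m g := by
  simp only [score, width]; ring

theorem Accurate.le_score {J : Fin G → ℝ} {m : ℕ} (H : Accurate c h t J m) (g : Fin G) :
    J g ≤ score c h t m g := by
  have := (abs_le.1 (H g)).1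
  rw [score_eq]; linarith

theorem Accurate.score_le {J : Fin G → ℝ} {m : ℕ} (H : Accurate c h t J m) (g : Fin G) :
    score c h t m g ≤ J g + 2 * width c h t m g := by
  have := (abs_le.1 (H g)).2
  rw [score_eq]; linarith

theorem mem_candidates_succ {m : ℕ} (hm : 1 ≤ m) (g : Fin G) :
    g ∈ candidates c h t (m + 1) ↔ g ∈ candidates c h t m ∧ ∀ g' ∈ candidates c h t m,
      score c h t m g' - score c h t m g ≤ (2 : ℝ) ^ (2 - (m : ℤ)) := by
  obtain ⟨m, rfl⟩ := Nat.exists_eq_add_of_le' hm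
  simp [candidates]

theorem candidates_nonempty (hG : 1 ≤ G) (m : ℕ) : (candidates c h t m).Nonempty := by
  have : Nonempty (Fin G) := ⟨⟨0, hG⟩⟩
  induction m with
  | zero => exact Finset.univ_nonempty
  | succ m ih =>
    rcases Nat.eq_zero_or_pos m with rfl | hm
    · exact Finset.univ_nonempty
    · obtain ⟨g, hg, hmax⟩ := (candidates c h t m).exists_max_image (score c h t m) ih
      refine ⟨g, (mem_candidates_succ hm g).2 ⟨hg, fun g' hg' => ?_⟩⟩
      have : (0 : ℝ) < 2 ^ (2 - (m : ℤ)) := by positivity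
      linarith [hmax g' hg']

/-- The score of a competitor exceeds its objective by at most twice its width, hence by at most `2
· 2^(1-m)`, while the score of an optimal arm is at least its objective. So an optimal arm trails by
at most the tolerance `2^(2-m)` and is never eliminated. -/
theorem mem_candidates_of_isMax {J : Fin G → ℝ} {g₀ : Fin G} (hg₀ : ∀ g, J g ≤ J g₀) {m : ℕ}
    (hm : 1 ≤ m) (H : ∀ m', 1 ≤ m' → m' < m → Eliminates c h t m' ∧ Accurate c h t J m') :
    g₀ ∈ candidates c h t m := by
  induction m, hm using Nat.le_induction with
  | base => exact Finset.mem_univ _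
  | succ m hm ih =>
    refine (mem_candidates_succ hm _).2
      ⟨ih fun m' h1 h2 => H m' h1 (h2.trans m.lt_succ_self), fun g hg => ?_⟩
    obtain ⟨he, ha⟩ := H m hm m.lt_succ_self
    have h1 := ha.le_score g₀
    have h2 := ha.score_le g
    have h3 := he.2 g hg
    have h4 : (2 : ℝ) ^ (2 - (m : ℤ)) = 2 * 2 ^ (1 - (m : ℤ)) := by
      rw [show (2 - (m : ℤ)) = 1 + (1 - m) by ring, zpow_add₀ two_ne_zero, zpow_one]
    linarith [hg₀ g]

/-- A surviving arm trails the score of the optimal arm by at most `2^(2-m)`, and its own score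
overshoots its objective by at most `2 · 2^(1-m)`. Each of the two is four times the threshold
`2^(1-(m+1))` of the next stage, whence the `8`. -/
theorem gap_le_of_mem_candidates {J : Fin G → ℝ} {g₀ g : Fin G} (hg₀ : ∀ g, J g ≤ J g₀) {m : ℕ}
    (hm : 1 ≤ m) (H : ∀ m', 1 ≤ m' → m' < m + 1 → Eliminates c h t m' ∧ Accurate c h t J m')
    (hg : g ∈ candidates c h t (m + 1)) : J g₀ - J g ≤ 8 * 2 ^ (1 - ((m + 1 : ℕ) : ℤ)) := by
  obtain ⟨he, ha⟩ := H m hm m.lt_succ_self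
  have hmem : g₀ ∈ candidates c h t m :=
    mem_candidates_of_isMax hg₀ hm fun m' h1 h2 => H m' h1 (h2.trans m.lt_succ_self)
  have h0 := (mem_candidates_succ hm g).1 hg
  have h1 := ha.le_score g₀
  have h2 := ha.score_le g
  have h3 := he.2 g h0.1
  have h4 := h0.2 g₀ hmem
  have h5 : (2 : ℝ) ^ (2 - (m : ℤ)) = 4 * 2 ^ (1 - ((m + 1 : ℕ) : ℤ)) := by
    rw [show (2 - (m : ℤ)) = 2 + (1 - ((m + 1 : ℕ) : ℤ)) by push_cast; ring,
      zpow_add₀ two_ne_zero]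
    norm_num
  have h6 : (2 : ℝ) ^ (1 - (m : ℤ)) = 2 * 2 ^ (1 - ((m + 1 : ℕ) : ℤ)) := by
    rw [show (1 - (m : ℤ)) = 1 + (1 - ((m + 1 : ℕ) : ℤ)) by push_cast; ring,
      zpow_add₀ two_ne_zero, zpow_one]
  linarith

/-- Once the elimination threshold is below `1/√T`, widths small enough to eliminate are small
enough to exploit, so the inner loop cannot pass this stage. -/
theorem not_eliminates_of_le {M : ℕ} (hM : (2 : ℝ) ^ (1 - (M : ℤ)) ≤ 1 / √(c.T : ℝ)) :
    ¬ Eliminates c h t M := fun he => he.1 fun g hg => (he.2 g hg).trans hM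

theorem exists_zpow_le (hT : 1 ≤ c.T) :
    ∃ M : ℕ, 1 ≤ M ∧ (2 : ℝ) ^ (1 - (M : ℤ)) ≤ 1 / √(c.T : ℝ) := by
  have hpos : 0 < 1 / √(c.T : ℝ) := by positivity
  obtain ⟨n, hn⟩ := exists_pow_lt_of_lt_one hpos (show (1 / 2 : ℝ) < 1 by norm_num)
  refine ⟨n + 1, by omega, le_of_eq_of_le ?_ hn.le⟩
  rw [show (1 - ((n + 1 : ℕ) : ℤ)) = -n by push_cast; ring, zpow_neg, zpow_natCast]
  simp

theorem finalStage_spec (hT : 1 ≤ c.T) :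
    1 ≤ finalStage c h t ∧ ¬ Eliminates c h t (finalStage c h t) := by
  obtain ⟨M, h1, hM⟩ := exists_zpow_le hT
  exact Nat.sInf_mem (s := {m | 1 ≤ m ∧ ¬ Eliminates c h t m}) ⟨M, h1, not_eliminates_of_le hM⟩

theorem eliminates_of_lt_finalStage {m : ℕ} (h1 : 1 ≤ m) (hm : m < finalStage c h t) :
    Eliminates c h t m := by
  by_contra hn
  exact Nat.notMem_of_lt_sInf hm ⟨h1, hn⟩

theorem finalStage_le {M : ℕ} (h1 : 1 ≤ M) (hM : (2 : ℝ) ^ (1 - (M : ℤ)) ≤ 1 / √(c.T : ℝ)) :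
    finalStage c h t ≤ M := Nat.sInf_le ⟨h1, not_eliminates_of_le hM⟩

theorem selectArm_exploit (hG : 1 ≤ G) (hpick : ∀ v S, S.Nonempty → c.pick v S ∈ S)
    (he : Exploits c h t (finalStage c h t)) :
    selectArm c h t ∈ candidates c h t (finalStage c h t) ∧
      ∀ g ∈ candidates c h t (finalStage c h t), score c h t (finalStage c h t) g
        ≤ score c h t (finalStage c h t) (selectArm c h t) := by
  classical
  have hne : ((candidates c h t (finalStage c h t)).filter fun g =>
      ∀ g' ∈ candidates c h t (finalStage c h t),
        score c h t (finalStage c h t) g' ≤ score c h t (finalStage c h t) g).Nonempty := by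
    obtain ⟨g, hg, hmax⟩ := (candidates c h t (finalStage c h t)).exists_max_image
      (score c h t (finalStage c h t)) (candidates_nonempty hG _)
    exact ⟨g, Finset.mem_filter.2 ⟨hg, hmax⟩⟩
  have := hpick (score c h t (finalStage c h t)) _ hne
  have hs : selectArm c h t = _ := if_pos he
  rw [hs]
  convert! Finset.mem_filter.1 this

theorem selectArm_explore (hT : 1 ≤ c.T) (hpick : ∀ v S, S.Nonempty → c.pick v S ∈ S)
    (he : ¬ Exploits c h t (finalStage c h t)) :
    selectArm c h t ∈ candidates c h t (finalStage c h t) ∧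
      (2 : ℝ) ^ (1 - (finalStage c h t : ℤ)) < width c h t (finalStage c h t) (selectArm c h t) := by
  classical
  have hne : ((candidates c h t (finalStage c h t)).filter fun g =>
      (2 : ℝ) ^ (1 - (finalStage c h t : ℤ)) < width c h t (finalStage c h t) g).Nonempty := by
    have h2 : ¬ WidthsLE c h t (finalStage c h t) ((2 : ℝ) ^ (1 - (finalStage c h t : ℤ))) :=
      fun hw => (finalStage_spec hT).2 ⟨he, hw⟩
    simp only [WidthsLE, not_forall, not_le] at h2
    obtain ⟨g, hg, hw⟩ := h2
    exact ⟨g, Finset.mem_filter.2 ⟨hg, hw⟩⟩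
  have := hpick (width c h t (finalStage c h t)) _ hne
  have hs : selectArm c h t = _ := if_neg he
  rw [hs]
  convert! Finset.mem_filter.1 this

theorem gap_le_of_exploit (hG : 1 ≤ G) (hT : 1 ≤ c.T)
    (hpick : ∀ v S, S.Nonempty → c.pick v S ∈ S) {J : Fin G → ℝ} {g₀ : Fin G}
    (hg₀ : ∀ g, J g ≤ J g₀)
    (H : ∀ m, 1 ≤ m → m ≤ finalStage c h t → Accurate c h t J m)
    (he : Exploits c h t (finalStage c h t)) :
    J g₀ - J (selectArm c h t) ≤ 2 * (1 / √(c.T : ℝ)) := by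
  obtain ⟨hs, hmax⟩ := selectArm_exploit hG hpick he
  have h1 := (finalStage_spec (h := h) (t := t) hT).1
  have hmem : g₀ ∈ candidates c h t (finalStage c h t) := mem_candidates_of_isMax hg₀ h1
    fun m' h1 h2 => ⟨eliminates_of_lt_finalStage h1 h2, H m' h1 h2.le⟩
  have ha := H _ h1 le_rfl
  linarith [ha.le_score g₀, hmax g₀ hmem, ha.score_le (selectArm c h t), he _ hs]

/-- The width of an explored arm exceeds `2^(1-m)`, so the gap bound inherited from the previous
stage becomes a multiple of the width. Stage `1` has no previous stage: there the width exceeds `1`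
and the crude gap bound `2b` is used, which is the origin of the factor `1 + b`. -/
theorem gap_le_of_explore (hT : 1 ≤ c.T)
    (hpick : ∀ v S, S.Nonempty → c.pick v S ∈ S) {J : Fin G → ℝ} {g₀ : Fin G}
    (hg₀ : ∀ g, J g ≤ J g₀) {b : ℝ} (hb0 : 0 ≤ b) (hb : J g₀ - J (selectArm c h t) ≤ 2 * b)
    (H : ∀ m, 1 ≤ m → m ≤ finalStage c h t → Accurate c h t J m)
    (he : ¬ Exploits c h t (finalStage c h t)) :
    J g₀ - J (selectArm c h t)
      ≤ 8 * (1 + b) * width c h t (finalStage c h t) (selectArm c h t) := by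
  obtain ⟨hs, hw⟩ := selectArm_explore hT hpick he
  have h1 := (finalStage_spec (h := h) (t := t) hT).1
  generalize hm : finalStage c h t = m at *
  have hp : (0 : ℝ) < 2 ^ (1 - (m : ℤ)) := by positivity
  have hwp := hp.trans hw
  rcases h1.eq_or_lt with rfl | h2
  · simp only [Nat.cast_one, sub_self, zpow_zero] at hw
    nlinarith
  · obtain ⟨m, rfl⟩ := Nat.exists_eq_add_of_le' h1
    have := gap_le_of_mem_candidates hg₀ (by omega : 1 ≤ m)
      (fun m' h1 h2 => ⟨eliminates_of_lt_finalStage h1 (by omega), H m' h1 (by omega)⟩) hs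
    nlinarith

end RoundRegret

/-! ### Index sets and information gain along a history -/

section InfoGain

variable {𝒯 𝒳 : Type*} {G : ℕ} {c : Config 𝒯 𝒳 G} {z : ℕ → 𝒯 × (𝒳 × ℝ)}

/-- Round `i` explores. -/
def Explores (c : Config 𝒯 𝒳 G) (z : ℕ → 𝒯 × (𝒳 × ℝ)) (i : ℕ) : Prop :=
  ¬ Exploits c (history c z i) (z i).1 (finalStage c (history c z i) (z i).1)

/-- The stage at which round `i` stops. -/
def chosenStage (c : Config 𝒯 𝒳 G) (z : ℕ → 𝒯 × (𝒳 × ℝ)) (i : ℕ) : ℕ :=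
  finalStage c (history c z i) (z i).1

/-- The squared deviation of the selected arm at the final stage of round `i`. -/
def chosenVar (c : Config 𝒯 𝒳 G) (z : ℕ → 𝒯 × (𝒳 × ℝ)) (τ : Target) (i : ℕ) : ℝ :=
  krrVar c.k c.α (prompts (indexSet (history c z i) τ (chosenArm c z i) (chosenStage c z i)))
    (z i).1

theorem length_history (n : ℕ) : (history c z n).length = n := by
  induction n with
  | zero => rfl
  | succ n ih => simp [history, ih]

theorem infoGain_prompts_of_length (k : 𝒯 → 𝒯 → ℝ) (α : ℝ) (L : List (Round 𝒯 𝒳 G)) {n : ℕ}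
    (hn : L.length = n) :
    infoGain k α (prompts L) = infoGain k α fun i : Fin n => (L.get (i.cast hn.symm)).prompt := by
  subst hn; rfl

variable {H : Type*} [NormedAddCommGroup H] [InnerProductSpace ℝ H] {φ : 𝒯 → H}

theorem infoGain_prompts_append {k : 𝒯 → 𝒯 → ℝ} (hk : ∀ t t', k t t' = inner ℝ (φ t) (φ t'))
    {α : ℝ} (hα : 0 < α) (L : List (Round 𝒯 𝒳 G)) (r : Round 𝒯 𝒳 G) :
    infoGain k α (prompts (L ++ [r]))
      = infoGain k α (prompts L) + 1 / 2 * Real.log (1 + krrVar k α (prompts L) r.prompt) := by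
  rw [infoGain_prompts_of_length k α (L ++ [r]) (n := L.length + 1) (by simp),
    ← infoGain_snoc hk hα]
  congr 1
  funext i
  refine Fin.lastCases ?_ (fun i => ?_) i
  · simp
  · simp [prompts]

open Classical in
-- The log-determinant telescopes along the rounds that enter one index set: each multiplies the
-- determinant by one plus its squared deviation at the time of entry.
theorem sum_log_eq_infoGain (hk : ∀ t t', c.k t t' = inner ℝ (φ t) (φ t')) (hα : 0 < c.α)
    (τ : Target) (g : Fin G) (m n : ℕ) :
    ∑ i ∈ Finset.range n, (if Explores c z i ∧ chosenArm c z i = g ∧ chosenStage c z i = m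
        then Real.log (1 + chosenVar c z τ i) else 0)
      = 2 * infoGain c.k c.α (prompts (indexSet (history c z n) τ g m)) := by
  induction n with
  | zero =>
    have h0 : ∀ p : Fin 0 → 𝒯, infoGain c.k c.α p = 0 := fun p => by simp [infoGain]
    have : infoGain c.k c.α (prompts (indexSet (history c z 0) τ g m)) = 0 := h0 _
    rw [this]; simp
  | succ n ih =>
    rw [Finset.sum_range_succ, ih]
    have hset : indexSet (history c z (n + 1)) τ g m = indexSet (history c z n) τ g m
        ++ if Explores c z n ∧ chosenArm c z n = g ∧ chosenStage c z n = m
          then [playRound c (history c z n) (z n)] else [] := by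
      rw [history, indexSet, List.filter_append]
      congr 1
      simp [List.filter_cons, playRound, Explores, chosenArm, chosenStage]
    by_cases hc : Explores c z n ∧ chosenArm c z n = g ∧ chosenStage c z n = m
    · rw [if_pos hc] at hset ⊢
      rw [hset, infoGain_prompts_append hk hα, chosenVar, hc.2.1, hc.2.2]
      simp only [playRound]
      ring
    · rw [if_neg hc, List.append_nil] at hset
      rw [if_neg hc, hset, add_zero]

/-- Every index set is a sublist of `h`, so only finitely many values occur although `m` ranges over
all of `ℕ`. This makes the real suprema `maxInfoGain` and `maxEffDim` genuine upper bounds rather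
than default values. -/
theorem indexSet_bddAbove (h : List (Round 𝒯 𝒳 G)) (τ : Target)
    (F : List (Round 𝒯 𝒳 G) → ℝ) :
    BddAbove (Set.range fun gm : Fin G × ℕ => F (indexSet h τ gm.1 gm.2)) := by
  apply Set.Finite.bddAbove
  refine ((List.finite_toSet h.sublists).image F).subset ?_
  rintro _ ⟨gm, rfl⟩
  exact ⟨_, List.mem_sublists.2 List.filter_sublist, rfl⟩

theorem infoGain_le_maxInfoGain (τ : Target) (g : Fin G) (m : ℕ) :
    infoGain c.k c.α (prompts (indexSet (history c z c.T) τ g m)) ≤ maxInfoGain c z τ :=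
  le_ciSup (indexSet_bddAbove (history c z c.T) τ fun L => infoGain c.k c.α (prompts L)) (g, m)

theorem effDim_le_maxEffDim (τ : Target) (g : Fin G) (m : ℕ) :
    effDim c.k c.α (prompts (indexSet (history c z c.T) τ g m)) ≤ maxEffDim c z τ :=
  le_ciSup (indexSet_bddAbove (history c z c.T) τ fun L => effDim c.k c.α (prompts L)) (g, m)

/-- This is `log (1+x) ≥ x/(1+x)`. With `y = 1/α`, the largest possible squared deviation, it trades
squared deviations for increments of the log-determinant at the price of the factor `1 + 1/α`. -/
theorem le_mul_log_one_add {x y : ℝ} (hx : 0 ≤ x) (hxy : x ≤ y) :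
    x ≤ (1 + y) * Real.log (1 + x) := by
  have h1 : x / (1 + x) ≤ Real.log (1 + x) := by
    have := Real.one_sub_inv_le_log_of_pos (show 0 < 1 + x by linarith)
    have h2 : x / (1 + x) = 1 - (1 + x)⁻¹ := by field_simp; ring
    rwa [h2]
  rw [div_le_iff₀ (by linarith)] at h1
  have h0 : 0 ≤ Real.log (1 + x) := Real.log_nonneg (by linarith)
  nlinarith

open Classical in
-- Cauchy–Schwarz over the at most `T` exploring rounds reduces to squared deviations, which add up
-- to at most `G M` telescoped information gains, one for each arm and stage.
theorem sum_sqrt_chosenVar_le (hk : ∀ t t', c.k t t' = inner ℝ (φ t) (φ t')) (hα : 0 < c.α)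
    (hnorm : ∀ t, c.k t t = 1) {M : ℕ}
    (hM : ∀ i < c.T, Explores c z i → chosenStage c z i ∈ Finset.Icc 1 M) (τ : Target) :
    ∑ i ∈ (Finset.range c.T).filter (Explores c z), √(chosenVar c z τ i)
      ≤ √2 * √(1 + 1 / c.α) * √(G * M * c.T * maxInfoGain c z τ) := by
  set S := (Finset.range c.T).filter (Explores c z) with hS
  have hv0 : ∀ i, 0 ≤ chosenVar c z τ i := fun i => krrVar_nonneg hk hα _ _
  have hv1 : ∀ i, chosenVar c z τ i ≤ 1 / c.α := fun i => by
    have := krrVar_le hk hα (prompts (indexSet (history c z i) τ (chosenArm c z i)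
      (chosenStage c z i))) (z i).1
    rw [hnorm, mul_one] at this
    simpa [chosenVar] using this
  have hα1 : 0 ≤ 1 + 1 / c.α := by positivity
  -- Each exploring round is counted for exactly one pair `(g, m)`, and `hM` keeps its stage within
  -- `1, …, M`.
  have h1 : ∑ i ∈ S, Real.log (1 + chosenVar c z τ i)
      = ∑ g : Fin G, ∑ m ∈ Finset.Icc 1 M,
        2 * infoGain c.k c.α (prompts (indexSet (history c z c.T) τ g m)) := by
    simp_rw [← sum_log_eq_infoGain (z := z) hk hα]
    rw [hS, Finset.sum_filter]
    have hcomm : ∀ F : Fin G → ℕ → ℕ → ℝ, ∑ g, ∑ m ∈ Finset.Icc 1 M, ∑ i ∈ Finset.range c.T, F g m i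
        = ∑ i ∈ Finset.range c.T, ∑ g, ∑ m ∈ Finset.Icc 1 M, F g m i := fun F => by
      rw [Finset.sum_comm]
      simp_rw [Finset.sum_comm (s := Finset.univ) (t := Finset.range c.T)]
      rw [Finset.sum_comm]
      refine Finset.sum_congr rfl fun i _ => Finset.sum_comm
    rw [hcomm]
    refine Finset.sum_congr rfl fun i hi => ?_
    split_ifs with he
    · rw [Finset.sum_eq_single (chosenArm c z i), Finset.sum_eq_single (chosenStage c z i)]
      · simp [he]
      · intro m _ hm; simp [hm.symm]
      · intro hn; exact absurd (hM i (Finset.mem_range.1 hi) he) hn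
      · intro g _ hg; simp [hg.symm]
      · simp
    · simp [he]
  have h2 : ∑ i ∈ S, chosenVar c z τ i ≤ (1 + 1 / c.α) * (2 * (G * M * maxInfoGain c z τ)) := by
    calc ∑ i ∈ S, chosenVar c z τ i
        ≤ ∑ i ∈ S, (1 + 1 / c.α) * Real.log (1 + chosenVar c z τ i) :=
          Finset.sum_le_sum fun i _ => le_mul_log_one_add (hv0 i) (hv1 i)
      _ ≤ (1 + 1 / c.α) * ∑ g : Fin G, ∑ m ∈ Finset.Icc 1 M, 2 * maxInfoGain c z τ := by
          rw [← Finset.mul_sum, h1]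
          gcongr
          exact infoGain_le_maxInfoGain _ _ _
      _ = _ := by
          simp only [Finset.sum_const, Finset.card_univ, Fintype.card_fin, Nat.card_Icc,
            Nat.add_sub_cancel, nsmul_eq_mul]
          ring
  have h3 : (∑ i ∈ S, √(chosenVar c z τ i)) ^ 2 ≤ c.T * ∑ i ∈ S, chosenVar c z τ i := by
    have hcard : (S.card : ℝ) ≤ c.T := by
      exact_mod_cast (Finset.card_filter_le _ _).trans (Finset.card_range _).le
    calc _ ≤ (S.card : ℝ) * ∑ i ∈ S, √(chosenVar c z τ i) ^ 2 := sq_sum_le_card_mul_sum_sq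
      _ = S.card * ∑ i ∈ S, chosenVar c z τ i := by simp_rw [Real.sq_sqrt (hv0 _)]
      _ ≤ _ := mul_le_mul_of_nonneg_right hcard (Finset.sum_nonneg fun i _ => hv0 i)
  rw [← Real.sqrt_mul zero_le_two, ← Real.sqrt_mul (by positivity)]
  apply Real.le_sqrt_of_sq_le
  calc _ ≤ _ := h3
    _ ≤ c.T * ((1 + 1 / c.α) * (2 * (G * M * maxInfoGain c z τ))) := by gcongr
    _ = _ := by ring

end InfoGain

/-! ### Deterministic regret bounds -/

section RegretBound

variable {𝒯 𝒳 : Type*} {G : ℕ} {c : Config 𝒯 𝒳 G} {z : ℕ → 𝒯 × (𝒳 × ℝ)}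
  {H : Type*} [NormedAddCommGroup H] [InnerProductSpace ℝ H] {φ : 𝒯 → H}

/-- The confidence sum `β^{(s)} √(G M T Γ^{(s)}) + λ β^{(D)} √(G M T Γ^{(D)})`. -/
def gainSum (c : Config 𝒯 𝒳 G) (z : ℕ → 𝒯 × (𝒳 × ℝ)) : ℝ :=
  c.beta .fidelity * √(G * c.M * c.T * maxInfoGain c z .fidelity) +
    c.lam * (c.beta .diversity * √(G * c.M * c.T * maxInfoGain c z .diversity))

theorem eta_nonneg : 0 ≤ c.eta := by unfold Config.eta; positivity

theorem beta_nonneg {τ : Target} (hB : 0 ≤ c.B τ) : 0 ≤ c.beta τ := by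
  have := eta_nonneg (c := c)
  unfold Config.beta; positivity

theorem gap_le_two_mul {f : Target → Fin G → 𝒯 → ℝ} (hlam : 0 ≤ c.lam)
    (hf : ∀ τ g t, |f τ g t| ≤ c.B τ) (g g' : Fin G) (t : 𝒯) :
    objective c f g t - objective c f g' t ≤ 2 * (c.B .fidelity + c.lam * c.B .diversity) := by
  have h1 := abs_le.1 (hf .fidelity g t)
  have h2 := abs_le.1 (hf .diversity g t)
  have h3 := abs_le.1 (hf .fidelity g' t)
  have h4 := abs_le.1 (hf .diversity g' t)
  simp only [objective]
  nlinarith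

theorem exists_isMax_objective (hG : 1 ≤ G) (f : Target → Fin G → 𝒯 → ℝ) (t : 𝒯) :
    ∃ g₀, (∀ g, objective c f g t ≤ objective c f g₀ t)
      ∧ (⨆ g, objective c f g t) = objective c f g₀ t := by
  have : Nonempty (Fin G) := ⟨⟨0, hG⟩⟩
  obtain ⟨g₀, hg₀⟩ := exists_eq_ciSup_of_finite (f := fun g => objective c f g t)
  refine ⟨g₀, fun g => ?_, hg₀.symm⟩
  rw [hg₀]
  exact le_ciSup (f := fun g => objective c f g t) (Set.finite_range _).bddAbove g

theorem regret_le_trivial (hG : 1 ≤ G) {f : Target → Fin G → 𝒯 → ℝ} (hlam : 0 ≤ c.lam)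
    (hf : ∀ τ g t, |f τ g t| ≤ c.B τ) :
    regret c f z ≤ c.T * (2 * (c.B .fidelity + c.lam * c.B .diversity)) := by
  have : ∀ i ∈ Finset.range c.T, (⨆ g, objective c f g (z i).1)
      - objective c f (chosenArm c z i) (z i).1
      ≤ 2 * (c.B .fidelity + c.lam * c.B .diversity) := by
    intro i _
    obtain ⟨g₀, _, h⟩ := exists_isMax_objective (c := c) hG f (z i).1
    rw [h]
    exact gap_le_two_mul hlam hf _ _ _
  simpa [regret] using Finset.sum_le_sum this

/-- Exploitation costs `2/√T` per round, `2√T` in total. Exploration costs `8 (1 + b)` times the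
widths, and the `√2` from the sum of deviations gives `8√2 ≤ 16`. The hypothesis `hM` ensures that
the inner loop never leaves the stages `1, …, M` on which accuracy is assumed. -/
theorem regret_le_of_accurate (hG : 1 ≤ G) (hT : 1 ≤ c.T) (hα : 0 < c.α) (hlam : 0 ≤ c.lam)
    (hk : ∀ t t', c.k t t' = inner ℝ (φ t) (φ t')) (hnorm : ∀ t, c.k t t = 1)
    (hpick : ∀ v S, S.Nonempty → c.pick v S ∈ S) {f : Target → Fin G → 𝒯 → ℝ}
    (hB : ∀ τ, 0 ≤ c.B τ) (hf : ∀ τ g t, |f τ g t| ≤ c.B τ) (hM1 : 1 ≤ c.M)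
    (hM : (2 : ℝ) ^ (1 - (c.M : ℤ)) ≤ 1 / √(c.T : ℝ))
    (hacc : ∀ i < c.T, ∀ m ∈ Finset.Icc 1 c.M,
      Accurate c (history c z i) (z i).1 (fun g => objective c f g (z i).1) m) :
    regret c f z ≤ 2 * √(c.T : ℝ) + 16 * ((1 + (c.B .fidelity + c.lam * c.B .diversity))
      * √(1 + 1 / c.α) * gainSum c z) := by
  classical
  set b := c.B .fidelity + c.lam * c.B .diversity with hb
  have hb0 : 0 ≤ b := add_nonneg (hB _) (mul_nonneg hlam (hB _))
  have hstage : ∀ i < c.T, Explores c z i → chosenStage c z i ∈ Finset.Icc 1 c.M := fun i _ _ =>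
    Finset.mem_Icc.2 ⟨(finalStage_spec hT).1, finalStage_le hM1 hM⟩
  have hround : ∀ i ∈ Finset.range c.T, (⨆ g, objective c f g (z i).1)
      - objective c f (chosenArm c z i) (z i).1
      ≤ 2 * (1 / √(c.T : ℝ)) + if Explores c z i then 8 * (1 + b)
        * (c.beta .fidelity * √(chosenVar c z .fidelity i)
          + c.lam * (c.beta .diversity * √(chosenVar c z .diversity i))) else 0 := by
    intro i hi
    obtain ⟨g₀, hg₀, h⟩ := exists_isMax_objective (c := c) hG f (z i).1
    have hH : ∀ m, 1 ≤ m → m ≤ finalStage c (history c z i) (z i).1 →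
        Accurate c (history c z i) (z i).1 (fun g => objective c f g (z i).1) m := fun m h1 h2 =>
      hacc i (Finset.mem_range.1 hi) m (Finset.mem_Icc.2 ⟨h1, h2.trans (finalStage_le hM1 hM)⟩)
    rw [h]
    split_ifs with he
    · have := gap_le_of_explore hT hpick hg₀ hb0 (gap_le_two_mul hlam hf _ _ _) hH he
      have h2 : 0 ≤ 2 * (1 / √(c.T : ℝ)) := by positivity
      exact this.trans (le_add_of_nonneg_left h2)
    · rw [add_zero]
      exact gap_le_of_exploit hG hT hpick hg₀ hH (not_not.1 he)
  have hTs : (c.T : ℝ) * (2 * (1 / √(c.T : ℝ))) = 2 * √(c.T : ℝ) := by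
    have hp : 0 < √(c.T : ℝ) := Real.sqrt_pos.2 (by exact_mod_cast hT)
    have : (c.T : ℝ) = √(c.T : ℝ) * √(c.T : ℝ) := (Real.mul_self_sqrt (by positivity)).symm
    nth_rewrite 1 [this]
    field_simp
  have hs2 : 8 * √2 ≤ 16 := by
    have : √2 ≤ 2 := Real.sqrt_le_iff.2 (by norm_num)
    linarith
  have hs := sum_sqrt_chosenVar_le hk hα hnorm hstage .fidelity
  have hD := sum_sqrt_chosenVar_le hk hα hnorm hstage .diversity
  have hbs := beta_nonneg (hB .fidelity)
  have hbD := beta_nonneg (hB .diversity)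
  calc regret c f z ≤ _ := Finset.sum_le_sum hround
    _ = 2 * √(c.T : ℝ) + 8 * (1 + b) * (c.beta .fidelity *
          (∑ i ∈ (Finset.range c.T).filter (Explores c z), √(chosenVar c z .fidelity i))
        + c.lam * (c.beta .diversity *
          (∑ i ∈ (Finset.range c.T).filter (Explores c z), √(chosenVar c z .diversity i)))) := by
      rw [Finset.sum_add_distrib, Finset.sum_const, Finset.card_range, nsmul_eq_mul, hTs,
        ← Finset.sum_filter, ← Finset.mul_sum, Finset.sum_add_distrib, ← Finset.mul_sum,
        ← Finset.mul_sum, ← Finset.mul_sum]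
    _ ≤ 2 * √(c.T : ℝ) + 8 * (1 + b) * (c.beta .fidelity *
          (√2 * √(1 + 1 / c.α) * √(G * c.M * c.T * maxInfoGain c z .fidelity))
        + c.lam * (c.beta .diversity *
          (√2 * √(1 + 1 / c.α) * √(G * c.M * c.T * maxInfoGain c z .diversity)))) := by
      gcongr
    _ = 2 * √(c.T : ℝ) + (8 * √2) * ((1 + b) * √(1 + 1 / c.α) * gainSum c z) := by
      rw [gainSum]; ring
    _ ≤ _ := by
      have : 0 ≤ (1 + b) * √(1 + 1 / c.α) * gainSum c z := by
        unfold gainSum; positivity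
      gcongr

/-- When `b √T > 1`, the first round explores, so that the information gain is bounded below. -/
theorem le_gainSum (hG : 1 ≤ G) (hT : 1 ≤ c.T) (hα : 0 < c.α) (hlam : 0 ≤ c.lam)
    (hk : ∀ t t', c.k t t' = inner ℝ (φ t) (φ t')) (hnorm : ∀ t, c.k t t = 1)
    (hB : ∀ τ, 0 ≤ c.B τ)
    (hb : 1 < (c.B .fidelity + c.lam * c.B .diversity) * √(c.T : ℝ)) :
    (c.B .fidelity + c.lam * c.B .diversity) * √(G * c.M * c.T / 2)
      ≤ √(1 + 1 / c.α) * gainSum c z := by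
  classical
  -- With empty index sets every deviation is `1/√α`, and `β ≥ B √α`, so every width is at least `b
  -- > 1/√T` and round `0` cannot exploit.
  have hexp : Explores c z 0 := by
    intro he
    obtain ⟨g, hg⟩ := candidates_nonempty (c := c) (h := history c z 0) (t := (z 0).1) hG
      (finalStage c (history c z 0) (z 0).1)
    have hw := he g hg
    have hdev : ∀ τ, deviation c (history c z 0) (z 0).1 τ
        (finalStage c (history c z 0) (z 0).1) g = 1 / √c.α := by
      intro τ
      have hv : ∀ p : Fin 0 → 𝒯, krrVar c.k c.α p (z 0).1 = c.α⁻¹ := fun p => by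
        simp [krrVar, hnorm]
      have hv' : krrVar c.k c.α (prompts (indexSet (history c z 0) τ g
          (finalStage c (history c z 0) (z 0).1))) (z 0).1 = c.α⁻¹ := hv _
      rw [deviation, hv', Real.sqrt_inv, one_div]
    have hβ : ∀ τ, c.B τ ≤ c.beta τ * (1 / √c.α) := by
      intro τ
      have hs : 0 < √c.α := Real.sqrt_pos.2 hα
      rw [mul_one_div, le_div_iff₀ hs, Config.beta]
      linarith [eta_nonneg (c := c)]
    rw [width, hdev, hdev] at hw
    have hTp : 0 < √(c.T : ℝ) := Real.sqrt_pos.2 (by exact_mod_cast hT)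
    have h1 := mul_le_mul_of_nonneg_left (hβ .diversity) hlam
    have h2 : c.B .fidelity + c.lam * c.B .diversity ≤ 1 / √(c.T : ℝ) := by
      linarith [hβ .fidelity]
    rw [le_div_iff₀ hTp] at h2
    linarith
  -- The index sets that receive round `0` already have this much information gain, and later rounds
  -- only add to it.
  have hgain : ∀ τ, 1 / 2 * Real.log (1 + c.α⁻¹) ≤ maxInfoGain c z τ := by
    intro τ
    have h1 := sum_log_eq_infoGain (z := z) hk hα τ (chosenArm c z 0) (chosenStage c z 0) c.T
    have h0 : chosenVar c z τ 0 = c.α⁻¹ := by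
      have hv : ∀ p : Fin 0 → 𝒯, krrVar c.k c.α p (z 0).1 = c.α⁻¹ := fun p => by
        simp [krrVar, hnorm]
      exact hv _
    have h2 : Real.log (1 + c.α⁻¹) ≤ ∑ i ∈ Finset.range c.T,
        (if Explores c z i ∧ chosenArm c z i = chosenArm c z 0
            ∧ chosenStage c z i = chosenStage c z 0
          then Real.log (1 + chosenVar c z τ i) else 0) := by
      rw [← h0]
      refine le_of_eq_of_le ?_ (Finset.single_le_sum (fun i _ => ?_) (Finset.mem_range.2 hT))
      · simp [hexp]
      · split_ifs
        · have : 0 ≤ chosenVar c z τ i := krrVar_nonneg hk hα _ _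
          exact Real.log_nonneg (by linarith)
        · exact le_rfl
    have h3 := infoGain_le_maxInfoGain (c := c) (z := z) τ (chosenArm c z 0) (chosenStage c z 0)
    linarith
  have hi : 0 < c.α⁻¹ := inv_pos.2 hα
  have hx : c.α⁻¹ ≤ (1 + 1 / c.α) * Real.log (1 + c.α⁻¹) := by
    rw [one_div]; exact le_mul_log_one_add hi.le le_rfl
  have hroot : ∀ τ, 1 / √c.α * √(G * c.M * c.T / 2)
      ≤ √(1 + 1 / c.α) * √(G * c.M * c.T * maxInfoGain c z τ) := by
    intro τ
    rw [one_div, ← Real.sqrt_inv, ← Real.sqrt_mul hi.le, ← Real.sqrt_mul (by positivity)]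
    apply Real.sqrt_le_sqrt
    calc c.α⁻¹ * (G * c.M * c.T / 2)
        ≤ ((1 + 1 / c.α) * Real.log (1 + c.α⁻¹)) * (G * c.M * c.T / 2) := by gcongr
      _ = (1 + 1 / c.α) * (G * c.M * c.T * (1 / 2 * Real.log (1 + c.α⁻¹))) := by ring
      _ ≤ _ := by gcongr; exact hgain τ
  have hβ : ∀ τ, c.B τ * √(G * c.M * c.T / 2)
      ≤ √(1 + 1 / c.α) * (c.beta τ * √(G * c.M * c.T * maxInfoGain c z τ)) := by
    intro τ
    have hs : 0 < √c.α := Real.sqrt_pos.2 hα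
    calc c.B τ * √(G * c.M * c.T / 2)
        ≤ (c.beta τ * (1 / √c.α)) * √(G * c.M * c.T / 2) := by
          gcongr
          rw [mul_one_div, le_div_iff₀ hs, Config.beta]
          linarith [eta_nonneg (c := c)]
      _ = c.beta τ * (1 / √c.α * √(G * c.M * c.T / 2)) := by ring
      _ ≤ c.beta τ * (√(1 + 1 / c.α) * √(G * c.M * c.T * maxInfoGain c z τ)) :=
          mul_le_mul_of_nonneg_left (hroot τ) (beta_nonneg (hB τ))
      _ = _ := by ring
  have h1 := hβ .fidelity
  have h2 := mul_le_mul_of_nonneg_left (hβ .diversity) hlam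
  rw [gainSum]
  linarith

end RegretBound

/-! ### Decisions up to stage `m` do not depend on the labels of stages `≥ m` -/

section Coupling

variable {𝒯 𝒳 : Type*} {G : ℕ}

/-- Two rounds that agree in everything that decisions up to stage `m` may depend on: their prompts,
all data when they stop before stage `m`, and membership in the index sets of stage `m`. -/
structure SameUpTo (m : ℕ) (r r' : Round 𝒯 𝒳 G) : Prop where
  prompt_eq : r.prompt = r'.prompt
  lt_iff : r.stage < m ↔ r'.stage < m
  eq_of_lt : r.stage < m → r = r'
  mem_iff : ∀ τ g, (r.appended τ = true ∧ r.arm = g ∧ r.stage = m)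
    ↔ (r'.appended τ = true ∧ r'.arm = g ∧ r'.stage = m)

theorem SameUpTo.refl (m : ℕ) (r : Round 𝒯 𝒳 G) : SameUpTo m r r :=
  ⟨rfl, Iff.rfl, fun _ => rfl, fun _ _ => Iff.rfl⟩

theorem SameUpTo.symm {m : ℕ} {r r' : Round 𝒯 𝒳 G} (H : SameUpTo m r r') : SameUpTo m r' r :=
  ⟨H.prompt_eq.symm, H.lt_iff.symm, fun h => (H.eq_of_lt (H.lt_iff.2 h)).symm,
    fun τ g => (H.mem_iff τ g).symm⟩

abbrev SameHistory (m : ℕ) (h h' : List (Round 𝒯 𝒳 G)) : Prop := List.Forall₂ (SameUpTo m) h h'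

theorem SameHistory.symm {m : ℕ} {h h' : List (Round 𝒯 𝒳 G)} (H : SameHistory m h h') :
    SameHistory m h' h := by
  induction H with
  | nil => exact List.Forall₂.nil
  | cons hr _ ih => exact List.Forall₂.cons hr.symm ih

theorem SameHistory.indexSet_eq {m m' : ℕ} {h h' : List (Round 𝒯 𝒳 G)} (H : SameHistory m h h')
    (hm : m' < m) (τ : Target) (g : Fin G) : indexSet h τ g m' = indexSet h' τ g m' := by
  classical
  induction H with
  | nil => rfl
  | @cons r r' l l' hr _ ih =>
    simp only [indexSet] at ih ⊢
    by_cases hs : r.stage < m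
    · rw [← hr.eq_of_lt hs, List.filter_cons, List.filter_cons, ih]
    · have hs' : ¬ r'.stage < m := fun h => hs (hr.lt_iff.2 h)
      rw [List.filter_cons_of_neg, List.filter_cons_of_neg, ih]
      · simp only [decide_eq_true_eq]; omega
      · simp only [decide_eq_true_eq]; omega

/-- At stage `m` itself the two histories share membership and prompts but not labels. This
determines the posterior deviations, which involve no labels, but not the estimates. -/
theorem SameHistory.map_prompt_indexSet_eq {m : ℕ} {h h' : List (Round 𝒯 𝒳 G)}
    (H : SameHistory m h h') (τ : Target) (g : Fin G) :
    (indexSet h τ g m).map Round.prompt = (indexSet h' τ g m).map Round.prompt := by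
  classical
  induction H with
  | nil => rfl
  | @cons r r' l l' hr _ ih =>
    simp only [indexSet] at ih ⊢
    by_cases hs : r.appended τ = true ∧ r.arm = g ∧ r.stage = m
    · have hs' := (hr.mem_iff τ g).1 hs
      rw [List.filter_cons_of_pos (by simpa using hs), List.filter_cons_of_pos (by simpa using hs'),
        List.map_cons, List.map_cons, ih, hr.prompt_eq]
    · have hs' := fun h => hs ((hr.mem_iff τ g).2 h)
      rw [List.filter_cons_of_neg (by simpa using hs), List.filter_cons_of_neg (by simpa using hs'),
        ih]

/-- The snapshot of stage `m'` ends before the first round that reached stage `m'`, so it reads only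
rounds that stopped earlier, and these are identical in both histories. Freezing the archives is
what keeps feedback from stage `m` on out of the labels of earlier stages. -/
theorem SameHistory.snapshot_eq {m m' : ℕ} {h h' : List (Round 𝒯 𝒳 G)} (H : SameHistory m h h')
    (hm : m' ≤ m) (g : Fin G) : snapshot h g m' = snapshot h' g m' := by
  classical
  have : (h.takeWhile fun r => decide (r.stage < m'))
      = h'.takeWhile fun r => decide (r.stage < m') := by
    induction H with
    | nil => rfl
    | @cons r r' l l' hr _ ih =>
      by_cases hs : r.stage < m'
      · rw [← hr.eq_of_lt (hs.trans_le hm), List.takeWhile_cons_of_pos (by simpa using hs),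
          List.takeWhile_cons_of_pos (by simpa using hs), ih]
      · have hs' : ¬ r'.stage < m' := fun h' => hs (by
          rwa [hr.eq_of_lt (hr.lt_iff.2 (h'.trans_le hm))])
        rw [List.takeWhile_cons_of_neg (by simpa using hs),
          List.takeWhile_cons_of_neg (by simpa using hs')]
  simp only [snapshot, this]

theorem krrVar_prompts_of_length (k : 𝒯 → 𝒯 → ℝ) (α : ℝ) (L : List (Round 𝒯 𝒳 G)) (t : 𝒯)
    {n : ℕ} (hn : L.length = n) :
    krrVar k α (prompts L) t
      = krrVar k α (fun i : Fin n => (L.get (i.cast hn.symm)).prompt) t := by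
  subst hn; rfl

theorem krrVar_prompts_eq_map (k : 𝒯 → 𝒯 → ℝ) (α : ℝ) (L : List (Round 𝒯 𝒳 G)) (t : 𝒯) :
    krrVar k α (prompts L) t = krrVar k α (L.map Round.prompt).get t := by
  rw [krrVar_prompts_of_length k α L t (n := (L.map Round.prompt).length) (by simp)]
  congr 1
  funext i
  simp

variable {c : Config 𝒯 𝒳 G}

theorem SameHistory.estimate_eq {m m' : ℕ} {h h' : List (Round 𝒯 𝒳 G)} (H : SameHistory m h h')
    (hm : m' < m) (t : 𝒯) (τ : Target) (g : Fin G) :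
    estimate c h t τ m' g = estimate c h' t τ m' g := by
  unfold estimate; rw [H.indexSet_eq hm]

theorem SameHistory.deviation_eq {m m' : ℕ} {h h' : List (Round 𝒯 𝒳 G)} (H : SameHistory m h h')
    (hm : m' ≤ m) (t : 𝒯) (τ : Target) (g : Fin G) :
    deviation c h t τ m' g = deviation c h' t τ m' g := by
  rcases hm.lt_or_eq with hm | rfl
  · unfold deviation; rw [H.indexSet_eq hm]
  · unfold deviation; rw [krrVar_prompts_eq_map, H.map_prompt_indexSet_eq, krrVar_prompts_eq_map]

theorem SameHistory.width_eq {m m' : ℕ} {h h' : List (Round 𝒯 𝒳 G)} (H : SameHistory m h h')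
    (hm : m' ≤ m) (t : 𝒯) : width c h t m' = width c h' t m' := by
  funext g
  simp only [width, H.deviation_eq hm]

theorem SameHistory.score_eq {m m' : ℕ} {h h' : List (Round 𝒯 𝒳 G)} (H : SameHistory m h h')
    (hm : m' < m) (t : 𝒯) : score c h t m' = score c h' t m' := by
  funext g
  simp only [score, H.deviation_eq hm.le, H.estimate_eq hm]

theorem SameHistory.candidates_eq {m m' : ℕ} {h h' : List (Round 𝒯 𝒳 G)} (H : SameHistory m h h')
    (hm : m' ≤ m) (t : 𝒯) : candidates c h t m' = candidates c h' t m' := by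
  induction m' with
  | zero => rfl
  | succ m' ih =>
    rcases Nat.eq_zero_or_pos m' with rfl | h0
    · rfl
    · ext g
      rw [mem_candidates_succ h0, mem_candidates_succ h0, ih (by omega),
        H.score_eq (by omega : m' < m)]

theorem SameHistory.widthsLE_iff {m m' : ℕ} {h h' : List (Round 𝒯 𝒳 G)} (H : SameHistory m h h')
    (hm : m' ≤ m) (t : 𝒯) (r : ℝ) : WidthsLE c h t m' r ↔ WidthsLE c h' t m' r := by
  simp only [WidthsLE, H.candidates_eq hm, H.width_eq hm]

theorem SameHistory.exploits_iff {m m' : ℕ} {h h' : List (Round 𝒯 𝒳 G)} (H : SameHistory m h h')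
    (hm : m' ≤ m) (t : 𝒯) : Exploits c h t m' ↔ Exploits c h' t m' := H.widthsLE_iff hm t _

/-- Whether a stage eliminates is decided by candidates and widths, and these agree up to and
including stage `m`. -/
theorem SameHistory.finalStage_le {m : ℕ} {h h' : List (Round 𝒯 𝒳 G)} (H : SameHistory m h h')
    (hT : 1 ≤ c.T) {t : 𝒯} (hf : finalStage c h t ≤ m) :
    finalStage c h' t ≤ finalStage c h t := by
  obtain ⟨h1, h2⟩ := finalStage_spec (c := c) (h := h) (t := t) hT
  refine Nat.sInf_le ⟨h1, ?_⟩
  rwa [Eliminates, ← H.exploits_iff hf, ← H.widthsLE_iff hf]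

theorem SameHistory.finalStage_eq {m : ℕ} {h h' : List (Round 𝒯 𝒳 G)} (H : SameHistory m h h')
    (hT : 1 ≤ c.T) {t : 𝒯} (hf : finalStage c h t ≤ m) :
    finalStage c h' t = finalStage c h t := by
  have h1 := H.finalStage_le hT hf
  exact le_antisymm h1 (H.symm.finalStage_le hT (h1.trans hf))

theorem SameHistory.exploits_finalStage_iff {m : ℕ} {h h' : List (Round 𝒯 𝒳 G)}
    (H : SameHistory m h h') (hT : 1 ≤ c.T) {t : 𝒯} (hf : finalStage c h t ≤ m) :
    Exploits c h' t (finalStage c h' t) ↔ Exploits c h t (finalStage c h t) := by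
  rw [H.finalStage_eq hT hf, H.exploits_iff hf]

/-- Exploration compares widths, so the arm agrees even at stage `m`. Exploitation compares scores,
which contain labels, and agrees only strictly below `m`. For this reason `SameUpTo` asks for equal
index-set membership at stage `m` rather than for equal arms. -/
theorem SameHistory.selectArm_eq_of_explore {m : ℕ} {h h' : List (Round 𝒯 𝒳 G)}
    (H : SameHistory m h h') (hT : 1 ≤ c.T) {t : 𝒯} (hf : finalStage c h t ≤ m)
    (he : ¬ Exploits c h t (finalStage c h t)) :
    selectArm c h' t = selectArm c h t := by
  have he' := (H.exploits_finalStage_iff hT hf).not.2 he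
  refine (if_neg he').trans (Eq.trans ?_ (if_neg he).symm)
  simp only [H.finalStage_eq hT hf, H.candidates_eq hf, H.width_eq hf]

theorem SameHistory.selectArm_eq_of_lt {m : ℕ} {h h' : List (Round 𝒯 𝒳 G)}
    (H : SameHistory m h h') (hT : 1 ≤ c.T) {t : 𝒯} (hf : finalStage c h t < m) :
    selectArm c h' t = selectArm c h t := by
  by_cases he : Exploits c h t (finalStage c h t)
  · have he' := (H.exploits_finalStage_iff hT hf.le).2 he
    refine (if_pos he').trans (Eq.trans ?_ (if_pos he).symm)
    simp only [H.finalStage_eq hT hf.le, H.candidates_eq hf.le, H.score_eq hf]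
  · exact H.selectArm_eq_of_explore hT hf.le he

/-- The feedback of a round that stops at stage `m` or later may be altered at will without breaking
the coupling. The noise bound rests on this invariance. -/
theorem SameHistory.sameUpTo_playRound {m : ℕ} {h h' : List (Round 𝒯 𝒳 G)}
    (H : SameHistory m h h') (hT : 1 ≤ c.T) (t : 𝒯) (x x' : 𝒳 × ℝ)
    (hx : finalStage c h t < m → x = x') :
    SameUpTo m (playRound c h (t, x)) (playRound c h' (t, x')) where
  prompt_eq := rfl
  lt_iff := by
    constructor
    · intro hf; exact (H.finalStage_le hT (le_of_lt hf)).trans_lt hf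
    · intro hf; exact (H.symm.finalStage_le hT (le_of_lt hf)).trans_lt hf
  eq_of_lt := by
    intro hf
    have hf' : finalStage c h t < m := hf
    obtain rfl := hx hf
    simp only [playRound, Round.mk.injEq, true_and]
    refine ⟨(H.selectArm_eq_of_lt hT hf').symm, (H.finalStage_eq hT hf'.le).symm, ?_, ?_⟩
    · exact funext fun _ => decide_eq_decide.2 (H.exploits_finalStage_iff hT hf'.le).not.symm
    · simp only [H.finalStage_eq hT hf'.le, H.selectArm_eq_of_lt hT hf', H.snapshot_eq hf'.le]
  mem_iff := by
    have aux : ∀ (h h' : List (Round 𝒯 𝒳 G)) (x x' : 𝒳 × ℝ), SameHistory m h h' → ∀ τ g,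
        ((playRound c h (t, x)).appended τ = true ∧ (playRound c h (t, x)).arm = g
          ∧ (playRound c h (t, x)).stage = m) →
        ((playRound c h' (t, x')).appended τ = true ∧ (playRound c h' (t, x')).arm = g
          ∧ (playRound c h' (t, x')).stage = m) := by
      intro h h' x x' H τ g
      simp only [playRound, decide_eq_true_eq]
      rintro ⟨he, ha, hs⟩
      refine ⟨?_, ?_, ?_⟩
      · rwa [H.finalStage_eq hT hs.le, ← H.exploits_iff hs.le]
      · rwa [H.selectArm_eq_of_explore hT hs.le he]
      · rwa [H.finalStage_eq hT hs.le]
    exact fun τ g => ⟨aux h h' x x' H τ g, aux h' h x' x H.symm τ g⟩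

end Coupling

/-! ### Measurability of the algorithm -/

section Measurability

/-- Index sets have random size, so the Gram matrices live in varying types. Splitting according to
a statistic with countably many values (membership pattern, stage, arm) fixes the size, and on each
piece the map is an ordinary measurable function. -/
theorem measurable_of_countable_cases {A B ι : Type*} [MeasurableSpace A] [MeasurableSpace B]
    [MeasurableSpace ι] [Countable ι] [MeasurableSingletonClass ι] {s : A → ι} (hs : Measurable s)
    {f : A → B} (H : ∀ i, ∃ g : A → B, Measurable g ∧ ∀ a, s a = i → f a = g a) :
    Measurable f := by
  choose g hg hfg using H
  intro U hU
  have : f ⁻¹' U = ⋃ i, s ⁻¹' {i} ∩ g i ⁻¹' U := by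
    ext a
    simp only [Set.mem_preimage, Set.mem_iUnion, Set.mem_inter_iff, Set.mem_singleton_iff]
    constructor
    · intro h; exact ⟨s a, rfl, by rwa [← hfg _ a rfl]⟩
    · rintro ⟨i, hi, h⟩; rwa [hfg i a hi]
  rw [this]
  exact MeasurableSet.iUnion fun i => (hs (measurableSet_singleton i)).inter (hg i hU)

theorem measurable_matrix_det {A : Type*} [MeasurableSpace A] {n : ℕ}
    {M : A → Matrix (Fin n) (Fin n) ℝ} (hM : ∀ i j, Measurable fun a => M a i j) :
    Measurable fun a => (M a).det := by
  simp only [Matrix.det_apply, Units.smul_def, zsmul_eq_mul]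
  exact Finset.measurable_fun_sum _ fun σ _ => (Finset.measurable_fun_prod _ fun i _ => hM _ _).const_mul _

theorem measurable_matrix_inv {A : Type*} [MeasurableSpace A] {n : ℕ}
    {M : A → Matrix (Fin n) (Fin n) ℝ} (hM : ∀ i j, Measurable fun a => M a i j) (i j : Fin n) :
    Measurable fun a => (M a)⁻¹ i j := by
  simp only [Matrix.inv_def, Ring.inverse_eq_inv', Matrix.smul_apply, smul_eq_mul,
    Matrix.adjugate_apply]
  refine (measurable_matrix_det hM).inv.mul (measurable_matrix_det fun i' j' => ?_)
  simp only [Matrix.updateRow_apply]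
  split_ifs
  · exact measurable_const
  · exact hM _ _

variable {𝒯 𝒳 : Type*} [MeasurableSpace 𝒯] [MeasurableSpace 𝒳] {G : ℕ}

/-! ### Measurability of kernel ridge regression with a fixed number of prompts. -/

section KRR

variable {A : Type*} [MeasurableSpace A] {n : ℕ} {k : 𝒯 → 𝒯 → ℝ}
  (hk : Measurable fun p : 𝒯 × 𝒯 => k p.1 p.2) (α : ℝ) {p : A → Fin n → 𝒯} {t : A → 𝒯}
  (hp : ∀ i, Measurable fun a => p a i) (ht : Measurable t)

include hk hp ht

theorem measurable_krrWeight (i : Fin n) : Measurable fun a => krrWeight k α (p a) (t a) i := by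
  simp only [krrWeight, Matrix.mulVec, dotProduct, kvec]
  refine Finset.measurable_fun_sum _ fun j _ => (measurable_matrix_inv (fun i j => ?_) i j).mul
    (hk.comp (ht.prodMk (hp j)))
  simp only [ridge, gram, Matrix.add_apply, Matrix.of_apply, Matrix.smul_apply]
  exact (hk.comp ((hp i).prodMk (hp j))).add_const _

theorem measurable_krrVar : Measurable fun a => krrVar k α (p a) (t a) := by
  simp only [krrVar_eq_weight, kvec]
  exact ((hk.comp (ht.prodMk ht)).sub (Finset.measurable_fun_sum _ fun i _ =>
    (hk.comp (ht.prodMk (hp i))).mul (measurable_krrWeight hk α hp ht i))).const_mul _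

theorem measurable_krrMean {y : A → Fin n → ℝ} (hy : ∀ i, Measurable fun a => y a i) :
    Measurable fun a => krrMean k α (p a) (y a) (t a) := by
  simp only [krrMean, dotProduct, Matrix.mulVec, kvec]
  refine Finset.measurable_fun_sum _ fun i _ => (hk.comp (ht.prodMk (hp i))).mul
    (Finset.measurable_fun_sum _ fun j _ => (measurable_matrix_inv (fun i j => ?_) i j).mul (hy j))
  simp only [ridge, gram, Matrix.add_apply, Matrix.of_apply, Matrix.smul_apply]
  exact (hk.comp ((hp i).prodMk (hp j))).add_const _

end KRR

/-- The fields of a round as a tuple. -/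
def Round.data (r : Round 𝒯 𝒳 G) : 𝒯 × Fin G × 𝒳 × ℕ × (Target → Bool) × (Target → ℝ) :=
  (r.prompt, r.arm, r.output, r.stage, r.appended, r.label)

instance : MeasurableSpace (Round 𝒯 𝒳 G) := MeasurableSpace.comap Round.data inferInstance

theorem measurable_data : Measurable (Round.data : Round 𝒯 𝒳 G → _) := comap_measurable _

theorem measurable_prompt : Measurable (Round.prompt : Round 𝒯 𝒳 G → 𝒯) :=
  measurable_fst.comp measurable_data

theorem measurable_arm : Measurable (Round.arm : Round 𝒯 𝒳 G → Fin G) :=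
  (measurable_fst.comp measurable_snd).comp measurable_data

theorem measurable_output : Measurable (Round.output : Round 𝒯 𝒳 G → 𝒳) :=
  (measurable_fst.comp (measurable_snd.comp measurable_snd)).comp measurable_data

theorem measurable_stage : Measurable (Round.stage : Round 𝒯 𝒳 G → ℕ) :=
  (measurable_fst.comp (measurable_snd.comp (measurable_snd.comp measurable_snd))).comp
    measurable_data

theorem measurable_appended (τ : Target) :
    Measurable (fun r : Round 𝒯 𝒳 G => r.appended τ) :=
  (measurable_pi_apply τ).comp ((measurable_fst.comp (measurable_snd.comp (measurable_snd.comp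
    (measurable_snd.comp measurable_snd)))).comp measurable_data)

theorem measurable_label (τ : Target) :
    Measurable (fun r : Round 𝒯 𝒳 G => r.label τ) :=
  (measurable_pi_apply τ).comp ((measurable_snd.comp (measurable_snd.comp (measurable_snd.comp
    (measurable_snd.comp measurable_snd)))).comp measurable_data)

theorem measurableSet_mem_index (τ : Target) (g : Fin G) (m : ℕ) :
    MeasurableSet {r : Round 𝒯 𝒳 G | r.appended τ = true ∧ r.arm = g ∧ r.stage = m} :=
  ((measurable_appended τ) (measurableSet_singleton true)).inter
    ((measurable_arm (measurableSet_singleton g)).inter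
      (measurable_stage (measurableSet_singleton m)))

open Classical in
/-- The finite set of arms that satisfy `q`. -/
def armsOf (q : Fin G → Prop) : Finset (Fin G) := Finset.univ.filter fun g => q g

open Classical in
/-- The indices of the rounds of `v` that satisfy `q`. -/
def indices {n : ℕ} (q : Fin n → Prop) : List (Fin n) := (List.finRange n).filter fun i => q i

/-- Whether a round belongs to `Ψ_g^{m,(τ)}`. -/
def InIndex (τ : Target) (g : Fin G) (m : ℕ) (r : Round 𝒯 𝒳 G) : Prop :=
  r.appended τ = true ∧ r.arm = g ∧ r.stage = m

omit [MeasurableSpace 𝒯] [MeasurableSpace 𝒳] in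
theorem indexSet_ofFn {n : ℕ} (v : Fin n → Round 𝒯 𝒳 G) (τ : Target) (g : Fin G) (m : ℕ) :
    indexSet (List.ofFn v) τ g m = (indices fun i => InIndex τ g m (v i)).map v := by
  classical
  rw [indexSet, List.ofFn_eq_map, List.filter_map, indices]
  simp only [Function.comp_def, InIndex]
  congr!
  exact decide_eq_decide.2 Iff.rfl

theorem measurable_code {n : ℕ} {q : Round 𝒯 𝒳 G → Prop} (hq : MeasurableSet {r | q r}) :
    Measurable fun p : (Fin n → Round 𝒯 𝒳 G) × 𝒯 => fun i => q (p.1 i) :=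
  measurable_pi_lambda _ fun i =>
    measurableSet_setOfPred.1 (((measurable_pi_apply i).comp measurable_fst) hq)

omit [MeasurableSpace 𝒯] [MeasurableSpace 𝒳] in
theorem krrMean_map (k : 𝒯 → 𝒯 → ℝ) (α : ℝ) {n : ℕ} (l : List (Fin n))
    (v : Fin n → Round 𝒯 𝒳 G) (τ : Target) (t : 𝒯) :
    krrMean k α (prompts (l.map v)) (labels τ (l.map v)) t
      = krrMean k α (fun i : Fin l.length => (v (l.get i)).prompt)
          (fun i => (v (l.get i)).label τ) t := by
  have aux : ∀ (L : List (Round 𝒯 𝒳 G)) (N : ℕ) (hN : L.length = N),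
      krrMean k α (prompts L) (labels τ L) t
        = krrMean k α (fun i : Fin N => (L.get (i.cast hN.symm)).prompt)
          (fun i => (L.get (i.cast hN.symm)).label τ) t := by
    rintro L N rfl; rfl
  rw [aux _ l.length (by simp)]
  simp

omit [MeasurableSpace 𝒯] [MeasurableSpace 𝒳] in
theorem krrVar_map (k : 𝒯 → 𝒯 → ℝ) (α : ℝ) {n : ℕ} (l : List (Fin n))
    (v : Fin n → Round 𝒯 𝒳 G) (t : 𝒯) :
    krrVar k α (prompts (l.map v)) t
      = krrVar k α (fun i : Fin l.length => (v (l.get i)).prompt) t := by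
  rw [krrVar_prompts_of_length k α _ t (n := l.length) (by simp)]
  simp

variable {c : Config 𝒯 𝒳 G} {n : ℕ}

/-! ### The decisions as measurable functions of the history and the prompt. -/

section

variable (hkm : Measurable fun p : 𝒯 × 𝒯 => c.k p.1 p.2)
include hkm

theorem measurable_estimate (τ : Target) (m : ℕ) (g : Fin G) :
    Measurable fun p : (Fin n → Round 𝒯 𝒳 G) × 𝒯 => estimate c (List.ofFn p.1) p.2 τ m g := by
  refine measurable_of_countable_cases (measurable_code (measurableSet_mem_index τ g m)) fun q => ?_
  obtain ⟨l, hl⟩ : ∃ l, l = indices q := ⟨_, rfl⟩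
  refine ⟨fun p => krrMean c.k c.α (fun i : Fin l.length => (p.1 (l.get i)).prompt)
    (fun i => (p.1 (l.get i)).label τ) p.2, ?_, ?_⟩
  · exact measurable_krrMean (p := fun (p : (Fin n → Round 𝒯 𝒳 G) × 𝒯) (i : Fin l.length) =>
        (p.1 (l.get i)).prompt) (y := fun p i => (p.1 (l.get i)).label τ) (t := Prod.snd) hkm c.α
      (fun i => measurable_prompt.comp ((measurable_pi_apply _).comp measurable_fst))
      measurable_snd
      (fun i => (measurable_label τ).comp ((measurable_pi_apply _).comp measurable_fst))
  · rintro p rfl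
    rw [estimate, indexSet_ofFn, krrMean_map, hl]
    rfl

theorem measurable_deviation (τ : Target) (m : ℕ) (g : Fin G) :
    Measurable fun p : (Fin n → Round 𝒯 𝒳 G) × 𝒯 => deviation c (List.ofFn p.1) p.2 τ m g := by
  refine measurable_of_countable_cases (measurable_code (measurableSet_mem_index τ g m)) fun q => ?_
  obtain ⟨l, hl⟩ : ∃ l, l = indices q := ⟨_, rfl⟩
  refine ⟨fun p => √(krrVar c.k c.α
    (fun i : Fin l.length => (p.1 (l.get i)).prompt) p.2), ?_, ?_⟩
  · exact (measurable_krrVar (p := fun (p : (Fin n → Round 𝒯 𝒳 G) × 𝒯) (i : Fin l.length) =>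
        (p.1 (l.get i)).prompt) (t := Prod.snd) hkm c.α
      (fun i => measurable_prompt.comp ((measurable_pi_apply _).comp measurable_fst))
      measurable_snd).sqrt
  · rintro p rfl
    rw [deviation, indexSet_ofFn, krrVar_map, hl]
    rfl

theorem measurable_width (m : ℕ) (g : Fin G) :
    Measurable fun p : (Fin n → Round 𝒯 𝒳 G) × 𝒯 => width c (List.ofFn p.1) p.2 m g :=
  ((measurable_deviation hkm _ m g).const_mul _).add
    (((measurable_deviation hkm _ m g).const_mul _).const_mul _)

theorem measurable_score (m : ℕ) (g : Fin G) :
    Measurable fun p : (Fin n → Round 𝒯 𝒳 G) × 𝒯 => score c (List.ofFn p.1) p.2 m g :=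
  ((measurable_estimate hkm _ m g).add ((measurable_deviation hkm _ m g).const_mul _)).sub
    (((measurable_estimate hkm _ m g).sub ((measurable_deviation hkm _ m g).const_mul _)).const_mul _)

theorem measurableSet_mem_candidates (m : ℕ) (g : Fin G) :
    MeasurableSet {p : (Fin n → Round 𝒯 𝒳 G) × 𝒯 | g ∈ candidates c (List.ofFn p.1) p.2 m} := by
  induction m generalizing g with
  | zero => simp [candidates]
  | succ m ih =>
    rcases Nat.eq_zero_or_pos m with rfl | hm
    · simp [candidates]
    · simp only [mem_candidates_succ hm]
      refine (ih g).inter ?_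
      exact measurableSet_setOfPred.2 (Measurable.forall fun g' =>
        (measurableSet_setOfPred.1 (ih g')).imp (measurableSet_setOfPred.1 (measurableSet_le
          ((measurable_score hkm m g').sub (measurable_score hkm m g)) measurable_const)))

theorem measurableSet_widthsLE (m : ℕ) (r : ℝ) :
    MeasurableSet {p : (Fin n → Round 𝒯 𝒳 G) × 𝒯 | WidthsLE c (List.ofFn p.1) p.2 m r} := by
  exact measurableSet_setOfPred.2 (Measurable.forall fun g' =>
    (measurableSet_setOfPred.1 (measurableSet_mem_candidates hkm m g')).imp
      (measurableSet_setOfPred.1 (measurableSet_le (measurable_width hkm m g') measurable_const)))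

theorem measurableSet_exploits (m : ℕ) :
    MeasurableSet {p : (Fin n → Round 𝒯 𝒳 G) × 𝒯 | Exploits c (List.ofFn p.1) p.2 m} :=
  measurableSet_widthsLE hkm m _

theorem measurableSet_eliminates (m : ℕ) :
    MeasurableSet {p : (Fin n → Round 𝒯 𝒳 G) × 𝒯 | Eliminates c (List.ofFn p.1) p.2 m} :=
  (measurableSet_exploits hkm m).compl.inter (measurableSet_widthsLE hkm m _)

theorem measurable_finalStage (hT : 1 ≤ c.T) :
    Measurable fun p : (Fin n → Round 𝒯 𝒳 G) × 𝒯 => finalStage c (List.ofFn p.1) p.2 := by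
  refine measurable_to_countable' fun m => ?_
  have : (fun p : (Fin n → Round 𝒯 𝒳 G) × 𝒯 => finalStage c (List.ofFn p.1) p.2) ⁻¹' {m}
      = {p | (1 ≤ m ∧ ¬ Eliminates c (List.ofFn p.1) p.2 m)
        ∧ ∀ m' < m, 1 ≤ m' → Eliminates c (List.ofFn p.1) p.2 m'} := by
    ext p
    simp only [Set.mem_preimage, Set.mem_singleton_iff, Set.mem_ofPred_eq]
    constructor
    · rintro rfl
      exact ⟨finalStage_spec hT, fun m' h1 h2 => eliminates_of_lt_finalStage h2 h1⟩
    · rintro ⟨h1, h2⟩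
      refine le_antisymm (Nat.sInf_le h1) (not_lt.1 fun hlt => ?_)
      have hs := finalStage_spec (c := c) (h := List.ofFn p.1) (t := p.2) hT
      exact hs.2 (h2 _ hlt hs.1)
  rw [this]
  refine MeasurableSet.inter ((MeasurableSet.const _).inter (measurableSet_eliminates hkm m).compl) ?_
  exact measurableSet_setOfPred.2 (Measurable.forall fun m' => measurable_const.imp
    (measurable_const.imp (measurableSet_setOfPred.1 (measurableSet_eliminates hkm m'))))

theorem measurable_selectArm (hT : 1 ≤ c.T) (hpickm : ∀ S, Measurable fun v => c.pick v S) :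
    Measurable fun p : (Fin n → Round 𝒯 𝒳 G) × 𝒯 => selectArm c (List.ofFn p.1) p.2 := by
  classical
  refine measurable_of_countable_cases (measurable_finalStage hkm hT) fun m => ?_
  let S₁ : (Fin n → Round 𝒯 𝒳 G) × 𝒯 → Fin G → Prop := fun p g =>
    g ∈ candidates c (List.ofFn p.1) p.2 m ∧ ∀ g' ∈ candidates c (List.ofFn p.1) p.2 m,
      score c (List.ofFn p.1) p.2 m g' ≤ score c (List.ofFn p.1) p.2 m g
  let S₂ : (Fin n → Round 𝒯 𝒳 G) × 𝒯 → Fin G → Prop := fun p g =>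
    g ∈ candidates c (List.ofFn p.1) p.2 m ∧
      (2 : ℝ) ^ (1 - (m : ℤ)) < width c (List.ofFn p.1) p.2 m g
  have hS₁ : Measurable S₁ := by
    refine measurable_pi_lambda _ fun g => measurableSet_setOfPred.1 ?_
    refine (measurableSet_mem_candidates hkm m g).inter ?_
    exact measurableSet_setOfPred.2 (Measurable.forall fun g' =>
      (measurableSet_setOfPred.1 (measurableSet_mem_candidates hkm m g')).imp
        (measurableSet_setOfPred.1
          (measurableSet_le (measurable_score hkm m g') (measurable_score hkm m g))))
  have hS₂ : Measurable S₂ := by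
    refine measurable_pi_lambda _ fun g => measurableSet_setOfPred.1 ?_
    exact (measurableSet_mem_candidates hkm m g).inter
      (measurableSet_lt measurable_const (measurable_width hkm m g))
  refine ⟨fun p => if Exploits c (List.ofFn p.1) p.2 m then
      c.pick (score c (List.ofFn p.1) p.2 m) (armsOf (S₁ p))
    else c.pick (width c (List.ofFn p.1) p.2 m) (armsOf (S₂ p)), ?_, ?_⟩
  · refine Measurable.ite (measurableSet_exploits hkm m) ?_ ?_
    · refine measurable_of_countable_cases hS₁ fun s =>
        ⟨fun p => c.pick (score c (List.ofFn p.1) p.2 m) (armsOf s),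
          (hpickm _).comp (measurable_pi_lambda _ fun g => measurable_score hkm m g), ?_⟩
      rintro p rfl; rfl
    · refine measurable_of_countable_cases hS₂ fun s =>
        ⟨fun p => c.pick (width c (List.ofFn p.1) p.2 m) (armsOf s),
          (hpickm _).comp (measurable_pi_lambda _ fun g => measurable_width hkm m g), ?_⟩
      rintro p rfl; rfl
  · rintro p rfl
    by_cases he : Exploits c (List.ofFn p.1) p.2 (finalStage c (List.ofFn p.1) p.2)
    · refine (if_pos he).trans (Eq.trans ?_ (if_pos he).symm)
      congr 1
      ext g
      simp [armsOf, S₁]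
    · refine (if_neg he).trans (Eq.trans ?_ (if_neg he).symm)
      congr 1
      ext g
      simp [armsOf, S₂]

end

open Classical in
/-- The indices of the rounds that enter the snapshot of arm `g` at stage `m`. -/
def snapshotIndices (q q' : Fin n → Prop) : List (Fin n) :=
  ((List.finRange n).takeWhile fun i => q i).filter fun i => q' i

omit [MeasurableSpace 𝒯] [MeasurableSpace 𝒳] in
theorem snapshot_ofFn (v : Fin n → Round 𝒯 𝒳 G) (g : Fin G) (m : ℕ) :
    snapshot (List.ofFn v) g m
      = (snapshotIndices (fun i => (v i).stage < m) fun i => (v i).arm = g).map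
          fun i => ((v i).prompt, (v i).output) := by
  classical
  rw [snapshot, List.ofFn_eq_map, List.takeWhile_map, List.filter_map, List.map_map,
    snapshotIndices]
  simp only [Function.comp_def]
  congr!

theorem measurable_divLabel (hdivm : ∀ g n, Measurable fun p : (Fin n → 𝒯 × 𝒳) × (𝒯 × 𝒳) =>
      c.divLabel g (List.ofFn p.1) p.2) (g : Fin G) (m : ℕ) :
    Measurable fun p : ((Fin n → Round 𝒯 𝒳 G) × 𝒯) × 𝒳 =>
      c.divLabel g (snapshot (List.ofFn p.1.1) g m) (p.1.2, p.2) := by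
  have h1 : MeasurableSet {r : Round 𝒯 𝒳 G | r.stage < m} :=
    measurable_stage (measurableSet_Iio (a := m))
  have h2 : MeasurableSet {r : Round 𝒯 𝒳 G | r.arm = g} :=
    measurable_arm (measurableSet_singleton g)
  refine measurable_of_countable_cases (((measurable_code h1).prodMk (measurable_code h2)).comp
    measurable_fst) fun q => ?_
  let l := snapshotIndices q.1 q.2
  refine ⟨fun p => c.divLabel g (List.ofFn fun i : Fin l.length =>
    ((p.1.1 (l.get i)).prompt, (p.1.1 (l.get i)).output)) (p.1.2, p.2), ?_, ?_⟩
  · have hl : Measurable fun p : ((Fin n → Round 𝒯 𝒳 G) × 𝒯) × 𝒳 => fun i : Fin l.length =>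
        ((p.1.1 (l.get i)).prompt, (p.1.1 (l.get i)).output) :=
      measurable_pi_lambda _ fun i =>
        (measurable_prompt.prodMk measurable_output).comp
          ((measurable_pi_apply (l.get i)).comp (measurable_fst.comp measurable_fst))
    exact (hdivm g l.length).comp
      (hl.prodMk ((measurable_snd.comp measurable_fst).prodMk measurable_snd))
  · rintro p rfl
    rw [snapshot_ofFn]
    congr 1
    apply List.ext_get
    · simp [l]
    · intro i h1 h2
      simp [l]

theorem measurable_playRound (hkm : Measurable fun p : 𝒯 × 𝒯 => c.k p.1 p.2) (hT : 1 ≤ c.T)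
    (hpickm : ∀ S, Measurable fun v => c.pick v S)
    (hdivm : ∀ g n, Measurable fun p : (Fin n → 𝒯 × 𝒳) × (𝒯 × 𝒳) =>
      c.divLabel g (List.ofFn p.1) p.2) :
    Measurable fun p : (Fin n → Round 𝒯 𝒳 G) × (𝒯 × (𝒳 × ℝ)) =>
      playRound c (List.ofFn p.1) p.2 := by
  classical
  have hvt : Measurable fun p : (Fin n → Round 𝒯 𝒳 G) × (𝒯 × (𝒳 × ℝ)) => (p.1, p.2.1) :=
    measurable_fst.prodMk (measurable_fst.comp measurable_snd)
  have harm := (measurable_selectArm (n := n) hkm hT hpickm).comp hvt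
  have hstage := (measurable_finalStage (n := n) hkm hT).comp hvt
  have hx : Measurable fun p : (Fin n → Round 𝒯 𝒳 G) × (𝒯 × (𝒳 × ℝ)) => p.2.2.1 :=
    measurable_fst.comp (measurable_snd.comp measurable_snd)
  have hy : Measurable fun p : (Fin n → Round 𝒯 𝒳 G) × (𝒯 × (𝒳 × ℝ)) => p.2.2.2 :=
    measurable_snd.comp (measurable_snd.comp measurable_snd)
  refine measurable_comap_iff.2 ?_
  refine (measurable_fst.comp measurable_snd).prodMk (harm.prodMk (hx.prodMk (hstage.prodMk
    (Measurable.prodMk ?_ ?_))))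
  · refine measurable_pi_lambda _ fun τ => ?_
    refine measurable_of_countable_cases hstage fun m => ?_
    refine ⟨fun p => decide (¬ Exploits c (List.ofFn p.1) p.2.1 m), ?_, ?_⟩
    · refine measurable_to_bool ?_
      have : (fun p : (Fin n → Round 𝒯 𝒳 G) × (𝒯 × (𝒳 × ℝ)) =>
          decide (¬ Exploits c (List.ofFn p.1) p.2.1 m)) ⁻¹' {true}
          = (fun p => (p.1, p.2.1)) ⁻¹'
            {p : (Fin n → Round 𝒯 𝒳 G) × 𝒯 | Exploits c (List.ofFn p.1) p.2 m}ᶜ := by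
        ext p; simp
      rw [this]
      exact hvt (measurableSet_exploits hkm m).compl
    · rintro p rfl; rfl
  · refine measurable_pi_lambda _ fun τ => ?_
    cases τ with
    | fidelity => exact hy
    | diversity =>
      refine measurable_of_countable_cases (harm.prodMk hstage) fun q => ?_
      refine ⟨fun p => c.divLabel q.1 (snapshot (List.ofFn p.1) q.1 q.2) (p.2.1, p.2.2.1),
        (measurable_divLabel hdivm q.1 q.2).comp (hvt.prodMk hx), ?_⟩
      rintro p rfl; rfl

/-- The history after `n` rounds as a vector. -/
def historyVec (c : Config 𝒯 𝒳 G) (z : ℕ → 𝒯 × (𝒳 × ℝ)) (n : ℕ) : Fin n → Round 𝒯 𝒳 G :=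
  fun i => playRound c (history c z i) (z i)

omit [MeasurableSpace 𝒯] [MeasurableSpace 𝒳] in
theorem ofFn_historyVec (z : ℕ → 𝒯 × (𝒳 × ℝ)) (n : ℕ) :
    List.ofFn (historyVec c z n) = history c z n := by
  induction n with
  | zero => rfl
  | succ n ih =>
    rw [List.ofFn_succ', history, List.concat_eq_append]
    exact congrArg (· ++ [playRound c (history c z n) (z n)]) ih

omit [MeasurableSpace 𝒯] [MeasurableSpace 𝒳] in
theorem historyVec_succ (z : ℕ → 𝒯 × (𝒳 × ℝ)) (n : ℕ) :
    historyVec c z (n + 1)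
      = Fin.snoc (historyVec c z n) (playRound c (List.ofFn (historyVec c z n)) (z n)) := by
  rw [ofFn_historyVec]
  funext i
  refine Fin.lastCases ?_ (fun i => ?_) i
  · simp [historyVec]
  · simp [historyVec]

theorem measurable_snoc {A B : Type*} [MeasurableSpace A] [MeasurableSpace B] {n : ℕ}
    {f : A → Fin n → B} {g : A → B} (hf : Measurable f) (hg : Measurable g) :
    Measurable fun a => (Fin.snoc (f a) (g a) : Fin (n + 1) → B) := by
  refine measurable_pi_lambda _ fun i => ?_
  refine Fin.lastCases ?_ (fun i => ?_) i
  · simpa using hg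
  · simpa [Function.comp_def] using (measurable_pi_apply i).comp hf

/-- Adaptedness: measurability is with respect to the `σ`-algebra of the first `n` rounds, so that
events about the history qualify for the conditions in `IsRun`. -/
theorem measurable_historyVec {Ω : Type*} [MeasurableSpace Ω] (Z : ℕ → Ω → 𝒯 × (𝒳 × ℝ))
    (hkm : Measurable fun p : 𝒯 × 𝒯 => c.k p.1 p.2) (hT : 1 ≤ c.T)
    (hpickm : ∀ S, Measurable fun v => c.pick v S)
    (hdivm : ∀ g n, Measurable fun p : (Fin n → 𝒯 × 𝒳) × (𝒯 × 𝒳) =>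
      c.divLabel g (List.ofFn p.1) p.2) (n : ℕ) :
    Measurable[past Z n] fun ω => historyVec c (fun j => Z j ω) n := by
  induction n with
  | zero => exact @measurable_const' _ _ _ (past Z 0) _ fun _ _ => Subsingleton.elim _ _
  | succ n ih =>
    simp only [historyVec_succ]
    have hle : past Z n ≤ past Z (n + 1) := iSup_le fun j =>
      le_iSup (fun j : Fin (n + 1) => MeasurableSpace.comap (Z j) inferInstance) j.castSucc
    have hz : Measurable[past Z (n + 1)] (Z n) := by
      have : MeasurableSpace.comap (Z n) inferInstance ≤ past Z (n + 1) :=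
        le_iSup (fun j : Fin (n + 1) => MeasurableSpace.comap (Z j) inferInstance) (Fin.last n)
      exact (comap_measurable (Z n)).mono this le_rfl
    have ih' := ih.mono hle le_rfl
    exact @measurable_snoc _ _ (past Z (n + 1)) _ _ _ _ ih'
      ((measurable_playRound hkm hT hpickm hdivm).comp (ih'.prodMk hz))

end Measurability

/-! ### Law of a run -/

section Law

variable {𝒯 𝒳 Ω : Type*} [MeasurableSpace 𝒯] [MeasurableSpace 𝒳] [MeasurableSpace Ω] {G : ℕ}

/-- The kernel, the selection rule and the label rule are measurable, and there is a round. -/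
structure MeasurableRules (c : Config 𝒯 𝒳 G) : Prop where
  one_le_T : 1 ≤ c.T
  kernel : Measurable fun p : 𝒯 × 𝒯 => c.k p.1 p.2
  pick : ∀ S, Measurable fun v => c.pick v S
  divLabel : ∀ g n, Measurable fun p : (Fin n → 𝒯 × 𝒳) × (𝒯 × 𝒳) =>
    c.divLabel g (List.ofFn p.1) p.2

variable {c : Config 𝒯 𝒳 G} {PT : Measure 𝒯} [IsProbabilityMeasure PT]
  {P : Fin G → Kernel 𝒯 𝒳} [∀ g, IsMarkovKernel (P g)]
  {Q : Fin G → Kernel (𝒯 × 𝒳) ℝ} [∀ g, IsMarkovKernel (Q g)]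
  {μ : Measure Ω} [IsProbabilityMeasure μ] {Z : ℕ → Ω → 𝒯 × (𝒳 × ℝ)}

/-- The history of the run after `n` rounds. -/
def runVec (c : Config 𝒯 𝒳 G) (Z : ℕ → Ω → 𝒯 × (𝒳 × ℝ)) (n : ℕ) (ω : Ω) :
    Fin n → Round 𝒯 𝒳 G := historyVec c (fun j => Z j ω) n

theorem past_le (hZ : ∀ i, Measurable (Z i)) (n : ℕ) : past Z n ≤ ‹MeasurableSpace Ω› :=
  iSup_le fun j => (hZ j).comap_le

theorem measurable_runVec_past (hc : MeasurableRules c) (n : ℕ) :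
    Measurable[past Z n] (runVec c Z n) :=
  measurable_historyVec Z hc.kernel hc.one_le_T hc.pick hc.divLabel n

theorem measurable_runVec (hc : MeasurableRules c) (hZ : ∀ i, Measurable (Z i)) (n : ℕ) :
    Measurable (runVec c Z n) :=
  (measurable_runVec_past hc n).mono (past_le hZ n) le_rfl

omit [∀ g, IsMarkovKernel (P g)] [∀ g, IsMarkovKernel (Q g)] in
-- The condition on prompts in `IsRun` fixes the joint law of history and prompt on rectangles,
-- which identifies it as a product measure.
theorem lintegral_prompt (hc : MeasurableRules c) (hrun : IsRun c PT P Q μ Z) {n : ℕ} (hn : n < c.T)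
    {F : (Fin n → Round 𝒯 𝒳 G) × 𝒯 → ℝ≥0∞} (hF : Measurable F) :
    ∫⁻ ω, F (runVec c Z n ω, (Z n ω).1) ∂μ = ∫⁻ ω, ∫⁻ t, F (runVec c Z n ω, t) ∂PT ∂μ := by
  have hV := measurable_runVec hc hrun.measurable n
  have ht : Measurable fun ω => (Z n ω).1 := (hrun.measurable n).fst
  have : IsProbabilityMeasure (μ.map (runVec c Z n)) := Measure.isProbabilityMeasure_map hV.aemeasurable
  have hmap : μ.map (fun ω => (runVec c Z n ω, (Z n ω).1)) = (μ.map (runVec c Z n)).prod PT := by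
    have : IsProbabilityMeasure (μ.map (fun ω => (runVec c Z n ω, (Z n ω).1))) :=
      Measure.isProbabilityMeasure_map (hV.prodMk ht).aemeasurable
    refine Measure.ext_prod fun {s t} hs ht' => ?_
    rw [Measure.map_apply (hV.prodMk ht) (hs.prod ht'), Measure.prod_prod, Measure.map_apply hV hs]
    exact hrun.prompt_law n hn _ (measurable_runVec_past hc n hs) t ht'
  rw [← lintegral_map hF (hV.prodMk ht), hmap, lintegral_prod _ hF.aemeasurable,
    lintegral_map (hF.lintegral_prod_right') hV]

/-- The conditional law of the output and the fidelity observation. -/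
def feedback (c : Config 𝒯 𝒳 G) (hc : MeasurableRules c) (P : Fin G → Kernel 𝒯 𝒳)
    (Q : Fin G → Kernel (𝒯 × 𝒳) ℝ) (n : ℕ) :
    Kernel ((Fin n → Round 𝒯 𝒳 G) × 𝒯) (𝒳 × ℝ) where
  toFun p := (P (selectArm c (List.ofFn p.1) p.2) ⊗ₖ Q (selectArm c (List.ofFn p.1) p.2)) p.2
  measurable' := measurable_of_countable_cases (measurable_selectArm hc.kernel hc.one_le_T hc.pick)
    fun g => ⟨fun p => (P g ⊗ₖ Q g) p.2, (P g ⊗ₖ Q g).measurable.comp measurable_snd, by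
      rintro p rfl; rfl⟩

omit [∀ g, IsMarkovKernel (P g)] [∀ g, IsMarkovKernel (Q g)] in
theorem feedback_apply (hc : MeasurableRules c) (n : ℕ) (p : (Fin n → Round 𝒯 𝒳 G) × 𝒯) :
    feedback c hc P Q n p
      = (P (selectArm c (List.ofFn p.1) p.2) ⊗ₖ Q (selectArm c (List.ofFn p.1) p.2)) p.2 := rfl

instance (hc : MeasurableRules c) (n : ℕ) : IsMarkovKernel (feedback c hc P Q n) :=
  ⟨fun p => by rw [feedback_apply]; infer_instance⟩

omit [MeasurableSpace 𝒯] [MeasurableSpace 𝒳] in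
theorem chosenArm_eq (z : ℕ → 𝒯 × (𝒳 × ℝ)) (i : ℕ) :
    chosenArm c z i = selectArm c (List.ofFn (historyVec c z i)) (z i).1 := by
  rw [ofFn_historyVec]; rfl

omit [IsProbabilityMeasure PT] in
-- Again a comparison on rectangles: the joint law of history, prompt and feedback is the
-- composition product with the kernel `feedback`.
theorem lintegral_feedback (hc : MeasurableRules c) (hrun : IsRun c PT P Q μ Z) {n : ℕ}
    (hn : n < c.T) {F : ((Fin n → Round 𝒯 𝒳 G) × 𝒯) × (𝒳 × ℝ) → ℝ≥0∞} (hF : Measurable F) :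
    ∫⁻ ω, F ((runVec c Z n ω, (Z n ω).1), (Z n ω).2) ∂μ
      = ∫⁻ ω, ∫⁻ x, F ((runVec c Z n ω, (Z n ω).1), x)
          ∂(feedback c hc P Q n (runVec c Z n ω, (Z n ω).1)) ∂μ := by
  have hV := measurable_runVec hc hrun.measurable n
  have ht : Measurable fun ω => (Z n ω).1 := (hrun.measurable n).fst
  have hx : Measurable fun ω => (Z n ω).2 := (hrun.measurable n).snd
  have hU := hV.prodMk ht
  have hU' : Measurable[past Z n ⊔ MeasurableSpace.comap (fun ω => (Z n ω).1) inferInstance]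
      fun ω => (runVec c Z n ω, (Z n ω).1) :=
    Measurable.prodMk ((measurable_runVec_past hc n).mono le_sup_left le_rfl)
      ((comap_measurable _).mono le_sup_right le_rfl)
  have : IsProbabilityMeasure (μ.map fun ω => (runVec c Z n ω, (Z n ω).1)) :=
    Measure.isProbabilityMeasure_map hU.aemeasurable
  have hmap : μ.map (fun ω => ((runVec c Z n ω, (Z n ω).1), (Z n ω).2))
      = (μ.map fun ω => (runVec c Z n ω, (Z n ω).1)) ⊗ₘ feedback c hc P Q n := by
    have : IsProbabilityMeasure (μ.map fun ω => ((runVec c Z n ω, (Z n ω).1), (Z n ω).2)) :=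
      Measure.isProbabilityMeasure_map (hU.prodMk hx).aemeasurable
    refine Measure.ext_prod fun {s A} hs hA => ?_
    rw [Measure.map_apply (hU.prodMk hx) (hs.prod hA), Measure.compProd_apply_prod hs hA,
      setLIntegral_map hs (Kernel.measurable_coe _ hA) hU]
    refine (hrun.feedback_law n hn _ (hU' hs) A hA).trans ?_
    refine lintegral_congr fun ω => ?_
    rw [feedback_apply, chosenArm_eq]
    rfl
  rw [← lintegral_map hF (hU.prodMk hx), hmap, Measure.lintegral_compProd hF,
    lintegral_map hF.lintegral_kernel_prod_right' hU]

/-- The arms whose feedback is visible to decisions up to stage `m`: `some g` when arm `g` is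
selected before stage `m`, and `none` when round stops at stage `m` or later. -/
def Visible (c : Config 𝒯 𝒳 G) (m : ℕ) (h : List (Round 𝒯 𝒳 G)) (t : 𝒯) :
    Option (Fin G) → Prop
  | some g => finalStage c h t < m ∧ selectArm c h t = g
  | none => ¬ finalStage c h t < m

open Classical in
def visibleInd (c : Config 𝒯 𝒳 G) (m : ℕ) (h : List (Round 𝒯 𝒳 G)) (t : 𝒯)
    (o : Option (Fin G)) : ℝ≥0∞ := if Visible c m h t o then 1 else 0

omit [MeasurableSpace 𝒯] [MeasurableSpace 𝒳] in
-- The visibility indicator is itself blind, so it can be absorbed into the weight `Φ` of the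
-- exponential inequality.
theorem SameHistory.visibleInd_eq {m : ℕ} {h h' : List (Round 𝒯 𝒳 G)} (H : SameHistory m h h')
    (hT : 1 ≤ c.T) (t : 𝒯) (o : Option (Fin G)) :
    visibleInd c m h t o = visibleInd c m h' t o := by
  have hlt : finalStage c h t < m ↔ finalStage c h' t < m :=
    ⟨fun hf => (H.finalStage_le hT hf.le).trans_lt hf,
      fun hf => (H.symm.finalStage_le hT hf.le).trans_lt hf⟩
  have : Visible c m h t o ↔ Visible c m h' t o := by
    cases o with
    | none => exact hlt.not
    | some g =>
      constructor
      · rintro ⟨h1, h2⟩; exact ⟨hlt.1 h1, by rw [H.selectArm_eq_of_lt hT h1, h2]⟩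
      · rintro ⟨h1, h2⟩; exact ⟨hlt.2 h1, by rw [H.symm.selectArm_eq_of_lt hT h1, h2]⟩
  classical
  unfold visibleInd
  exact if_congr this rfl rfl

theorem measurable_visibleInd (hc : MeasurableRules c) (m n : ℕ) (o : Option (Fin G)) :
    Measurable fun p : (Fin n → Round 𝒯 𝒳 G) × 𝒯 => visibleInd c m (List.ofFn p.1) p.2 o := by
  have hlt : MeasurableSet {p : (Fin n → Round 𝒯 𝒳 G) × 𝒯 |
      finalStage c (List.ofFn p.1) p.2 < m} :=
    measurable_finalStage hc.kernel hc.one_le_T (measurableSet_Iio (a := m))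
  refine Measurable.ite ?_ measurable_const measurable_const
  cases o with
  | none => exact hlt.compl
  | some g =>
    exact hlt.inter (measurable_selectArm hc.kernel hc.one_le_T hc.pick (measurableSet_singleton g))

/-- The law of the visible part of a round; irrelevant for rounds that are not visible. -/
def visibleKernel (P : Fin G → Kernel 𝒯 𝒳) (Q : Fin G → Kernel (𝒯 × 𝒳) ℝ) (g₀ : Fin G)
    (o : Option (Fin G)) : Kernel 𝒯 (𝒳 × ℝ) := P (o.getD g₀) ⊗ₖ Q (o.getD g₀)

instance (g₀ : Fin G) (o : Option (Fin G)) : IsMarkovKernel (visibleKernel P Q g₀ o) := by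
  unfold visibleKernel; infer_instance

/-- The past influences the law of the feedback only through the selected arm. Splitting by that arm
gives an indicator, which carries the dependence on the past, times a kernel with a fixed arm. In an
invisible round the integrand is constant in the feedback, so every Markov kernel integrates it
alike and `g₀` is a mere placeholder. -/
theorem lintegral_feedback_eq_sum (hc : MeasurableRules c) (m : ℕ) {n : ℕ} (g₀ : Fin G)
    (p : (Fin n → Round 𝒯 𝒳 G) × 𝒯) {F : 𝒳 × ℝ → ℝ≥0∞}
    (hF : ¬ finalStage c (List.ofFn p.1) p.2 < m → ∀ x x', F x = F x') :
    ∫⁻ x, F x ∂(feedback c hc P Q n p)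
      = ∑ o : Option (Fin G), visibleInd c m (List.ofFn p.1) p.2 o
          * ∫⁻ x, F x ∂(visibleKernel P Q g₀ o p.2) := by
  rw [Fintype.sum_option]
  by_cases hs : finalStage c (List.ofFn p.1) p.2 < m
  · rw [Finset.sum_eq_single (selectArm c (List.ofFn p.1) p.2)]
    · simp [visibleInd, Visible, hs, feedback_apply, visibleKernel]
    · intro g _ hg; simp [visibleInd, Visible, hg.symm]
    · simp
  · obtain ⟨x₀⟩ : Nonempty (𝒳 × ℝ) := (feedback c hc P Q n p).nonempty_of_neZero
    have hF' : F = fun _ => F x₀ := funext fun x => hF hs x x₀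
    rw [hF']
    simp [visibleInd, Visible, hs]

theorem lintegral_prompt_feedback_eq_sum (hc : MeasurableRules c) (m : ℕ) {n : ℕ} (g₀ : Fin G)
    (v : Fin n → Round 𝒯 𝒳 G) {F : 𝒯 × (𝒳 × ℝ) → ℝ≥0∞} (hF : Measurable F)
    (hF' : ∀ t, ¬ finalStage c (List.ofFn v) t < m → ∀ x x', F (t, x) = F (t, x')) :
    ∫⁻ t, ∫⁻ x, F (t, x) ∂(feedback c hc P Q n (v, t)) ∂PT
      = ∑ o : Option (Fin G), ∫⁻ q, visibleInd c m (List.ofFn v) q.1 o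
          * F q ∂(PT ⊗ₘ visibleKernel P Q g₀ o) := by
  have hpair : Measurable fun t : 𝒯 => (v, t) := measurable_prodMk_left
  have hvis : ∀ o, Measurable fun t => visibleInd c m (List.ofFn v) t o := fun o => by
    have h := (measurable_visibleInd hc m n o).comp hpair
    exact h
  have hsum : ∀ t, ∫⁻ x, F (t, x) ∂(feedback c hc P Q n (v, t))
      = ∑ o : Option (Fin G), visibleInd c m (List.ofFn v) t o
          * ∫⁻ x, F (t, x) ∂(visibleKernel P Q g₀ o t) := fun t =>
    lintegral_feedback_eq_sum hc m g₀ (v, t) (hF' t)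
  rw [lintegral_congr hsum, lintegral_finsetSum]
  · refine Finset.sum_congr rfl fun o _ => ?_
    have hmul : Measurable fun q : 𝒯 × (𝒳 × ℝ) => visibleInd c m (List.ofFn v) q.1 o * F q := by
      have h := (hvis o).comp (measurable_fst : Measurable (Prod.fst : 𝒯 × (𝒳 × ℝ) → 𝒯))
      exact h.mul hF
    rw [Measure.lintegral_compProd hmul]
    refine lintegral_congr fun t => ?_
    exact (lintegral_const_mul _ (hF.comp measurable_prodMk_left)).symm
  · intro o _
    exact (hvis o).mul hF.lintegral_kernel_prod_right'

/-- Integration over round `n`, with the visible part of the round independent of the past. -/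
theorem lintegral_run_eq_sum (hc : MeasurableRules c) (hrun : IsRun c PT P Q μ Z) (m : ℕ) {n : ℕ}
    (hn : n < c.T) (g₀ : Fin G) {F : (Fin n → Round 𝒯 𝒳 G) × (𝒯 × (𝒳 × ℝ)) → ℝ≥0∞}
    (hF : Measurable F)
    (hF' : ∀ v t, ¬ finalStage c (List.ofFn v) t < m → ∀ x x', F (v, (t, x)) = F (v, (t, x'))) :
    ∫⁻ ω, F (runVec c Z n ω, Z n ω) ∂μ
      = ∑ o : Option (Fin G), ∫⁻ q, ∫⁻ ω, visibleInd c m (List.ofFn (runVec c Z n ω)) q.1 o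
          * F (runVec c Z n ω, q) ∂μ ∂(PT ⊗ₘ visibleKernel P Q g₀ o) := by
  have hV := measurable_runVec hc hrun.measurable n
  have hassoc : Measurable fun p : ((Fin n → Round 𝒯 𝒳 G) × 𝒯) × (𝒳 × ℝ) =>
      (p.1.1, (p.1.2, p.2)) :=
    (measurable_fst.comp measurable_fst).prodMk
      ((measurable_snd.comp measurable_fst).prodMk measurable_snd)
  have hFa : Measurable fun p : ((Fin n → Round 𝒯 𝒳 G) × 𝒯) × (𝒳 × ℝ) =>
      F (p.1.1, (p.1.2, p.2)) := hF.comp hassoc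
  have h1 := lintegral_feedback hc hrun hn hFa
  have h2 := lintegral_prompt hc hrun hn (F := fun p => ∫⁻ x, F (p.1, (p.2, x))
    ∂(feedback c hc P Q n p)) hFa.lintegral_kernel_prod_right'
  have h3 : ∀ ω, ∫⁻ t, ∫⁻ x, F (runVec c Z n ω, (t, x))
          ∂(feedback c hc P Q n (runVec c Z n ω, t)) ∂PT
      = ∑ o : Option (Fin G), ∫⁻ q, visibleInd c m (List.ofFn (runVec c Z n ω)) q.1 o
          * F (runVec c Z n ω, q) ∂(PT ⊗ₘ visibleKernel P Q g₀ o) := fun ω =>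
    lintegral_prompt_feedback_eq_sum hc m g₀ (runVec c Z n ω)
      (F := fun q => F (runVec c Z n ω, q)) (hF.comp measurable_prodMk_left)
      (hF' _)
  have hm2 : ∀ o, Measurable fun r : Ω × (𝒯 × (𝒳 × ℝ)) =>
      visibleInd c m (List.ofFn (runVec c Z n r.1)) r.2.1 o * F (runVec c Z n r.1, r.2) :=
    fun o => by
      have h := (measurable_visibleInd hc m n o).comp ((hV.comp measurable_fst).prodMk
        (measurable_fst.comp measurable_snd) : Measurable fun r : Ω × (𝒯 × (𝒳 × ℝ)) =>
          (runVec c Z n r.1, r.2.1))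
      exact h.mul (hF.comp ((hV.comp measurable_fst).prodMk measurable_snd))
  -- In each summand the law of `q` no longer depends on the past, so Tonelli moves the integral
  -- over the past inside and `q` becomes a fixed parameter there.
  refine (h1.trans h2).trans ((lintegral_congr h3).trans ?_)
  rw [lintegral_finsetSum]
  · exact Finset.sum_congr rfl fun o _ => lintegral_lintegral_swap (hm2 o).aemeasurable
  · exact fun o _ => (hm2 o).lintegral_prod_right'

end Law

/-! ### Exponential inequality for the noise of one arm and stage -/

section Noise

variable {𝒯 𝒳 Ω : Type*} [MeasurableSpace 𝒯] [MeasurableSpace 𝒳] [MeasurableSpace Ω] {G : ℕ}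

/-- The history `v` followed by one more round. -/
def extend (c : Config 𝒯 𝒳 G) {n : ℕ} (v : Fin n → Round 𝒯 𝒳 G) (q : 𝒯 × (𝒳 × ℝ)) :
    Fin (n + 1) → Round 𝒯 𝒳 G := Fin.snoc v (playRound c (List.ofFn v) q)

/-- `F` does not depend on data that are invisible to decisions up to stage `m`. -/
def BlindUpTo (m : ℕ) {n : ℕ} {B : Type*} (F : (Fin n → Round 𝒯 𝒳 G) → B) : Prop :=
  ∀ v v', (∀ j, SameUpTo m (v j) (v' j)) → F v = F v'

open Classical in
/-- The combined noise of the fidelity and diversity labels of a round of `Ψ_g^m`. -/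
def armNoise (c : Config 𝒯 𝒳 G) (f : Target → Fin G → 𝒯 → ℝ) (g : Fin G) (m : ℕ)
    (r : Round 𝒯 𝒳 G) : ℝ :=
  if InIndex .fidelity g m r then (r.label .fidelity - f .fidelity g r.prompt)
    - c.lam * (r.label .diversity - f .diversity g r.prompt) else 0

variable {c : Config 𝒯 𝒳 G} {n : ℕ}

omit [MeasurableSpace 𝒯] [MeasurableSpace 𝒳] in
@[simp] theorem extend_castSucc (v : Fin n → Round 𝒯 𝒳 G) (q : 𝒯 × (𝒳 × ℝ)) (j : Fin n) :
    extend c v q j.castSucc = v j := by simp [extend]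

omit [MeasurableSpace 𝒯] [MeasurableSpace 𝒳] in
@[simp] theorem extend_last (v : Fin n → Round 𝒯 𝒳 G) (q : 𝒯 × (𝒳 × ℝ)) :
    extend c v q (Fin.last n) = playRound c (List.ofFn v) q := by simp [extend]

omit [MeasurableSpace 𝒯] [MeasurableSpace 𝒳] [MeasurableSpace Ω] in
theorem runVec_succ (Z : ℕ → Ω → 𝒯 × (𝒳 × ℝ)) (n : ℕ) (ω : Ω) :
    runVec c Z (n + 1) ω = extend c (runVec c Z n ω) (Z n ω) := historyVec_succ _ _

omit [MeasurableSpace 𝒯] [MeasurableSpace 𝒳] in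
theorem sameHistory_ofFn {m : ℕ} {v v' : Fin n → Round 𝒯 𝒳 G}
    (H : ∀ j, SameUpTo m (v j) (v' j)) : SameHistory m (List.ofFn v) (List.ofFn v') := by
  refine List.forall₂_iff_get.2 ⟨by simp, fun i h₁ h₂ => ?_⟩
  simpa using H ⟨i, by simpa using h₁⟩

omit [MeasurableSpace 𝒯] [MeasurableSpace 𝒳] in
theorem sameUpTo_extend {m : ℕ} (hT : 1 ≤ c.T) {v v' : Fin n → Round 𝒯 𝒳 G}
    (H : ∀ j, SameUpTo m (v j) (v' j)) {t : 𝒯} {x x' : 𝒳 × ℝ}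
    (hx : finalStage c (List.ofFn v) t < m → x = x') (j : Fin (n + 1)) :
    SameUpTo m (extend c v (t, x) j) (extend c v' (t, x') j) := by
  refine Fin.lastCases ?_ (fun j => ?_) j
  · simpa using (sameHistory_ofFn H).sameUpTo_playRound hT t x x' hx
  · simpa using H j

theorem measurable_extend (hc : MeasurableRules c) :
    Measurable fun p : (Fin n → Round 𝒯 𝒳 G) × (𝒯 × (𝒳 × ℝ)) => extend c p.1 p.2 :=
  measurable_snoc measurable_fst
    (measurable_playRound hc.kernel hc.one_le_T hc.pick hc.divLabel)

theorem measurable_armNoise {f : Target → Fin G → 𝒯 → ℝ} (hf : ∀ τ g, Measurable (f τ g))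
    (g : Fin G) (m : ℕ) : Measurable (armNoise c f g m : Round 𝒯 𝒳 G → ℝ) := by
  refine Measurable.ite (measurableSet_mem_index _ g m) ?_ measurable_const
  exact ((measurable_label _).sub ((hf _ g).comp measurable_prompt)).sub
    (((measurable_label _).sub ((hf _ g).comp measurable_prompt)).const_mul _)

variable {PT : Measure 𝒯} [IsProbabilityMeasure PT]
  {P : Fin G → Kernel 𝒯 𝒳} [∀ g, IsMarkovKernel (P g)]
  {Q : Fin G → Kernel (𝒯 × 𝒳) ℝ} [∀ g, IsMarkovKernel (Q g)]
  {μ : Measure Ω} [IsProbabilityMeasure μ] {Z : ℕ → Ω → 𝒯 × (𝒳 × ℝ)}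

/-- The factor `exp (∑ (b_j ε_j - C b_j² / 2))`. -/
def noiseExp (c : Config 𝒯 𝒳 G) (f : Target → Fin G → 𝒯 → ℝ) (C : ℝ) (g : Fin G) (m : ℕ)
    (b : Fin n → ℝ) (v : Fin n → Round 𝒯 𝒳 G) : ℝ≥0∞ :=
  ENNReal.ofReal (Real.exp (∑ j, (b j * armNoise c f g m (v j) - C / 2 * b j ^ 2)))

theorem measurable_noiseExp {f : Target → Fin G → 𝒯 → ℝ} (hf : ∀ τ g, Measurable (f τ g))
    (C : ℝ) (g : Fin G) (m : ℕ) {A : Type*} [MeasurableSpace A] {b : Fin n → A → ℝ}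
    (hb : ∀ j, Measurable (b j)) {v : A → Fin n → Round 𝒯 𝒳 G} (hv : Measurable v) :
    Measurable fun a => noiseExp c f C g m (fun j => b j a) (v a) := by
  refine (Real.measurable_exp.comp (Finset.measurable_fun_sum _ fun j _ => ?_)).ennreal_ofReal
  exact ((hb j).mul ((measurable_armNoise hf g m).comp ((measurable_pi_apply j).comp hv))).sub
    (((hb j).pow_const 2).const_mul _)

omit [MeasurableSpace 𝒯] [MeasurableSpace 𝒳] in
theorem noiseExp_extend (f : Target → Fin G → 𝒯 → ℝ) (C : ℝ) (g : Fin G) (m : ℕ)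
    (b : Fin (n + 1) → ℝ) (v : Fin n → Round 𝒯 𝒳 G) (q : 𝒯 × (𝒳 × ℝ)) :
    noiseExp c f C g m b (extend c v q)
      = noiseExp c f C g m (fun j => b j.castSucc) v * ENNReal.ofReal (Real.exp
        (b (Fin.last n) * armNoise c f g m (playRound c (List.ofFn v) q)
          - C / 2 * b (Fin.last n) ^ 2)) := by
  simp only [noiseExp, Fin.sum_univ_castSucc, extend_castSucc, extend_last, Real.exp_add]
  rw [ENNReal.ofReal_mul (Real.exp_nonneg _)]

/-- Given the past and the prompt, the last round contributes a factor at most `1`. -/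
theorem lintegral_noiseExp_extend_le (hc : MeasurableRules c) {f : Target → Fin G → 𝒯 → ℝ}
    (hf : ∀ τ g, Measurable (f τ g)) {C : ℝ} (hC : 0 ≤ C) (g : Fin G) (m : ℕ)
    {Φ : (Fin (n + 1) → Round 𝒯 𝒳 G) → ℝ≥0∞} (hΦ' : BlindUpTo m Φ)
    {b : Fin (n + 1) → (Fin (n + 1) → Round 𝒯 𝒳 G) → ℝ} (hb' : ∀ j, BlindUpTo m (b j))
    (v : Fin n → Round 𝒯 𝒳 G) (t : 𝒯)
    (hsub : ∀ u : ℝ, ∫⁻ x, ENNReal.ofReal (Real.exp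
        (u * armNoise c f g m (playRound c (List.ofFn v) (t, x)) - C / 2 * u ^ 2))
          ∂(feedback c hc P Q n (v, t)) ≤ 1) :
    ∫⁻ x, Φ (extend c v (t, x)) * noiseExp c f C g m (fun j => b j (extend c v (t, x)))
        (extend c v (t, x)) ∂(feedback c hc P Q n (v, t))
      ≤ ∫⁻ x, Φ (extend c v (t, x)) * noiseExp c f C g m
          (fun j => b j.castSucc (extend c v (t, x))) v ∂(feedback c hc P Q n (v, t)) := by
  simp only [noiseExp_extend]
  obtain ⟨x₀⟩ : Nonempty (𝒳 × ℝ) := (feedback c hc P Q n (v, t)).nonempty_of_neZero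
  by_cases hin : InIndex .fidelity g m (playRound c (List.ofFn v) (t, x₀))
  -- A round of `Ψ_g^m` stops at stage `m`. By blindness `Φ` and all coefficients are then constant
  -- in its feedback, and only the last noise factor is integrated.
  · have hstage : ¬ finalStage c (List.ofFn v) t < m := by
      have : finalStage c (List.ofFn v) t = m := hin.2.2
      omega
    have hsame : ∀ x j, SameUpTo m (extend c v (t, x) j) (extend c v (t, x₀) j) := fun x j =>
      sameUpTo_extend hc.one_le_T (fun j => SameUpTo.refl m (v j)) (fun h => absurd h hstage) j
    have h1 : ∀ x, Φ (extend c v (t, x)) = Φ (extend c v (t, x₀)) := fun x => hΦ' _ _ (hsame x)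
    have h2 : ∀ x j, b j (extend c v (t, x)) = b j (extend c v (t, x₀)) := fun x j =>
      hb' j _ _ (hsame x)
    simp only [h1, h2, ← mul_assoc]
    have hm : Measurable fun x : 𝒳 × ℝ => ENNReal.ofReal (Real.exp
        (b (Fin.last n) (extend c v (t, x₀)) * armNoise c f g m (playRound c (List.ofFn v) (t, x))
          - C / 2 * b (Fin.last n) (extend c v (t, x₀)) ^ 2)) := by
      have hp := (measurable_playRound (n := n) hc.kernel hc.one_le_T hc.pick hc.divLabel).comp
        (measurable_prodMk_left.comp measurable_prodMk_left :
          Measurable fun x : 𝒳 × ℝ => (v, (t, x)))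
      have hn := (measurable_armNoise (c := c) hf g m).comp hp
      exact (Real.measurable_exp.comp ((hn.const_mul _).sub_const _)).ennreal_ofReal
    rw [lintegral_const_mul _ hm, lintegral_const]
    simpa using mul_le_mul_right (hsub (b (Fin.last n) (extend c v (t, x₀))))
      (Φ (extend c v (t, x₀)) * noiseExp c f C g m (fun j => b j.castSucc (extend c v (t, x₀))) v)
  -- Membership in the index set does not involve the feedback, so `hin` fails for every `x` and the
  -- last noise vanishes. What remains is the compensator, a factor at most `1`.
  · refine lintegral_mono fun x => ?_
    have h0 : armNoise c f g m (playRound c (List.ofFn v) (t, x)) = 0 := if_neg hin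
    rw [h0, mul_zero, zero_sub]
    refine mul_le_mul_right (mul_le_of_le_one_right' ?_) _
    rw [ENNReal.ofReal_le_one, Real.exp_le_one_iff]
    have : 0 ≤ C / 2 * b (Fin.last n) (extend c v (t, x)) ^ 2 := by positivity
    linarith

/-- Coefficients may depend on later rounds, so the exponentials need not form a supermartingale.
The induction removes the last round instead: its noise is integrated out first
(`lintegral_noiseExp_extend_le`), then the round is frozen at a value `q`. For fixed `q` the
coefficients, and `Φ` multiplied by the visibility indicator, are again blind functions of the first
`n` rounds. This step forces the quantification over all `Φ` and `b`. -/
theorem lintegral_noiseExp_le (hc : MeasurableRules c) (hrun : IsRun c PT P Q μ Z)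
    {f : Target → Fin G → 𝒯 → ℝ} (hf : ∀ τ g, Measurable (f τ g)) {C : ℝ} (hC : 0 ≤ C)
    (g : Fin G) (m : ℕ)
    (hsub : ∀ i < c.T, ∀ᵐ ω ∂μ, ∀ u : ℝ, ∫⁻ x, ENNReal.ofReal (Real.exp
        (u * armNoise c f g m (playRound c (List.ofFn (runVec c Z i ω)) ((Z i ω).1, x))
          - C / 2 * u ^ 2)) ∂(feedback c hc P Q i (runVec c Z i ω, (Z i ω).1)) ≤ 1)
    (n : ℕ) (hn : n ≤ c.T) (Φ : (Fin n → Round 𝒯 𝒳 G) → ℝ≥0∞) (hΦ : Measurable Φ)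
    (hΦ' : BlindUpTo m Φ) (b : Fin n → (Fin n → Round 𝒯 𝒳 G) → ℝ) (hb : ∀ j, Measurable (b j))
    (hb' : ∀ j, BlindUpTo m (b j)) :
    ∫⁻ ω, Φ (runVec c Z n ω) * noiseExp c f C g m (fun j => b j (runVec c Z n ω))
        (runVec c Z n ω) ∂μ ≤ ∫⁻ ω, Φ (runVec c Z n ω) ∂μ := by
  induction n with
  | zero => simp [noiseExp]
  | succ n ih =>
    simp only [runVec_succ]
    have hext := measurable_extend (n := n) hc
    have hΦe : Measurable fun p : (Fin n → Round 𝒯 𝒳 G) × (𝒯 × (𝒳 × ℝ)) => Φ (extend c p.1 p.2) :=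
      hΦ.comp hext
    have hbe : ∀ j, Measurable fun p : (Fin n → Round 𝒯 𝒳 G) × (𝒯 × (𝒳 × ℝ)) =>
        b j (extend c p.1 p.2) := fun j => (hb j).comp hext
    have hassoc : Measurable fun p : ((Fin n → Round 𝒯 𝒳 G) × 𝒯) × (𝒳 × ℝ) =>
        (p.1.1, (p.1.2, p.2)) :=
      (measurable_fst.comp measurable_fst).prodMk
        ((measurable_snd.comp measurable_fst).prodMk measurable_snd)
    have hF₁ : Measurable fun p : (Fin n → Round 𝒯 𝒳 G) × (𝒯 × (𝒳 × ℝ)) =>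
        Φ (extend c p.1 p.2) * noiseExp c f C g m (fun j => b j (extend c p.1 p.2))
          (extend c p.1 p.2) := hΦe.mul (measurable_noiseExp hf C g m hbe hext)
    have hF₂ : Measurable fun p : (Fin n → Round 𝒯 𝒳 G) × (𝒯 × (𝒳 × ℝ)) =>
        Φ (extend c p.1 p.2) * noiseExp c f C g m (fun j => b j.castSucc (extend c p.1 p.2)) p.1 :=
      hΦe.mul (measurable_noiseExp hf C g m (fun j => hbe j.castSucc) measurable_fst)
    have hself : ∀ (v : Fin n → Round 𝒯 𝒳 G) (t : 𝒯), ¬ finalStage c (List.ofFn v) t < m →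
        ∀ x x' j, SameUpTo m (extend c v (t, x) j) (extend c v (t, x') j) := fun v t h x x' j =>
      sameUpTo_extend hc.one_le_T (fun j => SameUpTo.refl m (v j)) (fun h' => absurd h' h) j
    have hfix : ∀ (q : 𝒯 × (𝒳 × ℝ)) (v v' : Fin n → Round 𝒯 𝒳 G),
        (∀ j, SameUpTo m (v j) (v' j)) → ∀ j, SameUpTo m (extend c v q j) (extend c v' q j) :=
      fun q v v' H j => sameUpTo_extend (t := q.1) hc.one_le_T H (fun _ => rfl) j
    calc ∫⁻ ω, Φ (extend c (runVec c Z n ω) (Z n ω))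
          * noiseExp c f C g m (fun j => b j (extend c (runVec c Z n ω) (Z n ω)))
            (extend c (runVec c Z n ω) (Z n ω)) ∂μ
        ≤ ∫⁻ ω, Φ (extend c (runVec c Z n ω) (Z n ω))
          * noiseExp c f C g m (fun j => b j.castSucc (extend c (runVec c Z n ω) (Z n ω)))
            (runVec c Z n ω) ∂μ := by
          have e₁ := lintegral_feedback hc hrun hn (hF₁.comp hassoc)
          have e₂ := lintegral_feedback hc hrun hn (hF₂.comp hassoc)
          refine e₁.trans_le (le_of_le_of_eq ?_ e₂.symm)
          refine lintegral_mono_ae ?_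
          filter_upwards [hsub n hn] with ω hω
          exact lintegral_noiseExp_extend_le hc hf hC g m hΦ' hb' _ _ hω
      _ ≤ ∫⁻ ω, Φ (extend c (runVec c Z n ω) (Z n ω)) ∂μ := by
          have s₁ := lintegral_run_eq_sum hc hrun m hn g hF₂ (fun v t h x x' => by
            simp only [hΦ' _ _ (hself v t h x x'), hb' _ _ _ (hself v t h x x')])
          have s₂ := lintegral_run_eq_sum hc hrun m hn g hΦe (fun v t h x x' =>
            hΦ' _ _ (hself v t h x x'))
          refine s₁.trans_le (le_of_le_of_eq ?_ s₂.symm)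
          refine Finset.sum_le_sum fun o _ => lintegral_mono fun q => ?_
          have hvis : Measurable fun v : Fin n → Round 𝒯 𝒳 G =>
              visibleInd c m (List.ofFn v) q.1 o := by
            have h := (measurable_visibleInd hc m n o).comp (measurable_prodMk_right :
              Measurable fun v : Fin n → Round 𝒯 𝒳 G => (v, q.1))
            exact h
          have := ih (Nat.le_of_succ_le hn)
            (fun v => visibleInd c m (List.ofFn v) q.1 o * Φ (extend c v q))
            (hvis.mul (hΦe.comp measurable_prodMk_right))
            (fun v v' H => by
              simp only [hΦ' _ _ (hfix q v v' H),
                (sameHistory_ofFn H).visibleInd_eq hc.one_le_T q.1 o])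
            (fun j v => b j.castSucc (extend c v q))
            (fun j => (hbe j.castSucc).comp measurable_prodMk_right)
            (fun j v v' H => hb' _ _ _ (hfix q v v' H))
          simpa only [mul_assoc] using this

end Noise

/-! ### The confidence intervals hold with high probability -/

section Tail

variable {𝒯 𝒳 Ω : Type*} [MeasurableSpace 𝒯] [MeasurableSpace 𝒳] [MeasurableSpace Ω] {G : ℕ}

theorem lintegral_exp_sub_le_one {A : Type*} [MeasurableSpace A] {ν : Measure A} {X : A → ℝ}
    {κ : ℝ≥0} (hX : HasSubgaussianMGF X κ ν) (u : ℝ) :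
    ∫⁻ x, ENNReal.ofReal (Real.exp (u * X x - κ / 2 * u ^ 2)) ∂ν ≤ 1 := by
  have hexp : ∀ x, Real.exp (u * X x - κ / 2 * u ^ 2)
      = Real.exp (-(κ / 2 * u ^ 2)) * Real.exp (u * X x) := fun x => by
    rw [← Real.exp_add]; ring_nf
  simp only [hexp]
  rw [← ofReal_integral_eq_lintegral_ofReal ((hX.integrable_exp_mul u).const_mul _)
    (ae_of_all _ fun x => by positivity), ENNReal.ofReal_le_one, integral_const_mul]
  calc _ ≤ Real.exp (-(κ / 2 * u ^ 2)) * Real.exp (κ * u ^ 2 / 2) := by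
        gcongr; exact hX.mgf_le u
    _ = 1 := by rw [← Real.exp_add]; simp; ring

theorem hasSubgaussianMGF_neg_mul {A : Type*} [MeasurableSpace A] {ν : Measure A} {X : A → ℝ}
    {κ : ℝ≥0} (hX : HasSubgaussianMGF X κ ν) {r : ℝ} (hr : 0 ≤ r) :
    HasSubgaussianMGF (fun a => -r * X a) (r.toNNReal ^ 2 * κ) ν := by
  have hκ : (r.toNNReal ^ 2 : ℝ≥0) = ⟨(-r) ^ 2, sq_nonneg _⟩ := by
    ext; simp [hr]; rfl
  rw [hκ]
  exact hX.const_mul (-r)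

/-- Variance proxy of the combined noise. -/
def noiseProxy (c : Config 𝒯 𝒳 G) : ℝ≥0 := ((1 + c.lam.toNNReal) * c.σ) ^ 2

omit [MeasurableSpace 𝒯] [MeasurableSpace 𝒳] in
theorem coe_noiseProxy {c : Config 𝒯 𝒳 G} (hlam : 0 ≤ c.lam) :
    (noiseProxy c : ℝ) = ((1 + c.lam) * c.σ) ^ 2 := by
  simp [noiseProxy, hlam]

variable {c : Config 𝒯 𝒳 G} {PT : Measure 𝒯} [IsProbabilityMeasure PT]
  {P : Fin G → Kernel 𝒯 𝒳} [∀ g, IsMarkovKernel (P g)]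
  {Q : Fin G → Kernel (𝒯 × 𝒳) ℝ} [∀ g, IsMarkovKernel (Q g)]
  {μ : Measure Ω} [IsProbabilityMeasure μ] {Z : ℕ → Ω → 𝒯 × (𝒳 × ℝ)}

/-- The two label errors of a round share the output and may be dependent. The sum of sub-Gaussian
variables has as proxy the square of the sum of the standard deviations, here `σ + λσ`. -/
theorem lintegral_exp_armNoise_le_one (hc : MeasurableRules c) (hlam : 0 ≤ c.lam)
    {f : Target → Fin G → 𝒯 → ℝ}
    {n : ℕ} (v : Fin n → Round 𝒯 𝒳 G) (t : 𝒯)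
    (hs : HasSubgaussianMGF
      (fun q : 𝒳 × ℝ => q.2 - f .fidelity (selectArm c (List.ofFn v) t) t) (c.σ ^ 2)
      ((P (selectArm c (List.ofFn v) t) ⊗ₖ Q (selectArm c (List.ofFn v) t)) t))
    (hD : HasSubgaussianMGF
      (fun x : 𝒳 => c.divLabel (selectArm c (List.ofFn v) t)
          (snapshot (List.ofFn v) (selectArm c (List.ofFn v) t) (finalStage c (List.ofFn v) t))
          (t, x) - f .diversity (selectArm c (List.ofFn v) t) t) (c.σ ^ 2)
      (P (selectArm c (List.ofFn v) t) t)) (g : Fin G) (m : ℕ) (u : ℝ) :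
    ∫⁻ x, ENNReal.ofReal (Real.exp
        (u * armNoise c f g m (playRound c (List.ofFn v) (t, x)) - noiseProxy c / 2 * u ^ 2))
          ∂(feedback c hc P Q n (v, t)) ≤ 1 := by
  by_cases hin : selectArm c (List.ofFn v) t = g ∧ finalStage c (List.ofFn v) t = m
      ∧ ¬ Exploits c (List.ofFn v) t (finalStage c (List.ofFn v) t)
  · obtain ⟨rfl, rfl, he⟩ := hin
    refine lintegral_exp_sub_le_one (κ := noiseProxy c) (X := fun x =>
      armNoise c f (selectArm c (List.ofFn v) t) (finalStage c (List.ofFn v) t)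
        (playRound c (List.ofFn v) (t, x))) ?_ u
    -- The diversity error depends on the output alone, so its bound transfers from `P` to the joint
    -- law of output and fidelity observation through the first marginal.
    have hmap : ((P (selectArm c (List.ofFn v) t) ⊗ₖ Q (selectArm c (List.ofFn v) t)) t).map
        Prod.fst = P (selectArm c (List.ofFn v) t) t := by
      rw [← Kernel.fst_apply, Kernel.fst_compProd]
    rw [← hmap] at hD
    have hD' := hasSubgaussianMGF_neg_mul (hD.of_map measurable_fst.aemeasurable) hlam
    have hadd := hs.add hD'
    rw [show noiseProxy c = _ from ?_]
    · refine hadd.congr (ae_of_all _ fun x => ?_)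
      have hI : InIndex Target.fidelity (selectArm c (List.ofFn v) t)
          (finalStage c (List.ofFn v) t) (playRound c (List.ofFn v) (t, x)) :=
        ⟨by simpa [playRound] using he, rfl, rfl⟩
      have hN : armNoise c f (selectArm c (List.ofFn v) t) (finalStage c (List.ofFn v) t)
          (playRound c (List.ofFn v) (t, x)) = _ := if_pos hI
      refine Eq.trans ?_ hN.symm
      simp only [playRound, Function.comp_apply]
      ring
    · rw [noiseProxy, NNReal.sqrt_mul, NNReal.sqrt_sq, NNReal.sqrt_sq]
      ring
  · have h0 : ∀ x, armNoise c f g m (playRound c (List.ofFn v) (t, x)) = 0 := fun x => by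
      refine if_neg fun h => hin ⟨h.2.1, h.2.2, ?_⟩
      simpa [playRound] using h.1
    simp only [h0, mul_zero, zero_sub, lintegral_const, measure_univ, mul_one]
    rw [ENNReal.ofReal_le_one, Real.exp_le_one_iff]
    have : 0 ≤ (noiseProxy c : ℝ) / 2 * u ^ 2 := by positivity
    linarith

/-- The normalized KRR weight of round `j` for arm `g` and stage `m`. -/
def noiseCoef (c : Config 𝒯 𝒳 G) {n : ℕ} (l : List (Fin n)) (t : 𝒯) (v : Fin n → Round 𝒯 𝒳 G)
    (j : Fin n) : ℝ :=
  ∑ i : Fin l.length, if l.get i = j then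
    krrWeight c.k c.α (fun i : Fin l.length => (v (l.get i)).prompt) t i
      / √(krrVar c.k c.α (fun i : Fin l.length => (v (l.get i)).prompt) t) else 0

/-- The indices of the rounds of `Ψ_g^m`. -/
def stageIndices {n : ℕ} (g : Fin G) (m : ℕ) (v : Fin n → Round 𝒯 𝒳 G) : List (Fin n) :=
  indices fun j => InIndex .fidelity g m (v j)

omit [MeasurableSpace 𝒯] [MeasurableSpace 𝒳] in
theorem nodup_stageIndices {n : ℕ} (g : Fin G) (m : ℕ) (v : Fin n → Round 𝒯 𝒳 G) :
    (stageIndices g m v).Nodup := (List.nodup_finRange n).filter _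

theorem sum_fiber_sq {n : ℕ} {l : List (Fin n)} (hl : l.Nodup) (a : Fin l.length → ℝ) :
    ∑ j, (∑ i : Fin l.length, if l.get i = j then a i else 0) ^ 2 = ∑ i, a i ^ 2 := by
  symm
  have hinj : Function.Injective l.get := List.nodup_iff_injective_get.1 hl
  refine Fintype.sum_of_injective l.get hinj _ _ (fun j hj => ?_) (fun i => ?_)
  · rw [Finset.sum_eq_zero, zero_pow two_ne_zero]
    intro i _
    exact if_neg fun h => hj ⟨i, h⟩
  · congr 1
    simp only [hinj.eq_iff]
    simp

variable {H : Type*} [NormedAddCommGroup H] [InnerProductSpace ℝ H] {φ : 𝒯 → H}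

omit [MeasurableSpace 𝒯] [MeasurableSpace 𝒳] in
-- After division by `σ̂` the weights have Euclidean norm at most `1`, so the noise sum has the same
-- proxy as a single noise. If `σ̂ = 0`, division by zero makes them all `0`.
theorem sum_noiseCoef_sq_le (hk : ∀ t t', c.k t t' = inner ℝ (φ t) (φ t')) (hα : 0 < c.α) {n : ℕ}
    {l : List (Fin n)} (hl : l.Nodup) (t : 𝒯) (v : Fin n → Round 𝒯 𝒳 G) :
    ∑ j, noiseCoef c l t v j ^ 2 ≤ 1 := by
  simp only [noiseCoef]
  rw [sum_fiber_sq hl]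
  simp only [div_pow, ← Finset.sum_div]
  rw [Real.sq_sqrt (krrVar_nonneg hk hα _ _)]
  exact div_le_one_of_le₀ (sum_krrWeight_sq_le hk hα _ _) (krrVar_nonneg hk hα _ _)

omit [MeasurableSpace 𝒯] [MeasurableSpace 𝒳] in
-- The coefficients read only the prompts and the membership in `Ψ_g^m`, exactly what `SameUpTo m`
-- preserves.
theorem blind_noiseCoef {n : ℕ} (g : Fin G) (m : ℕ) (t : 𝒯) (j : Fin n) :
    BlindUpTo m fun v : Fin n → Round 𝒯 𝒳 G => noiseCoef c (stageIndices g m v) t v j := by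
  intro v v' hv
  have h1 : stageIndices g m v = stageIndices g m v' := by
    unfold stageIndices
    congr 1
    funext j
    exact propext ((hv j).mem_iff _ _)
  have h2 : ∀ j, (v j).prompt = (v' j).prompt := fun j => (hv j).prompt_eq
  simp only [noiseCoef, h2]
  rw [h1]

theorem measurable_noiseCoef (hc : MeasurableRules c) {n : ℕ} (g : Fin G) (m : ℕ) (j : Fin n) :
    Measurable fun p : (Fin n → Round 𝒯 𝒳 G) × 𝒯 =>
      noiseCoef c (stageIndices g m p.1) p.2 p.1 j := by
  refine measurable_of_countable_cases
    (measurable_code (measurableSet_mem_index .fidelity g m)) fun q => ?_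
  obtain ⟨l, hl⟩ : ∃ l, l = indices q := ⟨_, rfl⟩
  refine ⟨fun p => noiseCoef c l p.2 p.1 j, ?_, ?_⟩
  · have hp : ∀ i : Fin l.length, Measurable fun p : (Fin n → Round 𝒯 𝒳 G) × 𝒯 =>
        (p.1 (l.get i)).prompt := fun i =>
      measurable_prompt.comp ((measurable_pi_apply _).comp measurable_fst)
    have hw := measurable_krrWeight (p := fun (p : (Fin n → Round 𝒯 𝒳 G) × 𝒯)
      (i : Fin l.length) => (p.1 (l.get i)).prompt) (t := Prod.snd) hc.kernel c.α hp measurable_snd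
    have hV := measurable_krrVar (p := fun (p : (Fin n → Round 𝒯 𝒳 G) × 𝒯)
      (i : Fin l.length) => (p.1 (l.get i)).prompt) (t := Prod.snd) hc.kernel c.α hp measurable_snd
    refine Finset.measurable_fun_sum _ fun i _ => ?_
    split_ifs
    · exact (hw i).div hV.sqrt
    · exact measurable_const
  · rintro p rfl
    rw [hl]; rfl

/-- The normalized noise in the KRR predictor. -/
def noiseSum (c : Config 𝒯 𝒳 G) (f : Target → Fin G → 𝒯 → ℝ) {n : ℕ} (g : Fin G) (m : ℕ)
    (v : Fin n → Round 𝒯 𝒳 G) (t : 𝒯) : ℝ :=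
  ∑ j, noiseCoef c (stageIndices g m v) t v j * armNoise c f g m (v j)

omit [MeasurableSpace 𝒯] [MeasurableSpace 𝒳] in
theorem noiseSum_eq (f : Target → Fin G → 𝒯 → ℝ) {n : ℕ} (g : Fin G) (m : ℕ)
    (v : Fin n → Round 𝒯 𝒳 G) (t : 𝒯) :
    noiseSum c f g m v t = (∑ i : Fin (stageIndices g m v).length,
      krrWeight c.k c.α (fun i : Fin (stageIndices g m v).length =>
        (v ((stageIndices g m v).get i)).prompt) t i
        * armNoise c f g m (v ((stageIndices g m v).get i)))
      / √(krrVar c.k c.α (fun i : Fin (stageIndices g m v).length =>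
        (v ((stageIndices g m v).get i)).prompt) t) := by
  simp only [noiseSum, noiseCoef, Finset.sum_mul, Finset.sum_div]
  rw [Finset.sum_comm]
  refine Finset.sum_congr rfl fun i _ => ?_
  simp only [ite_mul, zero_mul, Finset.sum_ite_eq, Finset.mem_univ, if_true]
  ring

theorem measurable_noiseSum (hc : MeasurableRules c) {f : Target → Fin G → 𝒯 → ℝ}
    (hf : ∀ τ g, Measurable (f τ g)) {n : ℕ} (g : Fin G) (m : ℕ) :
    Measurable fun p : (Fin n → Round 𝒯 𝒳 G) × 𝒯 => noiseSum c f g m p.1 p.2 :=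
  Finset.measurable_fun_sum _ fun j _ => (measurable_noiseCoef hc g m j).mul
    ((measurable_armNoise hf g m).comp ((measurable_pi_apply j).comp measurable_fst))

/-- The sub-Gaussian condition on the labels of the run. -/
def SubgaussianLabels (c : Config 𝒯 𝒳 G) (f : Target → Fin G → 𝒯 → ℝ)
    (hc : MeasurableRules c) (P : Fin G → Kernel 𝒯 𝒳) (Q : Fin G → Kernel (𝒯 × 𝒳) ℝ)
    (μ : Measure Ω) (Z : ℕ → Ω → 𝒯 × (𝒳 × ℝ)) : Prop :=
  ∀ g m, ∀ i < c.T, ∀ᵐ ω ∂μ, ∀ u : ℝ, ∫⁻ x, ENNReal.ofReal (Real.exp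
    (u * armNoise c f g m (playRound c (List.ofFn (runVec c Z i ω)) ((Z i ω).1, x))
      - noiseProxy c / 2 * u ^ 2)) ∂(feedback c hc P Q i (runVec c Z i ω, (Z i ω).1)) ≤ 1

theorem lintegral_exp_noiseSum_le (hc : MeasurableRules c) (hrun : IsRun c PT P Q μ Z)
    {f : Target → Fin G → 𝒯 → ℝ} (hf : ∀ τ g, Measurable (f τ g))
    (hsub : SubgaussianLabels c f hc P Q μ Z)
    (hk : ∀ t t', c.k t t' = inner ℝ (φ t) (φ t')) (hα : 0 < c.α)
    {n : ℕ} (hn : n < c.T) (g : Fin G) (m : ℕ) (u : ℝ) :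
    ∫⁻ ω, ENNReal.ofReal (Real.exp (u * noiseSum c f g m (runVec c Z n ω) (Z n ω).1)) ∂μ
      ≤ ENNReal.ofReal (Real.exp (noiseProxy c * u ^ 2 / 2)) := by
  have hN := measurable_noiseSum hc hf (n := n) g m
  have hNe : Measurable fun p : (Fin n → Round 𝒯 𝒳 G) × 𝒯 =>
      ENNReal.ofReal (Real.exp (u * noiseSum c f g m p.1 p.2)) :=
    (Real.measurable_exp.comp (hN.const_mul u)).ennreal_ofReal
  have hV := measurable_runVec hc hrun.measurable n
  have h1 := lintegral_prompt hc hrun hn hNe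
  rw [h1, lintegral_lintegral_swap]
  swap
  · exact (hNe.comp ((hV.comp measurable_fst).prodMk measurable_snd :
      Measurable fun r : Ω × 𝒯 => (runVec c Z n r.1, r.2))).aemeasurable
  -- The current prompt is independent of the history, so it may be fixed before the exponential
  -- inequality is applied.
  have hle : ∀ t, ∫⁻ ω, ENNReal.ofReal (Real.exp (u * noiseSum c f g m (runVec c Z n ω) t)) ∂μ
      ≤ ENNReal.ofReal (Real.exp (noiseProxy c * u ^ 2 / 2)) := by
    intro t
    have hcoef : ∀ j, Measurable fun v : Fin n → Round 𝒯 𝒳 G =>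
        u * noiseCoef c (stageIndices g m v) t v j := fun j => by
      have h := (measurable_noiseCoef hc g m j).comp (measurable_prodMk_right :
        Measurable fun v : Fin n → Round 𝒯 𝒳 G => (v, t))
      exact h.const_mul u
    have hblind : ∀ j, BlindUpTo m fun v : Fin n → Round 𝒯 𝒳 G =>
        u * noiseCoef c (stageIndices g m v) t v j := fun j v v' hv =>
      congrArg (u * ·) (blind_noiseCoef g m t j v v' hv)
    -- The weight `Φ` is the inverse of the compensator. It turns the left side into the moment
    -- generating function of the noise sum, and on the right it is at most `exp (C u²/2)` because
    -- the squared coefficients sum to at most `1`.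
    have key := lintegral_noiseExp_le hc hrun hf (noiseProxy c).2 g m (hsub g m) n hn.le
      (fun v => ENNReal.ofReal (Real.exp
        (∑ j, (noiseProxy c : ℝ) / 2 * (u * noiseCoef c (stageIndices g m v) t v j) ^ 2)))
      ((Real.measurable_exp.comp (Finset.measurable_fun_sum _ fun j _ =>
        ((hcoef j).pow_const 2).const_mul _)).ennreal_ofReal)
      (fun v v' hv => by
        have h : ∀ j, noiseCoef c (stageIndices g m v) t v j
            = noiseCoef c (stageIndices g m v') t v' j := fun j => blind_noiseCoef g m t j v v' hv
        simp only [h])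
      (fun j v => u * noiseCoef c (stageIndices g m v) t v j) hcoef hblind
    have hleft : ∀ v : Fin n → Round 𝒯 𝒳 G, ENNReal.ofReal (Real.exp
        (∑ j, (noiseProxy c : ℝ) / 2 * (u * noiseCoef c (stageIndices g m v) t v j) ^ 2))
        * noiseExp c f (noiseProxy c) g m (fun j => u * noiseCoef c (stageIndices g m v) t v j) v
        = ENNReal.ofReal (Real.exp (u * noiseSum c f g m v t)) := by
      intro v
      rw [noiseExp, ← ENNReal.ofReal_mul (Real.exp_nonneg _), ← Real.exp_add,
        ← Finset.sum_add_distrib, noiseSum, Finset.mul_sum]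
      congr 3
      exact funext fun j => by ring
    have hright : ∀ v : Fin n → Round 𝒯 𝒳 G, ENNReal.ofReal (Real.exp
        (∑ j, (noiseProxy c : ℝ) / 2 * (u * noiseCoef c (stageIndices g m v) t v j) ^ 2))
        ≤ ENNReal.ofReal (Real.exp (noiseProxy c * u ^ 2 / 2)) := by
      intro v
      refine ENNReal.ofReal_le_ofReal (Real.exp_le_exp.2 ?_)
      have h := sum_noiseCoef_sq_le hk hα (nodup_stageIndices g m v) t v
      have h0 : 0 ≤ (noiseProxy c : ℝ) * u ^ 2 / 2 := by positivity
      calc _ = (noiseProxy c : ℝ) * u ^ 2 / 2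
            * ∑ j, noiseCoef c (stageIndices g m v) t v j ^ 2 := by
            rw [Finset.mul_sum]
            exact Finset.sum_congr rfl fun j _ => by ring
        _ ≤ _ := mul_le_of_le_one_right h0 h
    calc ∫⁻ ω, ENNReal.ofReal (Real.exp (u * noiseSum c f g m (runVec c Z n ω) t)) ∂μ
        = _ := lintegral_congr fun ω => (hleft (runVec c Z n ω)).symm
      _ ≤ _ := key
      _ ≤ ∫⁻ _, ENNReal.ofReal (Real.exp (noiseProxy c * u ^ 2 / 2)) ∂μ :=
          lintegral_mono fun ω => hright (runVec c Z n ω)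
      _ = _ := by rw [lintegral_const, measure_univ, mul_one]
  refine (lintegral_mono hle).trans ?_
  simp

theorem hasSubgaussianMGF_noiseSum (hc : MeasurableRules c) (hrun : IsRun c PT P Q μ Z)
    {f : Target → Fin G → 𝒯 → ℝ} (hf : ∀ τ g, Measurable (f τ g))
    (hsub : SubgaussianLabels c f hc P Q μ Z)
    (hk : ∀ t t', c.k t t' = inner ℝ (φ t) (φ t')) (hα : 0 < c.α)
    {n : ℕ} (hn : n < c.T) (g : Fin G) (m : ℕ) :
    HasSubgaussianMGF (fun ω => noiseSum c f g m (runVec c Z n ω) (Z n ω).1) (noiseProxy c) μ := by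
  have hm : Measurable fun ω => noiseSum c f g m (runVec c Z n ω) (Z n ω).1 := by
    have h := (measurable_noiseSum hc hf (n := n) g m).comp
      ((measurable_runVec hc hrun.measurable n).prodMk (hrun.measurable n).fst)
    exact h
  have hle := lintegral_exp_noiseSum_le hc hrun hf hsub hk hα hn g m
  have hme : ∀ u : ℝ, Measurable fun ω =>
      Real.exp (u * noiseSum c f g m (runVec c Z n ω) (Z n ω).1) := fun u =>
    Real.measurable_exp.comp (hm.const_mul u)
  refine ⟨fun u => ⟨(hme u).aestronglyMeasurable, ?_⟩, fun u => ?_⟩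
  · rw [hasFiniteIntegral_iff_ofReal (ae_of_all _ fun ω => Real.exp_nonneg _)]
    exact (hle u).trans_lt ENNReal.ofReal_lt_top
  · rw [mgf, integral_eq_lintegral_of_nonneg_ae (ae_of_all _ fun ω => Real.exp_nonneg _)
      (hme u).aestronglyMeasurable]
    exact ENNReal.toReal_le_of_le_ofReal (Real.exp_nonneg _) (hle u)

/-- The radius `η_σ` is calibrated so that `1 + λ` and `σ` cancel in the Chernoff exponent, leaving
`δ / (2 G M T)` for each sign. -/
theorem measure_noiseSum_gt_le (hc : MeasurableRules c) (hrun : IsRun c PT P Q μ Z)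
    {f : Target → Fin G → 𝒯 → ℝ} (hf : ∀ τ g, Measurable (f τ g))
    (hsub : SubgaussianLabels c f hc P Q μ Z)
    (hk : ∀ t t', c.k t t' = inner ℝ (φ t) (φ t')) (hα : 0 < c.α) (hlam : 0 ≤ c.lam)
    (hδ : 0 < c.δ) (hδ' : c.δ < 1) (hGMT : 1 ≤ (G * c.M * c.T : ℝ))
    {n : ℕ} (hn : n < c.T) (g : Fin G) (m : ℕ) :
    μ {ω | (1 + c.lam) * c.eta < |noiseSum c f g m (runVec c Z n ω) (Z n ω).1|}
      ≤ ENNReal.ofReal (c.δ / (G * c.M * c.T)) := by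
  have hS := hasSubgaussianMGF_noiseSum hc hrun hf hsub hk hα hn g m
  set N := fun ω => noiseSum c f g m (runVec c Z n ω) (Z n ω).1 with hN
  have hη := eta_nonneg (c := c)
  -- For `σ = 0` the Chernoff exponent would divide by zero; instead the noise sum vanishes almost
  -- surely.
  rcases eq_or_ne c.σ 0 with hσ | hσ
  · have h0 : noiseProxy c = 0 := by
      apply NNReal.coe_injective
      rw [coe_noiseProxy hlam, hσ]; simp
    rw [h0] at hS
    have hz := hS.ae_eq_zero_of_hasSubgaussianMGF_zero
    have : μ {ω | (1 + c.lam) * c.eta < |N ω|} = 0 := by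
      rw [measure_eq_zero_iff_ae_notMem]
      filter_upwards [hz] with ω hω
      simp only [not_lt, hω]
      simp only [Pi.zero_apply, abs_zero]
      positivity
    rw [this]; exact zero_le
  · have hσ' : 0 < (c.σ : ℝ) := lt_of_le_of_ne c.σ.2 fun h => hσ (NNReal.coe_injective h.symm)
    have hx : 0 ≤ (1 + c.lam) * c.eta := by positivity
    have hlog : 0 ≤ Real.log (2 * G * c.M * c.T / c.δ) := by
      apply Real.log_nonneg
      rw [one_le_div hδ]
      nlinarith
    have hexp : Real.exp (-((1 + c.lam) * c.eta) ^ 2 / (2 * (noiseProxy c : ℝ)))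
        = c.δ / (2 * (G * c.M * c.T)) := by
      have h1 : -((1 + c.lam) * c.eta) ^ 2 / (2 * (noiseProxy c : ℝ))
          = -Real.log (2 * G * c.M * c.T / c.δ) := by
        rw [coe_noiseProxy hlam, Config.eta, mul_pow, mul_pow, Real.sq_sqrt (by positivity)]
        field_simp
      rw [h1, Real.exp_neg, Real.exp_log (by
        apply div_pos _ hδ; nlinarith), inv_div]
      congr 1; ring
    have hup := hS.measure_ge_le hx
    have hdn := hS.neg.measure_ge_le hx
    rw [hexp] at hup hdn
    have hsubset : {ω | (1 + c.lam) * c.eta < |N ω|}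
        ⊆ {ω | (1 + c.lam) * c.eta ≤ N ω} ∪ {ω | (1 + c.lam) * c.eta ≤ (-N) ω} := by
      intro ω hω
      have hω' : (1 + c.lam) * c.eta < |N ω| := hω
      rcases lt_abs.1 hω' with h | h
      · exact Or.inl h.le
      · exact Or.inr h.le
    have hhalf : c.δ / (G * c.M * c.T) = c.δ / (2 * (G * c.M * c.T))
        + c.δ / (2 * (G * c.M * c.T)) := by
      field_simp; ring
    have hpos : 0 ≤ c.δ / (2 * (G * c.M * c.T)) := by positivity
    rw [hhalf, ENNReal.ofReal_add hpos hpos]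
    refine (measure_mono hsubset).trans ((measure_union_le _ _).trans (add_le_add ?_ ?_))
    · exact (ENNReal.le_ofReal_iff_toReal_le (measure_ne_top _ _) hpos).2 hup
    · exact (ENNReal.le_ofReal_iff_toReal_le (measure_ne_top _ _) hpos).2 hdn

omit [MeasurableSpace 𝒯] [MeasurableSpace 𝒳] in
theorem indexSet_eq_of_appended {h : List (Round 𝒯 𝒳 G)}
    (hh : ∀ r ∈ h, r.appended .fidelity = r.appended .diversity) (g : Fin G) (m : ℕ) :
    indexSet h .diversity g m = indexSet h .fidelity g m := by
  classical
  unfold indexSet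
  refine List.filter_congr fun r hr => ?_
  rw [hh r hr]

omit [MeasurableSpace 𝒯] [MeasurableSpace 𝒳] in
-- Both targets have the same index set, hence the same weights and deviation. Their noises
-- therefore combine into one sum, and `(1 + λ) η_σ σ̂` is exactly the noise share of the width. The
-- remaining share `(B_s + λ B_D) √α σ̂` covers the two biases.
theorem accurate_of_noiseSum_le (hk : ∀ t t', c.k t t' = inner ℝ (φ t) (φ t')) (hα : 0 < c.α)
    (hlam : 0 ≤ c.lam) {fH : Target → Fin G → H} (hfB : ∀ τ g, ‖fH τ g‖ ≤ c.B τ)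
    {n : ℕ} (v : Fin n → Round 𝒯 𝒳 G)
    (happ : ∀ j, (v j).appended .fidelity = (v j).appended .diversity) (t : 𝒯) (m : ℕ)
    (hN : ∀ g, |noiseSum c (fun τ g t => inner ℝ (φ t) (fH τ g)) g m v t| ≤ (1 + c.lam) * c.eta) :
    Accurate c (List.ofFn v) t
      (fun g => objective c (fun τ g t => inner ℝ (φ t) (fH τ g)) g t) m := by
  intro g
  have hidx : indexSet (List.ofFn v) .diversity g m = indexSet (List.ofFn v) .fidelity g m :=
    indexSet_eq_of_appended (fun r hr => by
      obtain ⟨j, rfl⟩ := (List.mem_ofFn' _ _).1 hr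
      exact happ j) g m
  have hl : indexSet (List.ofFn v) .fidelity g m = (stageIndices g m v).map v :=
    indexSet_ofFn v .fidelity g m
  have hmem : ∀ i : Fin (stageIndices g m v).length,
      InIndex .fidelity g m (v ((stageIndices g m v).get i)) := by
    intro i
    have := List.get_mem (stageIndices g m v) i
    simpa [stageIndices, indices] using this
  have hNg := hN g
  rw [noiseSum_eq] at hNg
  have hest : ∀ τ, estimate c (List.ofFn v) t τ m g
      = krrMean c.k c.α (fun i => (v ((stageIndices g m v).get i)).prompt)
        (fun i => (v ((stageIndices g m v).get i)).label τ) t := by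
    rintro (_ | _) <;> unfold estimate
    · rw [hl, krrMean_map]
    · rw [hidx, hl, krrMean_map]
  have hdev : ∀ τ, deviation c (List.ofFn v) t τ m g
      = √(krrVar c.k c.α (fun i => (v ((stageIndices g m v).get i)).prompt) t) := by
    rintro (_ | _) <;> unfold deviation
    · rw [hl, krrVar_map]
    · rw [hidx, hl, krrVar_map]
  simp only [width, objective, hest, hdev]
  generalize stageIndices g m v = l at hNg hmem ⊢
  set p : Fin l.length → 𝒯 := fun i => (v (l.get i)).prompt with hp
  set V := krrVar c.k c.α p t with hV
  set a := krrWeight c.k c.α p t with ha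
  have hV0 : 0 ≤ V := krrVar_nonneg hk hα p t
  have hnoise : |∑ i, a i * armNoise c (fun τ g t => inner ℝ (φ t) (fH τ g)) g m (v (l.get i))|
      ≤ (1 + c.lam) * c.eta * √V := by
    -- If the deviation is `0`, the normalized sum is a default value and says nothing about the
    -- noise; but then all weights vanish.
    rcases hV0.eq_or_lt with h0 | h0
    · have hz : ∀ i, a i = 0 := by
        have h1 := sum_krrWeight_sq_le hk hα p t
        rw [← hV, ← h0] at h1
        intro i
        have h2 := Finset.single_le_sum (f := fun i => a i ^ 2) (fun i _ => sq_nonneg _)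
          (Finset.mem_univ i)
        exact pow_eq_zero_iff two_ne_zero |>.1 (le_antisymm (h2.trans h1) (sq_nonneg _))
      simp [hz, ← h0]
    · rwa [abs_div, abs_of_nonneg (Real.sqrt_nonneg _), div_le_iff₀ (Real.sqrt_pos.2 h0)] at hNg
  have hbs := abs_krrBias_le hk hα p t (hfB .fidelity g)
  have hbD := abs_krrBias_le hk hα p t (hfB .diversity g)
  have hsum : ∑ i, a i * armNoise c (fun τ g t => inner ℝ (φ t) (fH τ g)) g m (v (l.get i))
      = (∑ i, a i * (v (l.get i)).label .fidelity - ∑ i, a i * inner ℝ (φ (p i)) (fH .fidelity g))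
        - c.lam * (∑ i, a i * (v (l.get i)).label .diversity
          - ∑ i, a i * inner ℝ (φ (p i)) (fH .diversity g)) := by
    simp only [armNoise, hmem, if_true, Finset.mul_sum, ← Finset.sum_sub_distrib]
    exact Finset.sum_congr rfl fun i _ => by ring
  rw [hsum] at hnoise
  rw [krrMean_eq_weight hk, krrMean_eq_weight hk, ← ha]
  simp only [Config.beta]
  rw [abs_le] at hnoise hbs hbD ⊢
  have h1 := mul_le_mul_of_nonneg_left hbD.1 hlam
  have h2 := mul_le_mul_of_nonneg_left hbD.2 hlam
  constructor <;> nlinarith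

end Tail

/-! ### Regret bounds on the good event -/

section Bounds

variable {𝒯 𝒳 : Type*} {G : ℕ} {c : Config 𝒯 𝒳 G} {z : ℕ → 𝒯 × (𝒳 × ℝ)}
  {H : Type*} [NormedAddCommGroup H] [InnerProductSpace ℝ H] {φ : 𝒯 → H}

theorem one_add_log_nonneg (hα : 0 < c.α) : 0 ≤ 1 + Real.log (1 + c.T / c.α) := by
  have : 0 ≤ (c.T : ℝ) / c.α := by positivity
  have := Real.log_nonneg (x := 1 + c.T / c.α) (by linarith)
  linarith

theorem maxInfoGain_le (hG : 1 ≤ G) (hk : ∀ t t', c.k t t' = inner ℝ (φ t) (φ t'))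
    (hα : 0 < c.α) (hnorm : ∀ t, c.k t t = 1) (τ : Target) :
    maxInfoGain c z τ ≤ (1 + Real.log (1 + c.T / c.α)) * maxEffDim c z τ := by
  have : Nonempty (Fin G × ℕ) := ⟨⟨0, hG⟩, 0⟩
  refine ciSup_le fun gm => ?_
  have hlen : (indexSet (history c z c.T) τ gm.1 gm.2).length ≤ c.T := by
    conv_rhs => rw [← length_history (c := c) (z := z) c.T]
    exact List.length_filter_le _ _
  exact (infoGain_le_effDim hk hα hnorm _ (Nat.cast_le.2 hlen)).trans
    (mul_le_mul_of_nonneg_left (effDim_le_maxEffDim τ gm.1 gm.2) (one_add_log_nonneg hα))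

/-- The information-gain term is controlled by the effective dimension. -/
theorem beta_mul_sqrt_le (hG : 1 ≤ G) (hk : ∀ t t', c.k t t' = inner ℝ (φ t) (φ t'))
    (hα : 0 < c.α) (hnorm : ∀ t, c.k t t = 1) {τ : Target} (hB : 0 ≤ c.B τ) :
    c.beta τ * √(G * c.M * c.T * maxInfoGain c z τ)
      ≤ √(1 + Real.log (1 + c.T / c.α)) * (1 + √c.α)
        * ((c.B τ + c.eta) * √(G * c.M * c.T * maxEffDim c z τ)) := by
  have hη := eta_nonneg (c := c)
  have hβ : c.beta τ ≤ (1 + √c.α) * (c.B τ + c.eta) := by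
    have h1 : 0 ≤ √c.α * c.eta := by positivity
    rw [Config.beta]
    linarith
  have hroot : √(G * c.M * c.T * maxInfoGain c z τ)
      ≤ √(1 + Real.log (1 + c.T / c.α)) * √(G * c.M * c.T * maxEffDim c z τ) := by
    rw [← Real.sqrt_mul (one_add_log_nonneg hα)]
    apply Real.sqrt_le_sqrt
    calc (G * c.M * c.T : ℝ) * maxInfoGain c z τ
        ≤ G * c.M * c.T * ((1 + Real.log (1 + c.T / c.α)) * maxEffDim c z τ) := by
          gcongr; exact maxInfoGain_le hG hk hα hnorm τ
      _ = _ := by ring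
  calc _ ≤ ((1 + √c.α) * (c.B τ + c.eta))
        * (√(1 + Real.log (1 + c.T / c.α)) * √(G * c.M * c.T * maxEffDim c z τ)) := by
        gcongr
    _ = _ := by ring

theorem gainSum_le (hG : 1 ≤ G) (hk : ∀ t t', c.k t t' = inner ℝ (φ t) (φ t')) (hα : 0 < c.α)
    (hlam : 0 ≤ c.lam) (hnorm : ∀ t, c.k t t = 1) (hB : ∀ τ, 0 ≤ c.B τ) :
    gainSum c z ≤ √(1 + Real.log (1 + c.T / c.α)) * (1 + √c.α) *
      ((c.B .fidelity + c.eta) * √(G * c.M * c.T * maxEffDim c z .fidelity) +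
        c.lam * ((c.B .diversity + c.eta) * √(G * c.M * c.T * maxEffDim c z .diversity))) := by
  have h1 := beta_mul_sqrt_le (z := z) hG hk hα hnorm (hB .fidelity)
  have h2 := mul_le_mul_of_nonneg_left
    (beta_mul_sqrt_le (z := z) hG hk hα hnorm (hB .diversity)) hlam
  rw [gainSum]
  linarith

theorem gainSum_nonneg (hlam : 0 ≤ c.lam) (hB : ∀ τ, 0 ≤ c.B τ) : 0 ≤ gainSum c z := by
  have h := fun τ => beta_nonneg (hB τ)
  have h1 := h .fidelity
  have h2 := h .diversity
  unfold gainSum; positivity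

/-- At horizon two the information-gain bound holds for every run with `b √T > 1`. -/
theorem regret_le_of_T_eq_two (hG : 1 ≤ G) (hT : c.T = 2) (hα : 0 < c.α) (hlam : 0 ≤ c.lam)
    (hk : ∀ t t', c.k t t' = inner ℝ (φ t) (φ t')) (hnorm : ∀ t, c.k t t = 1)
    {f : Target → Fin G → 𝒯 → ℝ} (hB : ∀ τ, 0 ≤ c.B τ) (hf : ∀ τ g t, |f τ g t| ≤ c.B τ)
    (hM : 1 ≤ c.M) (hb : 1 < (c.B .fidelity + c.lam * c.B .diversity) * √(c.T : ℝ)) :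
    regret c f z ≤ 4 * (√(1 + 1 / c.α) * gainSum c z) := by
  have hb0 : 0 ≤ c.B .fidelity + c.lam * c.B .diversity :=
    add_nonneg (hB _) (mul_nonneg hlam (hB _))
  have h1 := regret_le_trivial (c := c) (z := z) hG hlam hf
  have h2 := le_gainSum (c := c) (z := z) hG (by omega) hα hlam hk hnorm hB hb
  have h3 : 1 ≤ √((G : ℝ) * c.M * c.T / 2) := by
    rw [Real.one_le_sqrt, hT]
    have hG' : (1 : ℝ) ≤ G := by exact_mod_cast hG
    have hM' : (1 : ℝ) ≤ c.M := by exact_mod_cast hM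
    push_cast
    nlinarith
  have h4 := (le_mul_of_one_le_right hb0 h3).trans h2
  rw [hT] at h1
  push_cast at h1
  linarith

/-- Regret bounds in terms of the information gain, once the confidence intervals hold. -/
theorem regret_bounds (hG : 1 ≤ G) (hT : 2 ≤ c.T) (hα : 0 < c.α) (hlam : 0 ≤ c.lam)
    (hk : ∀ t t', c.k t t' = inner ℝ (φ t) (φ t')) (hnorm : ∀ t, c.k t t = 1)
    (hpick : ∀ v S, S.Nonempty → c.pick v S ∈ S) {f : Target → Fin G → 𝒯 → ℝ}
    (hB : ∀ τ, 0 ≤ c.B τ) (hf : ∀ τ g t, |f τ g t| ≤ c.B τ)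
    (hacc : ∀ i < c.T, ∀ m ∈ Finset.Icc 1 c.M,
      Accurate c (history c z i) (z i).1 (fun g => objective c f g (z i).1) m) :
    regret c f z ≤ 16 * (√(c.T : ℝ) + (1 + (c.B .fidelity + c.lam * c.B .diversity))
        * (√(1 + 1 / c.α) * gainSum c z)) ∧
      (1 < (c.B .fidelity + c.lam * c.B .diversity) * √(c.T : ℝ) →
        regret c f z ≤ 16 * (1 + (c.B .fidelity + c.lam * c.B .diversity)
          + (c.B .fidelity + c.lam * c.B .diversity)⁻¹) * (√(1 + 1 / c.α) * gainSum c z)) := by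
  have hM1 : 1 ≤ c.M := Nat.clog_pos one_lt_two hT
  have hX0 : 0 ≤ √(1 + 1 / c.α) * gainSum c z :=
    mul_nonneg (Real.sqrt_nonneg _) (gainSum_nonneg hlam hB)
  have hb0 : 0 ≤ c.B .fidelity + c.lam * c.B .diversity :=
    add_nonneg (hB _) (mul_nonneg hlam (hB _))
  have hs0 : 0 ≤ √(c.T : ℝ) := Real.sqrt_nonneg _
  -- For `T = 2` one has `M = 1`, and the threshold `2^0` is above `1/√2`, so the inner loop may
  -- pass stage `M`, where no confidence interval is available. The trivial regret bound `4b` is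
  -- used in this case.
  rcases hT.eq_or_lt with hT2 | hT3
  · have htwo := regret_le_of_T_eq_two (z := z) hG hT2.symm hα hlam hk hnorm hB hf hM1
    have htriv := regret_le_trivial (c := c) (z := z) hG hlam hf
    set b := c.B .fidelity + c.lam * c.B .diversity with hb
    set X := √(1 + 1 / c.α) * gainSum c z with hX
    have hbX : 0 ≤ b * X := mul_nonneg hb0 hX0
    have hbX' : 0 ≤ b⁻¹ * X := mul_nonneg (inv_nonneg.2 hb0) hX0
    refine ⟨?_, fun h => ?_⟩
    · by_cases h : 1 < b * √(c.T : ℝ)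
      · linarith [htwo h]
      -- From `b √2 ≤ 1` follows `2b ≤ √2`, so the trivial bound `4b` fits into the additive `√T`
      -- term.
      · have hs : √(c.T : ℝ) * √(c.T : ℝ) = 2 := by
          rw [Real.mul_self_sqrt (Nat.cast_nonneg _), ← hT2]; norm_num
        have h5 := mul_le_mul_of_nonneg_right (not_lt.1 h) hs0
        rw [mul_assoc, hs, one_mul] at h5
        rw [← hT2] at htriv
        push_cast at htriv
        linarith
    · linarith [htwo h]
  · have hM2 : 2 ≤ c.M := by
      by_contra h
      have h1 : c.T ≤ 2 ^ c.M := Nat.le_pow_clog one_lt_two _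
      have h2 : 2 ^ c.M ≤ 2 ^ 1 := Nat.pow_le_pow_right (by norm_num) (by omega)
      omega
    -- This is `T ≤ 2^M ≤ 2^(2(M-1))`, where the second inequality needs `M ≥ 2`.
    have hM : (2 : ℝ) ^ (1 - (c.M : ℤ)) ≤ 1 / √(c.T : ℝ) := by
      obtain ⟨k, hkM⟩ : ∃ k, c.M = k + 2 := ⟨c.M - 2, by omega⟩
      have h1 : c.T ≤ 2 ^ c.M := Nat.le_pow_clog one_lt_two _
      have h2 : (c.T : ℝ) ≤ (2 ^ (k + 1)) ^ 2 := by
        have h3 : (2 : ℕ) ^ c.M ≤ (2 ^ (k + 1)) ^ 2 := by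
          rw [← pow_mul]; exact Nat.pow_le_pow_right (by norm_num) (by omega)
        exact_mod_cast h1.trans h3
      have h4 : (1 - (c.M : ℤ)) = -((k + 1 : ℕ) : ℤ) := by rw [hkM]; push_cast; ring
      rw [h4, zpow_neg, zpow_natCast, ← one_div]
      refine one_div_le_one_div_of_le (Real.sqrt_pos.2 (by positivity)) ?_
      rw [← Real.sqrt_sq (by positivity : (0 : ℝ) ≤ 2 ^ (k + 1))]
      exact Real.sqrt_le_sqrt h2
    have hmain := regret_le_of_accurate hG (by omega) hα hlam hk hnorm hpick hB hf hM1 hM hacc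
    have hlow := le_gainSum (c := c) (z := z) hG (by omega) hα hlam hk hnorm hB
    rw [mul_assoc (1 + _)] at hmain
    set b := c.B .fidelity + c.lam * c.B .diversity with hb
    set X := √(1 + 1 / c.α) * gainSum c z with hX
    refine ⟨by linarith, fun h => ?_⟩
    have hbpos : 0 < b := by
      rcases hb0.eq_or_lt with h0 | h0
      · rw [← h0] at h; linarith
      · exact h0
    -- Here `G M ≥ 2` pays for the factor `1/2` in the lower bound on the confidence sum.
    have hroot : √(c.T : ℝ) ≤ √((G : ℝ) * c.M * c.T / 2) := by
      apply Real.sqrt_le_sqrt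
      have hG' : (1 : ℝ) ≤ G := by exact_mod_cast hG
      have hM' : (2 : ℝ) ≤ c.M := by exact_mod_cast hM2
      have hGM : (2 : ℝ) ≤ G * c.M := by nlinarith
      have := mul_le_mul_of_nonneg_right hGM (Nat.cast_nonneg (α := ℝ) c.T)
      linarith
    have h1 : b * √(c.T : ℝ) ≤ X := (mul_le_mul_of_nonneg_left hroot hb0).trans (hlow h)
    have h2 : √(c.T : ℝ) ≤ b⁻¹ * X := by
      rw [inv_mul_eq_div, le_div_iff₀ hbpos]; linarith
    linarith

end Bounds

/-! ### Probability of the good event -/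

section GoodEvent

variable {𝒯 𝒳 Ω : Type*} [MeasurableSpace 𝒯] [MeasurableSpace 𝒳] [MeasurableSpace Ω] {G : ℕ}
  {H : Type*} [NormedAddCommGroup H] [InnerProductSpace ℝ H]

/-- Elements of an RKHS with measurable kernel sections are measurable functions. -/
theorem measurable_coe_of_kernel [CompleteSpace H] [RKHS ℝ H 𝒯 ℝ]
    (hker : ∀ t', Measurable fun t => RKHS.kernel H t t' (1 : ℝ)) (f : H) :
    Measurable fun t => f t := by
  -- Kernel sections span a dense subspace and evaluations are continuous, so `f` is a pointwise
  -- limit of a sequence of measurable functions.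
  have hf : f ∈ closure (Submodule.span ℝ {RKHS.kerFun H x v | (x : 𝒯) (v : ℝ)} : Set H) := by
    have h := RKHS.kerFun_dense (𝕜 := ℝ) (X := 𝒯) (V := ℝ) H
    rw [← Submodule.topologicalClosure_coe, h]
    exact Submodule.mem_top
  obtain ⟨F, hF, hlim⟩ := mem_closure_iff_seq_limit.1 hf
  refine measurable_of_tendsto_metrizable (f := fun n t => F n t) (fun n => ?_)
    (tendsto_pi_nhds.2 fun t => ((RKHS.continuous_eval t).tendsto f).comp hlim)
  refine Submodule.span_induction (p := fun x _ => Measurable fun t => x t) ?_ ?_ ?_ ?_ (hF n)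
  · rintro _ ⟨x, v, rfl⟩
    have h : ∀ t, RKHS.kerFun H x v t = v * RKHS.kernel H t x (1 : ℝ) := fun t => by
      rw [RKHS.kerFun_apply]
      conv_lhs => rw [← mul_one v, ← smul_eq_mul, map_smul]
      rfl
    simp only [h]
    exact (hker x).const_mul v
  · simp
  · intro x y _ _ hx hy
    simp only [RKHS.coe_add]
    exact hx.add hy
  · intro a x _ hx
    simp only [RKHS.coe_smul]
    exact hx.const_smul a

variable {c : Config 𝒯 𝒳 G} {PT : Measure 𝒯} [IsProbabilityMeasure PT]
  {P : Fin G → Kernel 𝒯 𝒳} [∀ g, IsMarkovKernel (P g)]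
  {Q : Fin G → Kernel (𝒯 × 𝒳) ℝ} [∀ g, IsMarkovKernel (Q g)]
  {μ : Measure Ω} [IsProbabilityMeasure μ] {Z : ℕ → Ω → 𝒯 × (𝒳 × ℝ)} {φ : 𝒯 → H}

/-- With probability at least `1 - δ`, all noise sums are at most `(1 + λ) η_σ`. -/
theorem measure_exists_noiseSum_gt_le (hc : MeasurableRules c) (hrun : IsRun c PT P Q μ Z)
    {f : Target → Fin G → 𝒯 → ℝ} (hf : ∀ τ g, Measurable (f τ g))
    (hsub : SubgaussianLabels c f hc P Q μ Z)
    (hk : ∀ t t', c.k t t' = inner ℝ (φ t) (φ t')) (hα : 0 < c.α) (hlam : 0 ≤ c.lam)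
    (hδ : 0 < c.δ) (hδ' : c.δ < 1) (hG : 1 ≤ G) (hM : 1 ≤ c.M) :
    μ {ω | ∃ i < c.T, ∃ m ∈ Finset.Icc 1 c.M, ∃ g,
        (1 + c.lam) * c.eta < |noiseSum c f g m (runVec c Z i ω) (Z i ω).1|}
      ≤ ENNReal.ofReal c.δ := by
  have hG' : (1 : ℝ) ≤ G := by exact_mod_cast hG
  have hM' : (1 : ℝ) ≤ c.M := by exact_mod_cast hM
  have hT' : (1 : ℝ) ≤ c.T := by exact_mod_cast hc.one_le_T
  have hGMT : 1 ≤ (G * c.M * c.T : ℝ) := by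
    have := one_le_mul_of_one_le_of_one_le hG' hM'
    exact one_le_mul_of_one_le_of_one_le this hT'
  set s := Finset.range c.T ×ˢ (Finset.Icc 1 c.M ×ˢ (Finset.univ : Finset (Fin G))) with hs
  set E : ℕ × (ℕ × Fin G) → Set Ω := fun q => {ω | (1 + c.lam) * c.eta
    < |noiseSum c f q.2.2 q.2.1 (runVec c Z q.1 ω) (Z q.1 ω).1|} with hE
  calc _ ≤ μ (⋃ q ∈ s, E q) := by
        refine measure_mono ?_
        rintro ω ⟨i, hi, m, hm, g, h⟩
        refine Set.mem_iUnion₂.2 ⟨(i, m, g), ?_, h⟩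
        rw [hs, Finset.mem_product, Finset.mem_product]
        exact ⟨Finset.mem_range.2 hi, hm, Finset.mem_univ _⟩
    _ ≤ ∑ q ∈ s, μ (E q) := measure_biUnion_finset_le _ _
    _ ≤ ∑ _q ∈ s, ENNReal.ofReal (c.δ / (G * c.M * c.T)) := by
        refine Finset.sum_le_sum fun q hq => ?_
        rw [hs, Finset.mem_product] at hq
        exact measure_noiseSum_gt_le hc hrun hf hsub hk hα hlam hδ hδ' hGMT
          (Finset.mem_range.1 hq.1) q.2.2 q.2.1
    _ = ENNReal.ofReal c.δ := by
        rw [Finset.sum_const, hs, Finset.card_product, Finset.card_product, Finset.card_range,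
          Nat.card_Icc, Finset.card_univ, Fintype.card_fin, Nat.add_sub_cancel, nsmul_eq_mul,
          ← ENNReal.ofReal_natCast, ← ENNReal.ofReal_mul (Nat.cast_nonneg _)]
        congr 1
        push_cast
        field_simp

end GoodEvent

end

end SupDAK

/-! ### The regret theorem. -/

open SupDAK in
theorem mainTheorem1
    {𝒯 𝒳 Ω H : Type*} [MeasurableSpace 𝒯] [MeasurableSpace 𝒳] [MeasurableSpace Ω]
    [NormedAddCommGroup H] [InnerProductSpace ℝ H] [CompleteSpace H] [RKHS ℝ H 𝒯 ℝ]
    {G : ℕ} (hG : 1 ≤ G) (c : Config 𝒯 𝒳 G)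
    -- parameters
    (hT : 2 ≤ c.T) (hlam : 0 ≤ c.lam) (hα : 0 < c.α) (hδ : 0 < c.δ) (hδ' : c.δ < 1)
    -- the normalized prompt kernel is the kernel of the RKHS `H`
    (hker : ∀ t t', c.k t t' = RKHS.kernel H t t' 1) (hnorm : ∀ t, c.k t t = 1)
    -- selection rules return an eligible arm
    (hpick : ∀ v S, S.Nonempty → c.pick v S ∈ S)
    -- measurability of the kernel, the selection rule and the label rule
    (hkm : Measurable fun p : 𝒯 × 𝒯 => c.k p.1 p.2)
    (hpickm : ∀ S, Measurable fun v => c.pick v S)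
    (hdivm : ∀ g n, Measurable fun p : (Fin n → 𝒯 × 𝒳) × (𝒯 × 𝒳) =>
      c.divLabel g (List.ofFn p.1) p.2)
    -- fidelity `s_g = f .fidelity g` and diversity `D_g = f .diversity g` lie in balls of `H`
    (f : Target → Fin G → H) (hf : ∀ τ g, ‖f τ g‖ ≤ c.B τ)
    -- prompt law, models, fidelity observations
    (PT : Measure 𝒯) [IsProbabilityMeasure PT]
    (P : Fin G → Kernel 𝒯 𝒳) [∀ g, IsMarkovKernel (P g)]
    (Q : Fin G → Kernel (𝒯 × 𝒳) ℝ) [∀ g, IsMarkovKernel (Q g)]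
    -- the run
    (μ : Measure Ω) [IsProbabilityMeasure μ] (Z : ℕ → Ω → 𝒯 × (𝒳 × ℝ))
    (hrun : IsRun c PT P Q μ Z)
    -- given the history, the observations are unbiased with `σ`-sub-Gaussian noise; the conditional
    -- law of the output and the fidelity observation of round `i` is that of the selected arm
    (hsubs : ∀ i < c.T, ∀ᵐ ω ∂μ,
      HasSubgaussianMGF
        (fun q : 𝒳 × ℝ => q.2 - f .fidelity (chosenArm c (fun j => Z j ω) i) (Z i ω).1)
        (c.σ ^ 2)
        ((P (chosenArm c (fun j => Z j ω) i) ⊗ₖ Q (chosenArm c (fun j => Z j ω) i)) (Z i ω).1))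
    (hsubD : ∀ i < c.T, ∀ᵐ ω ∂μ,
      HasSubgaussianMGF
        (fun x : 𝒳 => c.divLabel (chosenArm c (fun j => Z j ω) i)
            (usedSnapshot c (fun j => Z j ω) i) ((Z i ω).1, x)
          - f .diversity (chosenArm c (fun j => Z j ω) i) (Z i ω).1)
        (c.σ ^ 2)
        (P (chosenArm c (fun j => Z j ω) i) (Z i ω).1)) :
    -- with `b = B_s + λ B_D`, outside an event of probability at most `δ`:
    μ {ω | ¬ (
      -- regret bound at every horizon
      (regret c (fun τ g t => f τ g t) (fun i => Z i ω) ≤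
        16 * (√(c.T : ℝ) + (1 + (c.B .fidelity + c.lam * c.B .diversity)) * √(1 + 1 / c.α) *
          (c.beta .fidelity * √(G * c.M * c.T * maxInfoGain c (fun i => Z i ω) .fidelity) +
            c.lam * (c.beta .diversity *
              √(G * c.M * c.T * maxInfoGain c (fun i => Z i ω) .diversity))))) ∧
      -- without the additive `√T`, as soon as `b √T > 1`
      (1 < (c.B .fidelity + c.lam * c.B .diversity) * √(c.T : ℝ) →
        regret c (fun τ g t => f τ g t) (fun i => Z i ω) ≤
        16 * (1 + (c.B .fidelity + c.lam * c.B .diversity) +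
            (c.B .fidelity + c.lam * c.B .diversity)⁻¹) * √(1 + 1 / c.α) *
          (c.beta .fidelity * √(G * c.M * c.T * maxInfoGain c (fun i => Z i ω) .fidelity) +
            c.lam * (c.beta .diversity *
              √(G * c.M * c.T * maxInfoGain c (fun i => Z i ω) .diversity)))) ∧
      -- the same with the effective dimension
      (regret c (fun τ g t => f τ g t) (fun i => Z i ω) ≤
        16 * (√(c.T : ℝ) + (1 + (c.B .fidelity + c.lam * c.B .diversity)) * √(1 + 1 / c.α) *
          √(1 + Real.log (1 + c.T / c.α)) * (1 + √c.α) *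
          ((c.B .fidelity + c.eta) * √(G * c.M * c.T * maxEffDim c (fun i => Z i ω) .fidelity) +
            c.lam * ((c.B .diversity + c.eta) *
              √(G * c.M * c.T * maxEffDim c (fun i => Z i ω) .diversity))))))}
      ≤ ENNReal.ofReal c.δ := by
  classical
  have hc : MeasurableRules c := ⟨by omega, hkm, hpickm, hdivm⟩
  -- The canonical feature map: the reproducing property turns kernel values and function values
  -- into inner products, the form in which the KRR facts are stated.
  set φ : 𝒯 → H := fun t => RKHS.kerFun H t 1 with hφ
  have hk : ∀ t t', c.k t t' = inner ℝ (φ t) (φ t') := fun t t' => by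
    rw [hker, hφ, RKHS.kerFun_inner, RKHS.kerFun_apply]
    simp
  have heval : ∀ τ g t, f τ g t = inner ℝ (φ t) (f τ g) := fun τ g t => by
    rw [hφ, RKHS.kerFun_inner]
    simp
  have hφ1 : ∀ t, ‖φ t‖ = 1 := fun t => by
    have h := real_inner_self_eq_norm_sq (φ t)
    rw [← hk, hnorm] at h
    exact (pow_eq_one_iff_of_nonneg (norm_nonneg _) two_ne_zero).1 h.symm
  have hfB : ∀ τ g t, |f τ g t| ≤ c.B τ := fun τ g t => by
    rw [heval]
    have h := abs_real_inner_le_norm (φ t) (f τ g)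
    rw [hφ1, one_mul] at h
    exact h.trans (hf τ g)
  have hB : ∀ τ, 0 ≤ c.B τ := fun τ => (norm_nonneg _).trans (hf τ ⟨0, hG⟩)
  have hfm : ∀ τ g, Measurable fun t => f τ g t := fun τ g =>
    measurable_coe_of_kernel (fun t' => by
      have h : Measurable fun t => c.k t t' := hkm.comp measurable_prodMk_right
      simpa only [hker] using h) (f τ g)
  have hM1 : 1 ≤ c.M := Nat.clog_pos one_lt_two hT
  have hsub : SubgaussianLabels c (fun τ g t => f τ g t) hc P Q μ Z := by
    intro g m i hi
    filter_upwards [hsubs i hi, hsubD i hi] with ω h1 h2 u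
    have hh : history c (fun j => Z j ω) i = List.ofFn (runVec c Z i ω) :=
      (ofFn_historyVec _ _).symm
    simp only [usedSnapshot, chosenArm, hh] at h1 h2
    exact lintegral_exp_armNoise_le_one hc hlam (f := fun τ g t => f τ g t) (runVec c Z i ω)
      (Z i ω).1 h1 h2 g m u
  -- Monotonicity of the outer measure suffices, so the failure event itself need not be measurable.
  refine (measure_mono ?_).trans (measure_exists_noiseSum_gt_le hc hrun
    (f := fun τ g t => f τ g t) hfm hsub hk hα hlam hδ hδ' hG hM1)
  intro ω hω
  by_contra hgood
  refine hω ?_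
  have hN : ∀ i < c.T, ∀ m ∈ Finset.Icc 1 c.M, ∀ g,
      |noiseSum c (fun τ g t => f τ g t) g m (runVec c Z i ω) (Z i ω).1|
        ≤ (1 + c.lam) * c.eta := fun i hi m hm g => by
    by_contra h
    exact hgood ⟨i, hi, m, hm, g, not_le.1 h⟩
  have hacc : ∀ i < c.T, ∀ m ∈ Finset.Icc 1 c.M,
      Accurate c (history c (fun i => Z i ω) i) (Z i ω).1
        (fun g => objective c (fun τ g t => f τ g t) g (Z i ω).1) m := by
    intro i hi m hm
    have hh : history c (fun j => Z j ω) i = List.ofFn (runVec c Z i ω) :=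
      (ofFn_historyVec _ _).symm
    rw [hh]
    have h := hN i hi m hm
    simp only [heval] at h ⊢
    -- A round is appended to both index sets or to neither by construction, hence the `rfl`.
    exact accurate_of_noiseSum_le hk hα hlam hf (runVec c Z i ω) (fun _ => rfl) (Z i ω).1 m h
  obtain ⟨h1, h2⟩ := regret_bounds (z := fun i => Z i ω) hG hT hα hlam hk hnorm hpick hB hfB hacc
  have hle := gainSum_le (z := fun i => Z i ω) hG hk hα hlam hnorm hB
  have hb0 : 0 ≤ c.B .fidelity + c.lam * c.B .diversity :=
    add_nonneg (hB _) (mul_nonneg hlam (hB _))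
  refine ⟨?_, fun h => ?_, ?_⟩
  · simpa only [gainSum, mul_assoc] using h1
  · simpa only [gainSum, mul_assoc] using h2 h
  · refine h1.trans ?_
    have h3 : 0 ≤ (1 + (c.B .fidelity + c.lam * c.B .diversity)) * √(1 + 1 / c.α) := by
      positivity
    have h4 := mul_le_mul_of_nonneg_left hle h3
    simp only [mul_assoc] at h4 ⊢
    linarith
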